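/- **Setting.** Let $B$ be a smooth complex variety, $L$ a divisor on $B$, and $y^2=x^3+fx+g$ a Weierstrass model over $B$ with $f\in H^0(\mathcal O_B(4L))$, $g\in H^0(\mathcal O_B(6L))$ and $\Delta=4f^3+27g^2\neq0$; assume that there is no point of codimension two of $B$ at which $\operatorname{mult}f\ge4$ and $\operatorname{mult}g\ge6$. Let $\Sigma\subset B$ be a prime divisor with local equation $z=0$ and with one of the following Kodaira types, given by the orders of vanishing of $(f,g,\Delta)$ along $\Sigma$: $I_m$, $m\ge2$: $(0,0,m)$; $III$: $(1,\ge2,3)$; $IV$: $(\ge2,2,4)$; $I_0^*$: $(\ge2,\ge3,6)$; $I_k^*$, $k\ge1$: $(2,3,k+6)$; $IV^*$: $(\ge3,4,8)$; $III^*$: $(3,\ge5,9)$; $II^*$: $(\ge4,5,10)$. Let $m_\Sigma$ be the order of $\Delta$ along $\Sigma$. Define the following rational sections of line bundles on $\Sigma$. * $\delta_\Sigma=(\Delta/z^{m_\Sigma})|_\Sigma$. * $\beta_\Sigma=(-9g/2f)|_\Sigma$ for $I_m$, $m\ge3$; $(g/z^2)|_\Sigma$ for $IV$; $(g/z^4)|_\Sigma$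 for $IV^*$; and, for $I_k^*$, $\delta_\Sigma/\gamma_\Sigma^3$ if $k\ge1$ is odd and $-\delta_\Sigma/\gamma_\Sigma^2$ if $k\ge2$ is even. * $\gamma_\Sigma=\delta_\Sigma\,(4f^2/81g^2)|_\Sigma$ for $I_m$, $m\ge2$; $(f/z)|_\Sigma$ for $III$; $(-9g/2zf)|_\Sigma$ for $I_k^*$, $k\ge1$; $(f/z^3)|_\Sigma$ for $III^*$; $(g/z^5)|_\Sigma$ for $II^*$. The gauge algebra $\mathfrak g(\Sigma)$ is: $\mathfrak{su}(2)$ for $I_2$ and $III$; for $I_m$, $m\ge3$: $\mathfrak{su}(m)$ if $\beta_\Sigma$ is a square (at the generic point of $\Sigma$), otherwise $\mathfrak{sp}(\lfloor m/2\rfloor)$; for $IV$: $\mathfrak{su}(3)$ if $\beta_\Sigma$ is a square, otherwise $\mathfrak{sp}(1)$; for $I_0^*$: $\mathfrak g_2$, $\mathfrak{so}(7)$ or $\mathfrak{so}(8)$ according as $\psi^3+(f/z^2)|_\Sigma\,\psi+(g/z^3)|_\Sigma$ over the function field of $\Sigma$ is irreducible, is a linear times an irreducible quadratic factor, or splits;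 for $I_k^*$, $k\ge1$: $\mathfrak{so}(2k+8)$ if $\beta_\Sigma$ is a square, otherwise $\mathfrak{so}(2k+7)$; for $IV^*$: $\mathfrak e_6$ if $\beta_\Sigma$ is a square, otherwise $\mathfrak f_4$; $\mathfrak e_7$ for $III^*$; $\mathfrak e_8$ for $II^*$. Here $\mathfrak{sp}(1)=\mathfrak{su}(2)$. **Representations** in $R(\mathfrak g(\Sigma))\otimes\mathbb Q$, where $\mathrm{spin}_*$ is the spinor representation (for $\mathfrak{so}(\ell)$ with $\ell$ even, a fixed one of the two half-spinor representations $\mathrm{spin}_\pm$): * $\rho_\alpha=\mathrm{adj}+\rho'$ with $\rho'=2\,\mathrm{fund}$ for $\mathfrak{sp}(1)$ (types $I_3$, $IV$ with $\beta_\Sigma$ not a square); $\Lambda^2_{\rm irr}$ for $I_{2n}$, $\mathfrak{sp}(n)$, $n\ge2$; $\Lambda^2_{\rm irr}+2\,\mathrm{fund}$ for $I_{2n+1}$, $\mathfrak{sp}(n)$, $n\ge2$; $2\cdot\mathbf 7$ for $\mathfrak g_2$; $\mathrm{vect}$ for $\mathfrak{so}(\text{odd})$; $\mathbf{26}$ for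 $\mathfrak f_4$; and $\rho'=0$ otherwise. * $\rho_{\sqrt\beta}=\mathrm{fund}$ for $I_3$; $\Lambda^2$ for $I_m$, $m\ge4$, $\mathfrak{su}(m)$; $\Lambda^2_{\rm irr}$ for $I_{2n}$ and $\Lambda^2_{\rm irr}+\mathrm{fund}$ for $I_{2n+1}$, $\mathfrak{sp}(n)$, $n\ge2$; $3\,\mathrm{fund}$ for $IV$; $\mathrm{vect}$ for $I_k^*$, $k\ge1$; $\mathbf{27}$ for $\mathfrak e_6$; $\mathbf{26}$ for $\mathfrak f_4$; $0$ otherwise. * $\rho_\gamma=\mathrm{fund}$ for $I_m$; $2\,\mathrm{fund}$ for $III$; $\mathrm{spin}_*$, $\frac12\mathrm{spin}_*$, $\frac14\mathrm{spin}_*+\mathrm{vect}$ for $I_1^*$, $I_2^*$, $I_3^*$; $\frac12\cdot\mathbf{56}$ for $III^*$; $0$ otherwise. The **Tate cycle** in $A^1(\Sigma)\otimes R(\mathfrak g(\Sigma))\otimes\mathbb Q$ is $$Z_{\mathrm{Tate},\Sigma}=\tfrac12(-L+\Sigma)|_\Sigma\otimes\rho_\alpha+\tfrac12\operatorname{div}(\beta_\Sigma)\otimes\rho_{\sqrt\beta}+\operatorname{div}(\gamma_\Sigma)\otimes\rho_\gamma,$$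 where, for type $I_0^*$, the last two terms are replaced by $\frac12\operatorname{div}(\delta_\Sigma)\otimes\mathbf 7$ for $\mathfrak g_2$, by $\frac13\operatorname{div}(\delta_\Sigma)\otimes\mathrm{spin}+\frac16\operatorname{div}(\delta_\Sigma)\otimes\mathrm{vect}$ for $\mathfrak{so}(7)$, and by $\frac16\operatorname{div}(\delta_\Sigma)\otimes(\mathrm{vect}+\mathrm{spin}_++\mathrm{spin}_-)$ for $\mathfrak{so}(8)$. **Classes $\Gamma_\rho$** (restricted to $\Sigma$; all others are $0$): $\Gamma_{\rm adj}=\frac12(-L+\Sigma)$ for every algebra, and * $\mathfrak{su}(2)$: $\Gamma_{\rm fund}=8L-2\Sigma$; $\mathfrak{su}(3)$: $\Gamma_{\rm fund}=9L-3\Sigma$; $\mathfrak{su}(m)$, $m\ge4$: $\Gamma_{\rm fund}=8L-m\Sigma$, $\Gamma_{\Lambda^2}=L$; * $\mathfrak{sp}(n)$, $n\ge2$: $\Gamma_{\rm fund}=8L-2n\Sigma$, $\Gamma_{\Lambda^2_{\rm irr}}=\frac12(L+\Sigma)$; * $\mathfrak{so}(\ell)$, $7\le\ell\le14$: $\Gamma_{\rm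 vect}=\frac12((\ell-4)L+(6-\ell)\Sigma)$, and $\Gamma_{\mathrm{spin}_*}=\frac1{\dim\mathrm{spin}_*}(32L-16\Sigma)$ if $\ell\ne8$, $\Gamma_{\mathrm{spin}_+}=\Gamma_{\mathrm{spin}_-}=2L-\Sigma$ if $\ell=8$; * for $n\ge4$, $\Gamma_{\rm vect}=\frac72L-(n-\frac12)\Sigma$ for $\mathfrak{so}(4n-1)$; $4L-n\Sigma$ for $\mathfrak{so}(4n)$; $\frac52L-(n-\frac12)\Sigma$ for $\mathfrak{so}(4n+1)$; $3L-n\Sigma$ for $\mathfrak{so}(4n+2)$; * $\mathfrak e_6$: $\Gamma_{\mathbf{27}}=3L-2\Sigma$; $\mathfrak e_7$: $\Gamma_{\mathbf{56}}=\frac12(4L-3\Sigma)$; $\mathfrak f_4$: $\Gamma_{\mathbf{26}}=\frac12(5L-3\Sigma)$; $\mathfrak g_2$: $\Gamma_{\mathbf 7}=5L-2\Sigma$. **Traces.** Let $X^{(k)}(\sum_\rho Z_\rho\otimes\rho)=\sum_\rho Z_\rho\otimes\operatorname{Tr}_\rho F^k$, with values in $A^1(\Sigma)$ tensored with the Casimir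 operators (invariant polynomials in $F$) of $\mathfrak g(\Sigma)$, and let $\operatorname{tr}F^2$ be $\operatorname{Tr}_{\rm fund}F^2$ for $\mathfrak{su}(m)$ and $\mathfrak{sp}(n)$, $\frac12\operatorname{Tr}_{\rm vect}F^2$ for $\mathfrak{so}(\ell)$, and $\frac16\operatorname{Tr}_{\mathbf{27}}F^2$, $\frac1{12}\operatorname{Tr}_{\mathbf{56}}F^2$, $\frac1{60}\operatorname{Tr}_{\rm adj}F^2$, $\frac16\operatorname{Tr}_{\mathbf{26}}F^2$, $\frac12\operatorname{Tr}_{\mathbf 7}F^2$ for $\mathfrak e_6,\mathfrak e_7,\mathfrak e_8,\mathfrak f_4,\mathfrak g_2$. **Theorem.** For every Kodaira type and gauge algebra as above, $Z_{\mathrm{Tate},\Sigma}$ is rationally equivalent to $\sum_\rho\Gamma_\rho\otimes\rho$, that is, $$Z_{\mathrm{Tate},\Sigma}=\sum_\rho\Gamma_\rho\otimes\rho\quad\text{in }A^1(\Sigma)\otimes R(\mathfrak g(\Sigma))\otimes\mathbb Q,$$ where the $\Gamma_\rho$ are given in terms of $L|_\Sigma$ and $\Sigma|_\Sigma$ by the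 list above and depend otherwise only on $\mathfrak g(\Sigma)$. Moreover $$X^{(2)}(Z_{\mathrm{Tate},\Sigma})=6L|_\Sigma\otimes\operatorname{tr}F^2,\qquad X^{(4)}(Z_{\mathrm{Tate},\Sigma})=3\,\Sigma|_\Sigma\otimes(\operatorname{tr}F^2)^2.$$ -/

import Mathlib

open AlgebraicGeometry CategoryTheory
open scoped TensorProduct

noncomputable section

namespace FTheory

/-! ## Divisors and the first Chow group of an integral scheme -/

/-- A Cartier divisor on an integral scheme: a nonzero rational function `eqn x` (the local
equation) at every point `x`, such that near each point all of them are given by a single rational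
function, up to units of the local rings. -/
structure CartierDivisor (X : Scheme.{0}) [IsIntegral X] where
  eqn : X → X.functionField
  eqn_ne_zero : ∀ x, eqn x ≠ 0
  compat : ∀ x, ∃ U : X.Opens, x ∈ U ∧ ∀ y ∈ U, ∃ a : (X.presheaf.stalk y)ˣ,
    eqn y = algebraMap (X.presheaf.stalk y) X.functionField a * eqn x

/-- The rational function `h` is a global section of `𝒪_X(nD)`: the function `eqn x ^ n * h`, which
is the expression of this section in the local trivialization of `𝒪_X(nD)` given by the generator
`eqn x ^ (-n)`, is regular at every point `x`. -/
def CartierDivisor.IsSection {X : Scheme.{0}} [IsIntegral X] (D : CartierDivisor X) (n : ℕ)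
    (h : X.functionField) : Prop :=
  ∀ x, ∃ a : X.presheaf.stalk x,
    algebraMap (X.presheaf.stalk x) X.functionField a = D.eqn x ^ n * h

/-- Weil divisors with rational coefficients: locally finite functions supported on the points of
codimension one. -/
def weilDivisors (X : Scheme.{0}) : Submodule ℚ (X → ℚ) where
  carrier := {D | D ∈ Function.locallyFinsuppWithin.addSubgroup (Y := ℚ) (Set.univ : Set X) ∧
    ∀ x, D x ≠ 0 → Order.coheight x = 1}
  zero_mem' := ⟨zero_mem _, fun x hx => absurd rfl hx⟩
  add_mem' := by
    rintro D E ⟨hD, hD'⟩ ⟨hE, hE'⟩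
    refine ⟨add_mem hD hE, fun x hx => ?_⟩
    by_cases h : D x = 0
    · exact hE' x (by simpa [h] using hx)
    · exact hD' x h
  smul_mem' := by
    rintro c D ⟨hD, hD'⟩
    have key : Function.support (c • D) ⊆ Function.support D :=
      Function.support_const_smul_subset c D
    refine ⟨⟨Set.subset_univ _, fun x hx => ?_⟩, fun x hx => hD' x (key hx)⟩
    obtain ⟨t, ht, hf⟩ := hD.2 x hx
    exact ⟨t, ht, hf.subset (Set.inter_subset_inter_right t key)⟩

/-- The `ℚ`-span of the divisors of nonzero rational functions. -/
def principalDivisors (X : Scheme.{0}) [IsIntegral X] [IsLocallyNoetherian X] :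
    Submodule ℚ (weilDivisors X) :=
  Submodule.span ℚ {D | ∃ r : X.functionField, r ≠ 0 ∧ ∀ x, (D : X → ℚ) x = Scheme.ord r x}

/-- `A¹(X) ⊗ ℚ`: divisors on `X` with rational coefficients modulo rational equivalence. -/
abbrev Chow1 (X : Scheme.{0}) [IsIntegral X] [IsLocallyNoetherian X] : Type :=
  weilDivisors X ⧸ principalDivisors X

open Classical in
/-- The class in `A¹(X) ⊗ ℚ` of the Weil divisor `x ↦ ord_x (s x)`, where `s x` is the local
expression at `x` of a nonzero rational section of a line bundle, or the local equation at `x` of a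
Cartier divisor (for such `s` this function is locally finite; the value `0` for other `s` is never
used). -/
def divClass {X : Scheme.{0}} [IsIntegral X] [IsLocallyNoetherian X] (s : X → X.functionField) :
    Chow1 X :=
  if h : (fun x => (Scheme.ord (s x) x : ℚ)) ∈ weilDivisors X then
    (principalDivisors X).mkQ ⟨_, h⟩
  else 0

/-! ## Weierstrass models -/

/-- A Weierstrass model `y² = x³ + f x + g` over `B`, with `f` a section of `𝒪_B(4L)` and `g` a
section of `𝒪_B(6L)`, whose discriminant is not identically zero. -/
structure WeierstrassModel (B : Scheme.{0}) [IsIntegral B] where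
  L : CartierDivisor B
  f : B.functionField
  g : B.functionField
  f_section : L.IsSection 4 f
  g_section : L.IsSection 6 g
  disc_ne_zero : 4 * f ^ 3 + 27 * g ^ 2 ≠ 0

namespace WeierstrassModel

variable {B : Scheme.{0}} [IsIntegral B] (W : WeierstrassModel B)

/-- `f` as a function near `x`, in the local trivialization of `𝒪_B(4L)` at `x`. -/
def fAt (x : B) : B.functionField := W.L.eqn x ^ 4 * W.f

/-- `g` as a function near `x`, in the local trivialization of `𝒪_B(6L)` at `x`. -/
def gAt (x : B) : B.functionField := W.L.eqn x ^ 6 * W.g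

/-- The discriminant `Δ = 4f³ + 27g²` as a function near `x`. -/
def discAt (x : B) : B.functionField := 4 * W.fAt x ^ 3 + 27 * W.gAt x ^ 2

/-- At no point `x` of codimension two do the multiplicities of `f`, `g` reach `4`, `6` (and hence
that of `Δ` reach `12`): the restriction of the Weierstrass model to a general curve through a
general point of a codimension two subvariety is minimal. -/
def MinimalInCodimTwo : Prop :=
  ∀ x : B, Order.coheight x = 2 → ∀ a b : B.presheaf.stalk x,
    algebraMap (B.presheaf.stalk x) B.functionField a = W.fAt x →
    algebraMap (B.presheaf.stalk x) B.functionField b = W.gAt x →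
    ¬ (a ∈ IsLocalRing.maximalIdeal (B.presheaf.stalk x) ^ 4 ∧
       b ∈ IsLocalRing.maximalIdeal (B.presheaf.stalk x) ^ 6)

end WeierstrassModel

/-! ## A component `Σ` of the discriminant, and restriction to it -/

section Component

variable {B S : Scheme.{0}} [IsIntegral B] [IsIntegral S] (i : S ⟶ B)

/-- The Cartier divisor `z` is the prime divisor `S`: at the points of `S` its local equation
generates the ideal of `S`, and away from `S` it is a unit. -/
def CartierDivisor.IsEquationOf (z : CartierDivisor B) : Prop :=
  (∀ s : S, ∃ t : B.presheaf.stalk (i s),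
    algebraMap (B.presheaf.stalk (i s)) B.functionField t = z.eqn (i s) ∧
    RingHom.ker (i.stalkMap s).hom = Ideal.span {t}) ∧
  (∀ x : B, x ∉ Set.range i → ∃ a : (B.presheaf.stalk x)ˣ,
    algebraMap (B.presheaf.stalk x) B.functionField a = z.eqn x)

open Classical in
/-- The restriction `h|_S` of a rational function `h` on `B` that is regular at the generic point
of `S` (and `0` for other `h`). -/
def restrict (h : B.functionField) : S.functionField :=
  if H : ∃ a : B.presheaf.stalk (i (genericPoint S)),
      algebraMap (B.presheaf.stalk (i (genericPoint S))) B.functionField a = h then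
    (i.stalkMap (genericPoint S)).hom H.choose
  else 0

/-- The class `D|_S` in `A¹(S) ⊗ ℚ` of the restriction to `S` of (the line bundle of) a Cartier
divisor `D` on `B`. The local equations of `D` are divided by the one at the generic point of `S`
in order that they can be restricted. -/
def restrictClass [IsLocallyNoetherian S] (D : CartierDivisor B) : Chow1 S :=
  divClass fun s => restrict i (D.eqn (i s) / D.eqn (i (genericPoint S)))

variable (W : WeierstrassModel B) (z : CartierDivisor B)

/-- `ord_S h ≥ k`, where `z` is the equation of `S`. -/
def OrdGE (k : ℕ) (h : B.functionField) : Prop :=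
  ∃ a : B.presheaf.stalk (i (genericPoint S)),
    algebraMap (B.presheaf.stalk (i (genericPoint S))) B.functionField a =
      h / z.eqn (i (genericPoint S)) ^ k

/-- `ord_S h = k`, where `z` is the equation of `S`. -/
def OrdEq (k : ℕ) (h : B.functionField) : Prop :=
  OrdGE i z k h ∧ ¬ OrdGE i z (k + 1) h

end Component

/-! ## Kodaira types and the data of Tate's algorithm -/

/-- The Kodaira types that contribute to the gauge algebra: `I_m` (`m ≥ 2`), `III`, `IV`, `I_k^*`,
`IV^*`, `III^*`, `II^*`. -/
inductive KodairaType where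
  | I (m : ℕ)
  | III
  | IV
  | Istar (k : ℕ)
  | IVstar
  | IIIstar
  | IIstar

/-- The (real, compact) simple Lie algebras that occur as gauge algebras. -/
inductive GaugeAlgebra where
  | su (m : ℕ)
  | sp (n : ℕ)
  | so (l : ℕ)
  | e6
  | e7
  | e8
  | f4
  | g2

section Tate

variable {B S : Scheme.{0}} [IsIntegral B] [IsIntegral S] (i : S ⟶ B)
  (W : WeierstrassModel B) (z : CartierDivisor B)

/-- The generic singular fiber along `S` has the given Kodaira type. -/
def HasType (T : KodairaType) : Prop :=
  let f := W.fAt (i (genericPoint S))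
  let g := W.gAt (i (genericPoint S))
  let Δ := W.discAt (i (genericPoint S))
  match T with
  | .I m => 2 ≤ m ∧ OrdEq i z 0 f ∧ OrdEq i z 0 g ∧ OrdEq i z m Δ
  | .III => OrdEq i z 1 f ∧ OrdGE i z 2 g ∧ OrdEq i z 3 Δ
  | .IV => OrdGE i z 2 f ∧ OrdEq i z 2 g ∧ OrdEq i z 4 Δ
  | .Istar 0 => OrdGE i z 2 f ∧ OrdGE i z 3 g ∧ OrdEq i z 6 Δ
  | .Istar (k + 1) => OrdEq i z 2 f ∧ OrdEq i z 3 g ∧ OrdEq i z (k + 7) Δ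
  | .IVstar => OrdGE i z 3 f ∧ OrdEq i z 4 g ∧ OrdEq i z 8 Δ
  | .IIIstar => OrdEq i z 3 f ∧ OrdGE i z 5 g ∧ OrdEq i z 9 Δ
  | .IIstar => OrdGE i z 4 f ∧ OrdEq i z 5 g ∧ OrdEq i z 10 Δ

/-- The multiplicity of `S` in the discriminant. -/
def KodairaType.mult : KodairaType → ℕ
  | .I m => m
  | .III => 3
  | .IV => 4
  | .Istar k => k + 6
  | .IVstar => 8
  | .IIIstar => 9
  | .IIstar => 10

/-- The residual discriminant `δ_Σ = (Δ/z^m)|_Σ`, expressed at the point `s` of `Σ`. -/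
def deltaSec (T : KodairaType) (s : S) : S.functionField :=
  restrict i (W.discAt (i s) / z.eqn (i s) ^ T.mult)

/-- `(-9g/2f)|_Σ`, expressed at the point `s` of `Σ`. -/
def uSec (s : S) : S.functionField :=
  restrict i (-9 * W.gAt (i s) / (2 * W.fAt (i s)))

/-- `(-9g/2zf)|_Σ`, expressed at the point `s` of `Σ`. -/
def uStarSec (s : S) : S.functionField :=
  restrict i (-9 * W.gAt (i s) / (2 * z.eqn (i s) * W.fAt (i s)))

/-- The rational section `β_Σ`, expressed at the point `s` of `Σ` (and `1` for the types where
`β_Σ` is not defined). -/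
def betaSec (T : KodairaType) (s : S) : S.functionField :=
  match T with
  | .I m => if m = 2 then 1 else uSec i W s
  | .IV => restrict i (W.gAt (i s) / z.eqn (i s) ^ 2)
  | .Istar 0 => 1
  | .Istar (k + 1) =>
      if Odd (k + 1) then deltaSec i W z (.Istar (k + 1)) s / uStarSec i W z s ^ 3
      else - (deltaSec i W z (.Istar (k + 1)) s / uStarSec i W z s ^ 2)
  | .IVstar => restrict i (W.gAt (i s) / z.eqn (i s) ^ 4)
  | .III => 1
  | .IIIstar => 1
  | .IIstar => 1

/-- The rational section `γ_Σ`, expressed at the point `s` of `Σ` (and `1` for the types where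
`γ_Σ` is not defined). -/
def gammaSec (T : KodairaType) (s : S) : S.functionField :=
  match T with
  | .I m => deltaSec i W z (.I m) s / uSec i W s ^ 2
  | .III => restrict i (W.fAt (i s) / z.eqn (i s))
  | .Istar 0 => 1
  | .Istar (_ + 1) => uStarSec i W z s
  | .IIIstar => restrict i (W.fAt (i s) / z.eqn (i s) ^ 3)
  | .IIstar => restrict i (W.gAt (i s) / z.eqn (i s) ^ 5)
  | .IV => 1
  | .IVstar => 1

open Polynomial in
/-- The polynomial `ψ³ + (f/z²)|_Σ ψ + (g/z³)|_Σ` of the monodromy cover for type `I_0^*`. -/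
def monodromyCubic : S.functionField[X] :=
  X ^ 3 +
    C (restrict i (W.fAt (i (genericPoint S)) / z.eqn (i (genericPoint S)) ^ 2)) * X +
    C (restrict i (W.gAt (i (genericPoint S)) / z.eqn (i (genericPoint S)) ^ 3))

open Classical in
/-- The gauge algebra `𝔤(Σ)`. It depends on the type and on whether the monodromy cover is
reducible, that is, on whether `β_Σ` is a square, respectively on how the monodromy cubic factors.
The algebra `𝔰𝔭(1)` is always written as `𝔰𝔲(2)`. -/
def gaugeAlgebra (T : KodairaType) : GaugeAlgebra :=
  match T with
  | .I m =>
      if m = 2 then .su 2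
      else if IsSquare (betaSec i W z (.I m) (genericPoint S)) then .su m
      else if m = 3 then .su 2
      else .sp (m / 2)
  | .III => .su 2
  | .IV => if IsSquare (betaSec i W z .IV (genericPoint S)) then .su 3 else .su 2
  | .Istar 0 =>
      if Irreducible (monodromyCubic i W z) then .g2
      else if (monodromyCubic i W z).Splits then .so 8
      else .so 7
  | .Istar (k + 1) =>
      if IsSquare (betaSec i W z (.Istar (k + 1)) (genericPoint S)) then .so (2 * (k + 1) + 8)
      else .so (2 * (k + 1) + 7)
  | .IVstar => if IsSquare (betaSec i W z .IVstar (genericPoint S)) then .e6 else .f4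
  | .IIIstar => .e7
  | .IIstar => .e8

end Tate

/-! ## Cartan subalgebras, characters of representations, and Casimir operators

A representation is given by its character, the formal sum of its weights (with multiplicity) in
the dual of a Cartan subalgebra `𝔥` of `𝔤 ⊗ ℂ`; the representation ring is the ring of
Weyl-invariant sums of integral weights. A Casimir operator is given by its restriction to `𝔥`. -/

namespace GaugeAlgebra

/-- Index set of the coordinates on the Cartan subalgebra. For `e6`, `e7`, `e8`, `f4`, `g2` the
coordinates are those of the subalgebras of maximal rank `𝔰𝔲(3)³`, `𝔰𝔲(8)`, `𝔰𝔲(9)`, `𝔰𝔬(9)`,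
`𝔰𝔲(3)`. -/
abbrev Index : GaugeAlgebra → Type
  | su m => Fin m
  | sp n => Fin n
  | so l => Fin (l / 2)
  | e6 => Fin 3 × Fin 3
  | e7 => Fin 8
  | e8 => Fin 9
  | f4 => Fin 4
  | g2 => Fin 3

/-- The vectors whose coordinates sum to zero. -/
def sumZero (n : ℕ) : Submodule ℂ (Fin n → ℂ) where
  carrier := {x | ∑ j, x j = 0}
  zero_mem' := by simp
  add_mem' := by
    intro x y hx hy
    simp only [Set.mem_ofPred_eq] at hx hy
    simp [Finset.sum_add_distrib, hx, hy]
  smul_mem' := by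
    intro c x hx
    simp only [Set.mem_ofPred_eq] at hx
    simp [← Finset.mul_sum, hx]

/-- The Cartan subalgebra `𝔥` of `𝔤 ⊗ ℂ`. -/
abbrev cartan : (𝔤 : GaugeAlgebra) → Submodule ℂ (𝔤.Index → ℂ)
  | su m => sumZero m
  | sp _ => ⊤
  | so _ => ⊤
  | e6 => ⨅ a : Fin 3, (sumZero 3).comap (LinearMap.funLeft ℂ ℂ fun b : Fin 3 => (a, b))
  | e7 => sumZero 8
  | e8 => sumZero 9
  | f4 => ⊤
  | g2 => sumZero 3

/-- The weight lattice lies in the dual `𝔥*` of the Cartan subalgebra. -/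
abbrev Weight (𝔤 : GaugeAlgebra) : Type := Module.Dual ℂ 𝔤.cartan

/-- The coordinate function `ε_j` on `𝔥`. -/
def ε (𝔤 : GaugeAlgebra) (j : 𝔤.Index) : 𝔤.Weight := LinearMap.proj j ∘ₗ 𝔤.cartan.subtype

/-- Formal characters with rational coefficients. By means of characters, `R(𝔤) ⊗ ℚ` is the subspace
of Weyl-invariant combinations of integral weights; as tensoring over `ℚ` is exact, equalities in
`A ⊗ R(𝔤) ⊗ ℚ` may be stated in `A ⊗ Character 𝔤`. -/
abbrev Character (𝔤 : GaugeAlgebra) : Type := 𝔤.Weight →₀ ℚ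

/-- The formal exponential `e^w` of a weight. -/
def e {𝔤 : GaugeAlgebra} (w : 𝔤.Weight) : 𝔤.Character := Finsupp.single w 1

/-- The sum of the `e^{±ε_j}` over all `j`, for `n` coordinates. -/
def pmSum {𝔤 : GaugeAlgebra} {n : ℕ} (x : Fin n → 𝔤.Weight) : 𝔤.Character :=
  ∑ j, (e (x j) + e (-x j))

/-- The sum of the `e^{±ε_j ± ε_k}` over all `j < k` and all four choices of the signs. -/
def pairSum {𝔤 : GaugeAlgebra} {n : ℕ} (x : Fin n → 𝔤.Weight) : 𝔤.Character :=
  ∑ j, ∑ k ∈ Finset.univ.filter (fun k => j < k),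
    (e (x j + x k) + e (x j - x k) + e (-x j + x k) + e (-x j - x k))

/-- The sum of the `e^{ε_j - ε_k}` over all `j ≠ k`, plus `n - 1` times `e^0`: the character of the
adjoint representation of `𝔰𝔲(n)`. -/
def diffSum {𝔤 : GaugeAlgebra} {n : ℕ} (x : Fin n → 𝔤.Weight) : 𝔤.Character :=
  (∑ j, ∑ k, e (x j - x k)) - e 0

/-- The sum of the `e^{ε_{j₁} + ⋯ + ε_{jₖ}}` over all `j₁ < ⋯ < jₖ`: the character of the `k`-th
exterior power of the standard representation of `𝔰𝔲(n)`. -/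
def extSum {𝔤 : GaugeAlgebra} {n : ℕ} (k : ℕ) (x : Fin n → 𝔤.Weight) : 𝔤.Character :=
  ∑ t ∈ Finset.powersetCard k Finset.univ, e (∑ j ∈ t, x j)

/-- The sum of the `e^{(±ε_1 ± ⋯ ± ε_n)/2}` over all choices of signs that satisfy `P`. -/
def spinSum {𝔤 : GaugeAlgebra} {n : ℕ} (P : (Fin n → ℤˣ) → Prop) [DecidablePred P]
    (x : Fin n → 𝔤.Weight) : 𝔤.Character :=
  ∑ σ ∈ Finset.univ.filter P, e ((2⁻¹ : ℂ) • ∑ j, ((σ j : ℤ) : ℂ) • x j)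

end GaugeAlgebra

open GaugeAlgebra

/-- Names of the irreducible representations that occur: the adjoint representation, the
fundamental representation of `𝔰𝔲(m)` and `𝔰𝔭(n)`, its exterior square `Λ²` for `𝔰𝔲(m)`
respectively `Λ²_irr` for `𝔰𝔭(n)`, the vector representation of `𝔰𝔬(ℓ)`, its spinor
representations `spin_±` (both the same if `ℓ` is odd), and the representations `7` of `𝔤₂`, `26` of
`𝔣₄`, `27` of `𝔢₆`, `56` of `𝔢₇`. -/
inductive RepName where
  | adj
  | fund
  | asym
  | vect
  | spinPlus
  | spinMinus
  | small
  deriving DecidableEq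

instance : Fintype RepName where
  elems := {.adj, .fund, .asym, .vect, .spinPlus, .spinMinus, .small}
  complete := by intro ρ; cases ρ <;> decide

/-- The name of the spinor representation with the given sign. -/
def RepName.spin (ν : ℤˣ) : RepName := if ν = 1 then .spinPlus else .spinMinus

/-- The character of the named representation of `𝔤` (and `0` if there is none of this name). -/
def rep : RepName → (𝔤 : GaugeAlgebra) → 𝔤.Character
  | .adj, .su m => diffSum (n := m) (ε (.su m))
  | .adj, .sp n =>
      pairSum (n := n) (ε (.sp n)) + pmSum (n := n) (fun j => (2 : ℂ) • ε (.sp n) j) + (n : ℚ) • e 0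
  | .adj, .so l =>
      pairSum (n := l / 2) (ε (.so l)) + ((l / 2 : ℕ) : ℚ) • e 0 +
        if Odd l then pmSum (n := l / 2) (ε (.so l)) else 0
  | .adj, .e6 =>
      (∑ a : Fin 3, diffSum (n := 3) fun j => ε .e6 (a, j)) +
        ∑ j : Fin 3, ∑ k : Fin 3, ∑ l : Fin 3,
          (e (ε .e6 ((0 : Fin 3), j) + ε .e6 ((1 : Fin 3), k) + ε .e6 ((2 : Fin 3), l)) +
            e (-(ε .e6 ((0 : Fin 3), j) + ε .e6 ((1 : Fin 3), k) + ε .e6 ((2 : Fin 3), l))))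
  | .adj, .e7 => diffSum (n := 8) (ε .e7) + extSum (n := 8) 4 (ε .e7)
  | .adj, .e8 =>
      diffSum (n := 9) (ε .e8) + extSum (n := 9) 3 (ε .e8) + extSum (n := 9) 3 (fun j => -ε .e8 j)
  | .adj, .f4 =>
      pairSum (n := 4) (ε .f4) + pmSum (n := 4) (ε .f4) +
        spinSum (n := 4) (fun _ => True) (ε .f4) + (4 : ℚ) • e 0
  | .adj, .g2 => diffSum (n := 3) (ε .g2) + pmSum (n := 3) (ε .g2)
  | .fund, .su m => extSum (n := m) 1 (ε (.su m))
  | .fund, .sp n => pmSum (n := n) (ε (.sp n))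
  | .asym, .su m => extSum (n := m) 2 (ε (.su m))
  | .asym, .sp n => pairSum (n := n) (ε (.sp n)) + ((n : ℚ) - 1) • e 0
  | .vect, .so l => pmSum (n := l / 2) (ε (.so l)) + if Odd l then e 0 else 0
  | .spinPlus, .so l =>
      spinSum (n := l / 2) (fun σ => Odd l ∨ ∏ j, σ j = 1) (ε (.so l))
  | .spinMinus, .so l =>
      spinSum (n := l / 2) (fun σ => Odd l ∨ ∏ j, σ j = -1) (ε (.so l))
  | .small, .g2 => pmSum (n := 3) (ε .g2) + e 0
  | .small, .f4 =>
      pmSum (n := 4) (ε .f4) + spinSum (n := 4) (fun _ => True) (ε .f4) + (2 : ℚ) • e 0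
  | .small, .e6 =>
      ∑ a : Fin 3, ∑ j : Fin 3, ∑ k : Fin 3, e (ε .e6 (a, j) - ε .e6 (a + 1, k))
  | .small, .e7 => extSum (n := 8) 2 (ε .e7) + extSum (n := 8) 2 (fun j => -ε .e7 j)
  | _, _ => 0

/-- Complex-valued functions on the Cartan subalgebra. The Casimir operators, which are the invariant
polynomial functions on `𝔤`, are identified with the Weyl-invariant polynomial functions on `𝔥`, and
these form a subspace; again, equalities in `A ⊗ (Casimir operators)` may be stated here. -/
abbrev Casimir (𝔤 : GaugeAlgebra) : Type := 𝔤.cartan → ℂ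

/-- `ρ ↦ (F ↦ Tr_ρ F^k)`, extended linearly to `R(𝔤) ⊗ ℚ`: on `F ∈ 𝔥` the endomorphism `ρ(F)` is
diagonalizable with eigenvalues `w(F)`, where `w` runs through the weights. -/
def Tr (k : ℕ) (𝔤 : GaugeAlgebra) : 𝔤.Character →ₗ[ℚ] Casimir 𝔤 :=
  Finsupp.linearCombination ℚ fun (w : 𝔤.Weight) (F : 𝔤.cartan) => w F ^ k

/-- The normalized trace `tr F²`. -/
def normTr2 : (𝔤 : GaugeAlgebra) → Casimir 𝔤
  | .su m => Tr 2 (.su m) (rep .fund (.su m))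
  | .sp n => Tr 2 (.sp n) (rep .fund (.sp n))
  | .so l => (1 / 2 : ℚ) • Tr 2 (.so l) (rep .vect (.so l))
  | .e6 => (1 / 6 : ℚ) • Tr 2 .e6 (rep .small .e6)
  | .e7 => (1 / 12 : ℚ) • Tr 2 .e7 (rep .small .e7)
  | .e8 => (1 / 60 : ℚ) • Tr 2 .e8 (rep .adj .e8)
  | .f4 => (1 / 6 : ℚ) • Tr 2 .f4 (rep .small .f4)
  | .g2 => (1 / 2 : ℚ) • Tr 2 .g2 (rep .small .g2)

/-- `X^(k)` on cycles with coefficients in `R(𝔤) ⊗ ℚ`: `Z ⊗ ρ ↦ Z ⊗ Tr_ρ F^k`. -/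
def Xop (A : Type) [AddCommGroup A] [Module ℚ A] (k : ℕ) (𝔤 : GaugeAlgebra) :
    (A ⊗[ℚ] 𝔤.Character) →ₗ[ℚ] (A ⊗[ℚ] Casimir 𝔤) :=
  LinearMap.lTensor A (Tr k 𝔤)

/-! ## The Tate representations -/

/-- `ρ_α`. -/
def rhoAlpha : KodairaType → (𝔤 : GaugeAlgebra) → 𝔤.Character
  | .I m, .su n =>
      if m = n then rep .adj (.su n) else rep .adj (.su n) + (2 : ℚ) • rep .fund (.su n)
  | .I m, .sp n =>
      rep .adj (.sp n) + rep .asym (.sp n) + if Odd m then (2 : ℚ) • rep .fund (.sp n) else 0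
  | .IV, .su n =>
      if n = 2 then rep .adj (.su n) + (2 : ℚ) • rep .fund (.su n) else rep .adj (.su n)
  | .Istar _, .g2 => rep .adj .g2 + (2 : ℚ) • rep .small .g2
  | .Istar _, .so l => rep .adj (.so l) + if Odd l then rep .vect (.so l) else 0
  | .IVstar, .f4 => rep .adj .f4 + rep .small .f4
  | _, 𝔤 => rep .adj 𝔤

/-- `ρ_√β` (and `0` if it is not defined). -/
def rhoSqrtBeta : KodairaType → (𝔤 : GaugeAlgebra) → 𝔤.Character
  | .I m, .su n =>
      if m = 2 then 0 else if m = 3 then rep .fund (.su n) else rep .asym (.su n)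
  | .I m, .sp n => rep .asym (.sp n) + if Odd m then rep .fund (.sp n) else 0
  | .IV, 𝔤 => (3 : ℚ) • rep .fund 𝔤
  | .Istar (_ + 1), 𝔤 => rep .vect 𝔤
  | .IVstar, 𝔤 => rep .small 𝔤
  | _, _ => 0

/-- `ρ_γ` (and `0` if it is not defined), for a choice `ν` of the sign of the spinor
representation. -/
def rhoGamma (ν : ℤˣ) : KodairaType → (𝔤 : GaugeAlgebra) → 𝔤.Character
  | .I _, 𝔤 => rep .fund 𝔤
  | .III, 𝔤 => (2 : ℚ) • rep .fund 𝔤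
  | .Istar 1, 𝔤 => rep (.spin ν) 𝔤
  | .Istar 2, 𝔤 => (1 / 2 : ℚ) • rep (.spin ν) 𝔤
  | .Istar 3, 𝔤 => (1 / 4 : ℚ) • rep (.spin ν) 𝔤 + rep .vect 𝔤
  | .IIIstar, 𝔤 => (1 / 2 : ℚ) • rep .small 𝔤
  | _, _ => 0

/-- For type `I_0^*` the coefficient of `div(δ_Σ)`, which replaces the terms with `β_Σ` and `γ_Σ`. -/
def rhoDelta (ν : ℤˣ) : KodairaType → (𝔤 : GaugeAlgebra) → 𝔤.Character
  | .Istar 0, .g2 => (1 / 2 : ℚ) • rep .small .g2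
  | .Istar 0, .so 7 => (1 / 3 : ℚ) • rep (.spin ν) (.so 7) + (1 / 6 : ℚ) • rep .vect (.so 7)
  | .Istar 0, .so 8 =>
      (1 / 6 : ℚ) • (rep .vect (.so 8) + rep .spinPlus (.so 8) + rep .spinMinus (.so 8))
  | _, _ => 0

/-- The Tate cycle for `Σ` in `A¹(Σ) ⊗ R(𝔤(Σ)) ⊗ ℚ`. -/
def tateCycle {B S : Scheme.{0}} [IsIntegral B] [IsIntegral S] [IsLocallyNoetherian S] (i : S ⟶ B)
    (W : WeierstrassModel B) (z : CartierDivisor B) (ν : ℤˣ) (T : KodairaType)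
    (𝔤 : GaugeAlgebra) : Chow1 S ⊗[ℚ] 𝔤.Character :=
  ((1 / 2 : ℚ) • (-restrictClass i W.L + restrictClass i z)) ⊗ₜ[ℚ] rhoAlpha T 𝔤 +
  ((1 / 2 : ℚ) • divClass (betaSec i W z T)) ⊗ₜ[ℚ] rhoSqrtBeta T 𝔤 +
  divClass (gammaSec i W z T) ⊗ₜ[ℚ] rhoGamma ν T 𝔤 +
  divClass (deltaSec i W z T) ⊗ₜ[ℚ] rhoDelta ν T 𝔤

/-- The table of the cycles `Γ_ρ`, for a choice `ν` of the sign of the spinor representation: the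
pair `(a, b)` stands for the class `(aL + bΣ)|_Σ`. -/
def gammaCoeff (ν : ℤˣ) : GaugeAlgebra → RepName → ℚ × ℚ
  | _, .adj => (-1 / 2, 1 / 2)
  | .su 2, .fund => (8, -2)
  | .su 3, .fund => (9, -3)
  | .su m, .fund => (8, -m)
  | .su m, .asym => if 4 ≤ m then (1, 0) else (0, 0)
  | .sp n, .fund => (8, -2 * n)
  | .sp _, .asym => (1 / 2, 1 / 2)
  | .so l, .vect =>
      if l ≤ 14 then (((l : ℚ) - 4) / 2, (6 - (l : ℚ)) / 2)
      else
        -- here `n ≥ 4` is the integer with `l ∈ {4n - 1, 4n, 4n + 1, 4n + 2}`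
        let n : ℕ := (l + 1) / 4
        if l = 4 * n - 1 then (7 / 2, -((n : ℚ) - 1 / 2))
        else if l = 4 * n then (4, -n)
        else if l = 4 * n + 1 then (5 / 2, -((n : ℚ) - 1 / 2))
        else (3, -n)
  | .so 8, .spinPlus => (2, -1)
  | .so 8, .spinMinus => (2, -1)
  | .so l, ρ =>
      if ρ = .spin ν ∧ l ≤ 14 then (32 / 2 ^ ((l - 1) / 2), -16 / 2 ^ ((l - 1) / 2)) else (0, 0)
  | .e6, .small => (3, -2)
  | .e7, .small => (2, -3 / 2)
  | .f4, .small => (5 / 2, -3 / 2)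
  | .g2, .small => (5, -2)
  | _, _ => (0, 0)

/-- The class `Γ_ρ`, as a function of the gauge algebra and of the classes `ℓ = L|_Σ` and
`σ = Σ|_Σ` only. -/
def gammaClass {A : Type} [AddCommGroup A] [Module ℚ A] (ℓ σ : A) (ν : ℤˣ) (𝔤 : GaugeAlgebra)
    (ρ : RepName) : A :=
  (gammaCoeff ν 𝔤 ρ).1 • ℓ + (gammaCoeff ν 𝔤 ρ).2 • σ

end FTheory

end

noncomputable section

namespace FTheory

/-! ## Power sums over subsets, pairs and signs -/

/-! The cycle identity is a computation with line bundles. The functions f, g, Δ and z are sections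
of 𝒪(4L), 𝒪(6L), 𝒪(12L) and 𝒪(Σ). If a section h of 𝒪(nL) has order exactly k along Σ, then h/z^k
restricts to a nonzero rational section of (nL - kΣ)|_Σ, whose divisor therefore has this class
(`hasClass_leadingCoeff`). Products and quotients of such sections give the classes of β, γ and δ as
rational combinations of L|_Σ and Σ|_Σ. For each type and algebra it then suffices to compare the
coefficients of L|_Σ ⊗ ρ and Σ|_Σ ⊗ ρ (`tate_tensor_eq_one` and its variants).

For the trace identities a representation is replaced by its weights, so that traces are sums of
powers of linear forms on the Cartan subalgebra. Every quadratic trace is a multiple of tr F², and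
every quartic trace needed is a combination of (tr F²)² and one further quartic form; only for 𝔰𝔬(8)
is this done for the sum of the two half-spinors instead of each one. In the cycle of the classes
Γ_ρ the further form cancels. For 𝔰𝔲(2), 𝔰𝔲(3) and the exceptional algebras it is absent; for the
exceptional ones this is seen by restricting to a subalgebra of maximal rank.

These cancellations are formal in L and Σ except for 𝔢₈ and for 𝔰𝔬(ℓ) with ℓ ≥ 15, which lack the
extra representations that would balance the terms. There geometry supplies a relation: Σ|_Σ =
(6/5)L|_Σ and Σ|_Σ = 2L|_Σ respectively. It says that the leading coefficient g/z⁵, respectively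
f/z², is a unit at every codimension-one point of Σ, for a zero there would contradict minimality in
codimension two. For II^* this is a count of multiplicities. For I_k^* with k ≥ 4 one has f = t²F, g
= t³G with t⁴ dividing 4F³ + 27G², and must show that F cannot vanish at a point unless F ∈ 𝔪² and G
∈ 𝔪³. This is `mem_maximalIdeal_pow_of_pow_four_dvd`, a statement about two-dimensional regular
local rings. -/

theorem sum_powersetCard_succ_insert {ι : Type*} [DecidableEq ι] (φ : ℂ → ℂ) (x : ι → ℂ)
    {a : ι} {s : Finset ι} (ha : a ∉ s) (k : ℕ) (c : ℂ) :
    ∑ t ∈ (insert a s).powersetCard (k + 1), φ (c + ∑ j ∈ t, x j) =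
      ∑ t ∈ s.powersetCard (k + 1), φ (c + ∑ j ∈ t, x j) +
        ∑ t ∈ s.powersetCard k, φ ((c + x a) + ∑ j ∈ t, x j) := by
  have hmem : ∀ t ∈ s.powersetCard k, a ∉ t := fun t ht h =>
    ha ((Finset.mem_powersetCard.1 ht).1 h)
  rw [Finset.powersetCard_succ_insert ha, Finset.sum_union, Finset.sum_image]
  · congr 1
    refine Finset.sum_congr rfl fun t ht => ?_
    rw [Finset.sum_insert (hmem t ht), add_assoc]
  · intro t ht u hu h
    replace h : insert a t = insert a u := h
    rw [← Finset.erase_insert (hmem t ht), h, Finset.erase_insert (hmem u hu)]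
  · rw [Finset.disjoint_left]
    intro t ht h
    obtain ⟨u, -, rfl⟩ := Finset.mem_image.1 h
    exact ha ((Finset.mem_powersetCard.1 ht).1 (Finset.mem_insert_self a u))

/-- The free shift `c` makes the induction close here and in the analogues below: a subset
containing the new element `a` becomes a smaller subset with shift `c + x a`. Outside this recursion
only `c = 0` is needed. -/
theorem sum_powersetCard_one_sq {ι : Type*} [DecidableEq ι] (s : Finset ι) (x : ι → ℂ)
    (c : ℂ) :
    ∑ t ∈ s.powersetCard 1, (c + ∑ j ∈ t, x j) ^ 2 = 1 / 1 * (
        ((s.card : ℂ)) * c ^ 2 +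
        (2*(∑ j ∈ s, x j ^ 1)) * c ^ 1 +
        ((∑ j ∈ s, x j ^ 2))) := by
  induction s using Finset.induction_on generalizing c with
  | empty => rw [Finset.powersetCard_eq_empty.2 (by simp)]; simp
  | insert a s ha ih =>
    rw [sum_powersetCard_succ_insert (fun y => y ^ 2) _ ha, ih]
    simp only [Finset.powersetCard_zero, Finset.sum_singleton, Finset.sum_empty, add_zero]
    simp only [Finset.sum_insert ha, Finset.card_insert_of_notMem ha, Nat.cast_add, Nat.cast_one]
    ring

theorem sum_powersetCard_two_sq {ι : Type*} [DecidableEq ι] (s : Finset ι) (x : ι → ℂ)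
    (c : ℂ) :
    ∑ t ∈ s.powersetCard 2, (c + ∑ j ∈ t, x j) ^ 2 = 1 / 2 * (
        ((s.card : ℂ)^2 - 1*(s.card : ℂ)) * c ^ 2 +
        (4*(s.card : ℂ)*(∑ j ∈ s, x j ^ 1) - 4*(∑ j ∈ s, x j ^ 1)) * c ^ 1 +
        (2*(s.card : ℂ)*(∑ j ∈ s, x j ^ 2) + 2*(∑ j ∈ s, x j ^ 1)^2 - 4*(∑ j ∈ s, x j ^ 2))) := by
  induction s using Finset.induction_on generalizing c with
  | empty => rw [Finset.powersetCard_eq_empty.2 (by simp)]; simp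
  | insert a s ha ih =>
    rw [sum_powersetCard_succ_insert (fun y => y ^ 2) _ ha, ih]
    rw [sum_powersetCard_one_sq]
    simp only [Finset.sum_insert ha, Finset.card_insert_of_notMem ha, Nat.cast_add, Nat.cast_one]
    ring

theorem sum_powersetCard_three_sq {ι : Type*} [DecidableEq ι] (s : Finset ι) (x : ι → ℂ)
    (c : ℂ) :
    ∑ t ∈ s.powersetCard 3, (c + ∑ j ∈ t, x j) ^ 2 = 1 / 6 * (
        ((s.card : ℂ)^3 - 3*(s.card : ℂ)^2 + 2*(s.card : ℂ)) * c ^ 2 +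
        (6*(s.card : ℂ)^2*(∑ j ∈ s, x j ^ 1) - 18*(s.card : ℂ)*(∑ j ∈ s, x j ^ 1) +
          12*(∑ j ∈ s, x j ^ 1)) * c ^ 1 +
        (3*(s.card : ℂ)^2*(∑ j ∈ s, x j ^ 2) + 6*(s.card : ℂ)*(∑ j ∈ s, x j ^ 1)^2 -
          15*(s.card : ℂ)*(∑ j ∈ s, x j ^ 2) - 12*(∑ j ∈ s, x j ^ 1)^2 +
          18*(∑ j ∈ s, x j ^ 2))) := by
  induction s using Finset.induction_on generalizing c with
  | empty => rw [Finset.powersetCard_eq_empty.2 (by simp)]; simp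
  | insert a s ha ih =>
    rw [sum_powersetCard_succ_insert (fun y => y ^ 2) _ ha, ih]
    rw [sum_powersetCard_two_sq]
    simp only [Finset.sum_insert ha, Finset.card_insert_of_notMem ha, Nat.cast_add, Nat.cast_one]
    ring

theorem sum_powersetCard_four_sq {ι : Type*} [DecidableEq ι] (s : Finset ι) (x : ι → ℂ)
    (c : ℂ) :
    ∑ t ∈ s.powersetCard 4, (c + ∑ j ∈ t, x j) ^ 2 = 1 / 24 * (
        ((s.card : ℂ)^4 - 6*(s.card : ℂ)^3 + 11*(s.card : ℂ)^2 - 6*(s.card : ℂ)) * c ^ 2 +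
        (8*(s.card : ℂ)^3*(∑ j ∈ s, x j ^ 1) - 48*(s.card : ℂ)^2*(∑ j ∈ s, x j ^ 1) +
          88*(s.card : ℂ)*(∑ j ∈ s, x j ^ 1) - 48*(∑ j ∈ s, x j ^ 1)) * c ^ 1 +
        (4*(s.card : ℂ)^3*(∑ j ∈ s, x j ^ 2) + 12*(s.card : ℂ)^2*(∑ j ∈ s, x j ^ 1)^2 -
          36*(s.card : ℂ)^2*(∑ j ∈ s, x j ^ 2) - 60*(s.card : ℂ)*(∑ j ∈ s, x j ^ 1)^2 +
          104*(s.card : ℂ)*(∑ j ∈ s, x j ^ 2) + 72*(∑ j ∈ s, x j ^ 1)^2 -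
          96*(∑ j ∈ s, x j ^ 2))) := by
  induction s using Finset.induction_on generalizing c with
  | empty => rw [Finset.powersetCard_eq_empty.2 (by simp)]; simp
  | insert a s ha ih =>
    rw [sum_powersetCard_succ_insert (fun y => y ^ 2) _ ha, ih]
    rw [sum_powersetCard_three_sq]
    simp only [Finset.sum_insert ha, Finset.card_insert_of_notMem ha, Nat.cast_add, Nat.cast_one]
    ring

theorem sum_powersetCard_one_pow_four {ι : Type*} [DecidableEq ι] (s : Finset ι) (x : ι → ℂ)
    (c : ℂ) :
    ∑ t ∈ s.powersetCard 1, (c + ∑ j ∈ t, x j) ^ 4 = 1 / 1 * (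
        ((s.card : ℂ)) * c ^ 4 +
        (4*(∑ j ∈ s, x j ^ 1)) * c ^ 3 +
        (6*(∑ j ∈ s, x j ^ 2)) * c ^ 2 +
        (4*(∑ j ∈ s, x j ^ 3)) * c ^ 1 +
        ((∑ j ∈ s, x j ^ 4))) := by
  induction s using Finset.induction_on generalizing c with
  | empty => rw [Finset.powersetCard_eq_empty.2 (by simp)]; simp
  | insert a s ha ih =>
    rw [sum_powersetCard_succ_insert (fun y => y ^ 4) _ ha, ih]
    simp only [Finset.powersetCard_zero, Finset.sum_singleton, Finset.sum_empty, add_zero]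
    simp only [Finset.sum_insert ha, Finset.card_insert_of_notMem ha, Nat.cast_add, Nat.cast_one]
    ring

theorem sum_powersetCard_two_pow_four {ι : Type*} [DecidableEq ι] (s : Finset ι) (x : ι → ℂ)
    (c : ℂ) :
    ∑ t ∈ s.powersetCard 2, (c + ∑ j ∈ t, x j) ^ 4 = 1 / 2 * (
        ((s.card : ℂ)^2 - 1*(s.card : ℂ)) * c ^ 4 +
        (8*(s.card : ℂ)*(∑ j ∈ s, x j ^ 1) - 8*(∑ j ∈ s, x j ^ 1)) * c ^ 3 +
        (12*(s.card : ℂ)*(∑ j ∈ s, x j ^ 2) + 12*(∑ j ∈ s, x j ^ 1)^2 -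
          24*(∑ j ∈ s, x j ^ 2)) * c ^ 2 +
        (8*(s.card : ℂ)*(∑ j ∈ s, x j ^ 3) + 24*(∑ j ∈ s, x j ^ 1)*(∑ j ∈ s, x j ^ 2) -
          32*(∑ j ∈ s, x j ^ 3)) * c ^ 1 +
        (2*(s.card : ℂ)*(∑ j ∈ s, x j ^ 4) + 8*(∑ j ∈ s, x j ^ 1)*(∑ j ∈ s, x j ^ 3) +
          6*(∑ j ∈ s, x j ^ 2)^2 - 16*(∑ j ∈ s, x j ^ 4))) := by
  induction s using Finset.induction_on generalizing c with
  | empty => rw [Finset.powersetCard_eq_empty.2 (by simp)]; simp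
  | insert a s ha ih =>
    rw [sum_powersetCard_succ_insert (fun y => y ^ 4) _ ha, ih]
    rw [sum_powersetCard_one_pow_four]
    simp only [Finset.sum_insert ha, Finset.card_insert_of_notMem ha, Nat.cast_add, Nat.cast_one]
    ring

theorem sum_powersetCard_three_pow_four {ι : Type*} [DecidableEq ι] (s : Finset ι) (x : ι → ℂ)
    (c : ℂ) :
    ∑ t ∈ s.powersetCard 3, (c + ∑ j ∈ t, x j) ^ 4 = 1 / 6 * (
        ((s.card : ℂ)^3 - 3*(s.card : ℂ)^2 + 2*(s.card : ℂ)) * c ^ 4 +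
        (12*(s.card : ℂ)^2*(∑ j ∈ s, x j ^ 1) - 36*(s.card : ℂ)*(∑ j ∈ s, x j ^ 1) +
          24*(∑ j ∈ s, x j ^ 1)) * c ^ 3 +
        (18*(s.card : ℂ)^2*(∑ j ∈ s, x j ^ 2) + 36*(s.card : ℂ)*(∑ j ∈ s, x j ^ 1)^2 -
          90*(s.card : ℂ)*(∑ j ∈ s, x j ^ 2) - 72*(∑ j ∈ s, x j ^ 1)^2 +
          108*(∑ j ∈ s, x j ^ 2)) * c ^ 2 +
        (12*(s.card : ℂ)^2*(∑ j ∈ s, x j ^ 3) +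
          72*(s.card : ℂ)*(∑ j ∈ s, x j ^ 1)*(∑ j ∈ s, x j ^ 2) -
          108*(s.card : ℂ)*(∑ j ∈ s, x j ^ 3) + 24*(∑ j ∈ s, x j ^ 1)^3 -
          216*(∑ j ∈ s, x j ^ 1)*(∑ j ∈ s, x j ^ 2) + 216*(∑ j ∈ s, x j ^ 3)) * c ^ 1 +
        (3*(s.card : ℂ)^2*(∑ j ∈ s, x j ^ 4) +
          24*(s.card : ℂ)*(∑ j ∈ s, x j ^ 1)*(∑ j ∈ s, x j ^ 3) +
          18*(s.card : ℂ)*(∑ j ∈ s, x j ^ 2)^2 - 51*(s.card : ℂ)*(∑ j ∈ s, x j ^ 4) +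
          36*(∑ j ∈ s, x j ^ 1)^2*(∑ j ∈ s, x j ^ 2) - 120*(∑ j ∈ s, x j ^ 1)*(∑ j ∈ s, x j ^ 3) -
          72*(∑ j ∈ s, x j ^ 2)^2 + 162*(∑ j ∈ s, x j ^ 4))) := by
  induction s using Finset.induction_on generalizing c with
  | empty => rw [Finset.powersetCard_eq_empty.2 (by simp)]; simp
  | insert a s ha ih =>
    rw [sum_powersetCard_succ_insert (fun y => y ^ 4) _ ha, ih]
    rw [sum_powersetCard_two_pow_four]
    simp only [Finset.sum_insert ha, Finset.card_insert_of_notMem ha, Nat.cast_add, Nat.cast_one]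
    ring

theorem sum_powersetCard_four_pow_four {ι : Type*} [DecidableEq ι] (s : Finset ι) (x : ι → ℂ)
    (c : ℂ) :
    ∑ t ∈ s.powersetCard 4, (c + ∑ j ∈ t, x j) ^ 4 = 1 / 24 * (
        ((s.card : ℂ)^4 - 6*(s.card : ℂ)^3 + 11*(s.card : ℂ)^2 - 6*(s.card : ℂ)) * c ^ 4 +
        (16*(s.card : ℂ)^3*(∑ j ∈ s, x j ^ 1) - 96*(s.card : ℂ)^2*(∑ j ∈ s, x j ^ 1) +
          176*(s.card : ℂ)*(∑ j ∈ s, x j ^ 1) - 96*(∑ j ∈ s, x j ^ 1)) * c ^ 3 +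
        (24*(s.card : ℂ)^3*(∑ j ∈ s, x j ^ 2) + 72*(s.card : ℂ)^2*(∑ j ∈ s, x j ^ 1)^2 -
          216*(s.card : ℂ)^2*(∑ j ∈ s, x j ^ 2) - 360*(s.card : ℂ)*(∑ j ∈ s, x j ^ 1)^2 +
          624*(s.card : ℂ)*(∑ j ∈ s, x j ^ 2) + 432*(∑ j ∈ s, x j ^ 1)^2 -
          576*(∑ j ∈ s, x j ^ 2)) * c ^ 2 +
        (16*(s.card : ℂ)^3*(∑ j ∈ s, x j ^ 3) +
          144*(s.card : ℂ)^2*(∑ j ∈ s, x j ^ 1)*(∑ j ∈ s, x j ^ 2) -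
          240*(s.card : ℂ)^2*(∑ j ∈ s, x j ^ 3) + 96*(s.card : ℂ)*(∑ j ∈ s, x j ^ 1)^3 -
          1008*(s.card : ℂ)*(∑ j ∈ s, x j ^ 1)*(∑ j ∈ s, x j ^ 2) +
          1088*(s.card : ℂ)*(∑ j ∈ s, x j ^ 3) - 288*(∑ j ∈ s, x j ^ 1)^3 +
          1728*(∑ j ∈ s, x j ^ 1)*(∑ j ∈ s, x j ^ 2) - 1536*(∑ j ∈ s, x j ^ 3)) * c ^ 1 +
        (4*(s.card : ℂ)^3*(∑ j ∈ s, x j ^ 4) +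
          48*(s.card : ℂ)^2*(∑ j ∈ s, x j ^ 1)*(∑ j ∈ s, x j ^ 3) +
          36*(s.card : ℂ)^2*(∑ j ∈ s, x j ^ 2)^2 - 108*(s.card : ℂ)^2*(∑ j ∈ s, x j ^ 4) +
          144*(s.card : ℂ)*(∑ j ∈ s, x j ^ 1)^2*(∑ j ∈ s, x j ^ 2) -
          528*(s.card : ℂ)*(∑ j ∈ s, x j ^ 1)*(∑ j ∈ s, x j ^ 3) -
          324*(s.card : ℂ)*(∑ j ∈ s, x j ^ 2)^2 + 752*(s.card : ℂ)*(∑ j ∈ s, x j ^ 4) +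
          24*(∑ j ∈ s, x j ^ 1)^4 - 576*(∑ j ∈ s, x j ^ 1)^2*(∑ j ∈ s, x j ^ 2) +
          1344*(∑ j ∈ s, x j ^ 1)*(∑ j ∈ s, x j ^ 3) + 720*(∑ j ∈ s, x j ^ 2)^2 -
          1536*(∑ j ∈ s, x j ^ 4))) := by
  induction s using Finset.induction_on generalizing c with
  | empty => rw [Finset.powersetCard_eq_empty.2 (by simp)]; simp
  | insert a s ha ih =>
    rw [sum_powersetCard_succ_insert (fun y => y ^ 4) _ ha, ih]
    rw [sum_powersetCard_three_pow_four]
    simp only [Finset.sum_insert ha, Finset.card_insert_of_notMem ha, Nat.cast_add, Nat.cast_one]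
    ring

theorem sum_sum_filter_lt {n : ℕ} (g : Fin n → Fin n → ℂ) (hg : ∀ j k, g j k = g k j) :
    ∑ j, ∑ k ∈ Finset.univ.filter (fun k => j < k), g j k =
      1 / 2 * ((∑ j, ∑ k, g j k) - ∑ j, g j j) := by
  have h1 : ∀ j, ∑ k, g j k = ∑ k ∈ Finset.univ.filter (fun k => j < k), g j k +
      (g j j + ∑ k ∈ Finset.univ.filter (fun k => k < j), g j k) := by
    intro j
    have h2 : g j j = ∑ k, if j = k then g j k else 0 := by simp
    rw [Finset.sum_filter, Finset.sum_filter, h2, ← Finset.sum_add_distrib,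
      ← Finset.sum_add_distrib]
    refine Finset.sum_congr rfl fun k _ => ?_
    rcases lt_trichotomy j k with h | h | h
    · simp [h, h.ne, h.not_gt]
    · simp [h]
    · simp [h, h.ne', h.not_gt]
  have h3 : ∑ j, ∑ k ∈ Finset.univ.filter (fun k => k < j), g j k =
      ∑ j, ∑ k ∈ Finset.univ.filter (fun k => j < k), g j k := by
    simp only [Finset.sum_filter]
    rw [Finset.sum_comm]
    refine Finset.sum_congr rfl fun j _ => Finset.sum_congr rfl fun k _ => ?_
    rw [hg]
  rw [Finset.sum_congr rfl fun j _ => h1 j, Finset.sum_add_distrib, Finset.sum_add_distrib, h3]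
  ring

/-- The first sign is absorbed into the shift, which again carries the induction on the number of
variables. -/
theorem sum_sign_cons {n : ℕ} (φ : ℂ → ℂ) (x : Fin (n + 1) → ℂ) (c : ℂ) :
    ∑ σ : Fin (n + 1) → ℤˣ, φ (c + ∑ j, ((σ j : ℤ) : ℂ) * x j) =
      ∑ σ : Fin n → ℤˣ, φ ((c + x 0) + ∑ j, ((σ j : ℤ) : ℂ) * x j.succ) +
        ∑ σ : Fin n → ℤˣ, φ ((c - x 0) + ∑ j, ((σ j : ℤ) : ℂ) * x j.succ) := by
  rw [← (Fin.consEquiv fun _ => ℤˣ).sum_comp, Fintype.sum_prod_type]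
  simp [Fin.consEquiv, Fin.sum_univ_succ, UnitsInt.univ, add_assoc, sub_eq_add_neg]

theorem sum_sign_mul_prod_cons {n : ℕ} (φ : ℂ → ℂ) (x : Fin (n + 1) → ℂ) (c : ℂ) :
    ∑ σ : Fin (n + 1) → ℤˣ, ((∏ j, σ j : ℤˣ) : ℤ) * φ (c + ∑ j, ((σ j : ℤ) : ℂ) * x j) =
      ∑ σ : Fin n → ℤˣ,
        ((∏ j, σ j : ℤˣ) : ℤ) * φ ((c + x 0) + ∑ j, ((σ j : ℤ) : ℂ) * x j.succ) -
      ∑ σ : Fin n → ℤˣ,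
        ((∏ j, σ j : ℤˣ) : ℤ) * φ ((c - x 0) + ∑ j, ((σ j : ℤ) : ℂ) * x j.succ) := by
  rw [← (Fin.consEquiv fun _ => ℤˣ).sum_comp, Fintype.sum_prod_type]
  simp [Fin.consEquiv, Fin.sum_univ_succ, Fin.prod_univ_succ, UnitsInt.univ, add_assoc,
    sub_eq_add_neg]

theorem sum_sign_sq {n : ℕ} (x : Fin n → ℂ) (c : ℂ) :
    ∑ σ : Fin n → ℤˣ, (c + ∑ j, ((σ j : ℤ) : ℂ) * x j) ^ 2 =
      2 ^ n * (c ^ 2 + ∑ j, x j ^ 2) := by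
  induction n generalizing c with
  | zero => simp
  | succ n ih =>
    rw [sum_sign_cons (fun y => y ^ 2), ih, ih, Fin.sum_univ_succ]
    ring

theorem sum_sign_pow_four {n : ℕ} (x : Fin n → ℂ) (c : ℂ) :
    ∑ σ : Fin n → ℤˣ, (c + ∑ j, ((σ j : ℤ) : ℂ) * x j) ^ 4 =
      2 ^ n * (c ^ 4 + 6 * c ^ 2 * ∑ j, x j ^ 2 + 3 * (∑ j, x j ^ 2) ^ 2 - 2 * ∑ j, x j ^ 4) := by
  induction n generalizing c with
  | zero => simp
  | succ n ih =>
    rw [sum_sign_cons (fun y => y ^ 4), ih, ih, Fin.sum_univ_succ, Fin.sum_univ_succ]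
    ring

/-- Weighting by the product of the signs produces an iterated finite difference, one step for each
variable. It annihilates polynomials of degree less than the number of variables, so three variables
suffice for squares. -/
theorem sum_sign_mul_prod_sq {n : ℕ} (x : Fin (n + 3) → ℂ) (c : ℂ) :
    ∑ σ : Fin (n + 3) → ℤˣ,
      ((∏ j, σ j : ℤˣ) : ℤ) * (c + ∑ j, ((σ j : ℤ) : ℂ) * x j) ^ 2 = 0 := by
  induction n generalizing c with
  | zero =>
    simp only [sum_sign_mul_prod_cons (fun y => y ^ 2)]
    simp
    ring
  | succ n ih =>
    rw [sum_sign_mul_prod_cons (fun y => y ^ 2), ih, ih, sub_zero]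

/-- Five variables are needed in degree four: with four, a multiple of the product of all `x j`
survives. Hence the half-spinors of 𝔰𝔬(8) cannot be treated one at a time. -/
theorem sum_sign_mul_prod_pow_four {n : ℕ} (x : Fin (n + 5) → ℂ) (c : ℂ) :
    ∑ σ : Fin (n + 5) → ℤˣ,
      ((∏ j, σ j : ℤˣ) : ℤ) * (c + ∑ j, ((σ j : ℤ) : ℂ) * x j) ^ 4 = 0 := by
  induction n generalizing c with
  | zero =>
    simp only [sum_sign_mul_prod_cons (fun y => y ^ 4)]
    simp
    ring
  | succ n ih =>
    rw [sum_sign_mul_prod_cons (fun y => y ^ 4), ih, ih, sub_zero]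

/-- The indicator function of `∏ j, σ j = ν` is `(1 + ν * ∏ j, σ j) / 2`. -/
theorem sum_filter_prod_eq {n : ℕ} (ν : ℤˣ) (φ : (Fin n → ℤˣ) → ℂ) :
    ∑ σ ∈ Finset.univ.filter (fun σ : Fin n → ℤˣ => ∏ j, σ j = ν), φ σ =
      1 / 2 * (∑ σ, φ σ + (ν : ℤ) * ∑ σ, ((∏ j, σ j : ℤˣ) : ℤ) * φ σ) := by
  rw [Finset.sum_filter, Finset.mul_sum, ← Finset.sum_add_distrib, Finset.mul_sum]
  refine Finset.sum_congr rfl fun σ _ => ?_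
  rcases Int.units_eq_one_or ν with rfl | rfl <;>
    rcases Int.units_eq_one_or (∏ j, σ j) with h | h <;> rw [h] <;> simp <;> ring

/-! ## Traces of the basic characters -/

open GaugeAlgebra

variable {𝔤 : GaugeAlgebra}

@[simp]
theorem Tr_e (k : ℕ) (w : 𝔤.Weight) (F : 𝔤.cartan) : Tr k 𝔤 (e w) F = w F ^ k := by
  simp [Tr, e]

theorem Tr_sum_apply {ι : Type*} (k : ℕ) (s : Finset ι) (χ : ι → 𝔤.Character) (F : 𝔤.cartan) :
    Tr k 𝔤 (∑ a ∈ s, χ a) F = ∑ a ∈ s, Tr k 𝔤 (χ a) F := by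
  rw [map_sum, Finset.sum_apply]

theorem Tr_add_apply (k : ℕ) (χ χ' : 𝔤.Character) (F : 𝔤.cartan) :
    Tr k 𝔤 (χ + χ') F = Tr k 𝔤 χ F + Tr k 𝔤 χ' F := by
  rw [map_add, Pi.add_apply]

theorem Tr_sub_apply (k : ℕ) (χ χ' : 𝔤.Character) (F : 𝔤.cartan) :
    Tr k 𝔤 (χ - χ') F = Tr k 𝔤 χ F - Tr k 𝔤 χ' F := by
  rw [map_sub, Pi.sub_apply]

theorem Tr_smul_apply (k : ℕ) (c : ℚ) (χ : 𝔤.Character) (F : 𝔤.cartan) :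
    Tr k 𝔤 (c • χ) F = c * Tr k 𝔤 χ F := by
  rw [map_smul, Pi.smul_apply, Rat.smul_def]

@[simp]
theorem Tr_zero_apply (k : ℕ) (F : 𝔤.cartan) : Tr k 𝔤 0 F = 0 := by
  rw [map_zero, Pi.zero_apply]

section

variable {n : ℕ} (w : Fin n → 𝔤.Weight) (F : 𝔤.cartan)

theorem Tr_two_pmSum : Tr 2 𝔤 (pmSum w) F = 2 * ∑ j, w j F ^ 2 := by
  simp only [pmSum, Tr_sum_apply, Tr_add_apply, Tr_e, LinearMap.neg_apply, Finset.mul_sum]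
  exact Finset.sum_congr rfl fun j _ => by ring

theorem Tr_four_pmSum : Tr 4 𝔤 (pmSum w) F = 2 * ∑ j, w j F ^ 4 := by
  simp only [pmSum, Tr_sum_apply, Tr_add_apply, Tr_e, LinearMap.neg_apply, Finset.mul_sum]
  exact Finset.sum_congr rfl fun j _ => by ring

theorem Tr_two_pairSum : Tr 2 𝔤 (pairSum w) F = 4 * (n - 1) * ∑ j, w j F ^ 2 := by
  have key : ∀ j k : Fin n, (w j F + w k F) ^ 2 + (w j F - w k F) ^ 2 + (-w j F + w k F) ^ 2 +
      (-w j F - w k F) ^ 2 = 4 * w j F ^ 2 + 4 * w k F ^ 2 := fun j k => by ring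
  simp only [pairSum, Tr_sum_apply, Tr_add_apply, Tr_e, LinearMap.neg_apply, LinearMap.add_apply,
    LinearMap.sub_apply, key]
  rw [sum_sum_filter_lt _ fun j k => by ring]
  simp only [Finset.sum_add_distrib, ← Finset.mul_sum, Finset.sum_const, Finset.card_univ,
    Fintype.card_fin, nsmul_eq_mul]
  ring

theorem Tr_four_pairSum : Tr 4 𝔤 (pairSum w) F =
    4 * (n - 4) * ∑ j, w j F ^ 4 + 12 * (∑ j, w j F ^ 2) ^ 2 := by
  have key : ∀ j k : Fin n, (w j F + w k F) ^ 4 + (w j F - w k F) ^ 4 + (-w j F + w k F) ^ 4 +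
      (-w j F - w k F) ^ 4 = 4 * w j F ^ 4 + 24 * (w j F ^ 2 * w k F ^ 2) + 4 * w k F ^ 4 :=
    fun j k => by ring
  have key' : ∀ j, w j F ^ 2 * w j F ^ 2 = w j F ^ 4 := fun j => by ring
  simp only [pairSum, Tr_sum_apply, Tr_add_apply, Tr_e, LinearMap.neg_apply, LinearMap.add_apply,
    LinearMap.sub_apply, key]
  rw [sum_sum_filter_lt _ fun j k => by ring]
  simp only [Finset.sum_add_distrib, ← Finset.mul_sum, ← Finset.sum_mul, Finset.sum_const,
    Finset.card_univ, Fintype.card_fin, nsmul_eq_mul, key']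
  ring

theorem Tr_two_diffSum (h : ∑ j, w j F = 0) :
    Tr 2 𝔤 (diffSum w) F = 2 * n * ∑ j, w j F ^ 2 := by
  have key : ∀ j k : Fin n, (w j F - w k F) ^ 2 =
    w j F ^ 2 - 2 * (w j F * w k F) + w k F ^ 2 := fun j k => by ring
  simp only [diffSum, Tr_sum_apply, Tr_sub_apply, Tr_e, LinearMap.sub_apply, key,
    LinearMap.zero_apply, Finset.sum_add_distrib, Finset.sum_sub_distrib, ← Finset.mul_sum,
    ← Finset.sum_mul, Finset.sum_const, Finset.card_univ, Fintype.card_fin, nsmul_eq_mul, h]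
  ring

theorem Tr_four_diffSum (h : ∑ j, w j F = 0) :
    Tr 4 𝔤 (diffSum w) F = 2 * n * ∑ j, w j F ^ 4 + 6 * (∑ j, w j F ^ 2) ^ 2 := by
  have key : ∀ j k : Fin n, (w j F - w k F) ^ 4 =
    w j F ^ 4 - 4 * (w j F ^ 3 * w k F) + 6 * (w j F ^ 2 * w k F ^ 2) - 4 * (w j F * w k F ^ 3) +
      w k F ^ 4 := fun j k => by ring
  simp only [diffSum, Tr_sum_apply, Tr_sub_apply, Tr_e, LinearMap.sub_apply, key,
    LinearMap.zero_apply, Finset.sum_add_distrib, Finset.sum_sub_distrib, ← Finset.mul_sum,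
    ← Finset.sum_mul, Finset.sum_const, Finset.card_univ, Fintype.card_fin, nsmul_eq_mul, h]
  ring

theorem Tr_extSum (d k : ℕ) :
    Tr d 𝔤 (extSum k w) F = ∑ t ∈ Finset.univ.powersetCard k, (0 + ∑ j ∈ t, w j F) ^ d := by
  simp [extSum, Tr_sum_apply, LinearMap.sum_apply]

theorem Tr_extSum_one (d : ℕ) : Tr d 𝔤 (extSum 1 w) F = ∑ j, w j F ^ d := by
  simp [Tr_extSum, Finset.powersetCard_one]

theorem Tr_spinSum (d : ℕ) (P : (Fin n → ℤˣ) → Prop) [DecidablePred P] :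
    Tr d 𝔤 (spinSum P w) F = 1 / 2 ^ d *
      ∑ σ ∈ Finset.univ.filter P, (0 + ∑ j, ((σ j : ℤ) : ℂ) * w j F) ^ d := by
  simp only [spinSum, Tr_sum_apply, Tr_e, LinearMap.smul_apply, LinearMap.sum_apply, smul_eq_mul,
    zero_add, Finset.mul_sum (s := Finset.univ.filter P), mul_pow]
  simp

end

/-! ## Traces of the representations of the classical gauge algebras -/

section

variable {n : ℕ} (w : Fin n → 𝔤.Weight)

theorem sum_apply_eq_zero {w : Fin n → 𝔤.Weight} (hw : ∑ j, w j = 0) (F : 𝔤.cartan) :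
    ∑ j, w j F = 0 := by
  rw [← LinearMap.sum_apply, hw, LinearMap.zero_apply]

theorem Tr_two_diffSum_eq {w : Fin n → 𝔤.Weight} (hw : ∑ j, w j = 0) :
    Tr 2 𝔤 (diffSum w) = (2 * n : ℚ) • Tr 2 𝔤 (extSum 1 w) := by
  funext F
  simp only [Pi.smul_apply, Rat.smul_def]
  rw [Tr_two_diffSum _ _ (sum_apply_eq_zero hw F), Tr_extSum_one]
  push_cast
  ring

theorem Tr_two_extSum_two {w : Fin n → 𝔤.Weight} (hw : ∑ j, w j = 0) :
    Tr 2 𝔤 (extSum 2 w) = (n - 2 : ℚ) • Tr 2 𝔤 (extSum 1 w) := by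
  funext F
  simp only [Pi.smul_apply, Rat.smul_def]
  rw [Tr_extSum, Tr_extSum_one, sum_powersetCard_two_sq]
  simp only [pow_one, sum_apply_eq_zero hw F, Finset.card_univ, Fintype.card_fin]
  push_cast
  ring

theorem Tr_four_diffSum_eq {w : Fin n → 𝔤.Weight} (hw : ∑ j, w j = 0) :
    Tr 4 𝔤 (diffSum w) =
      (2 * n : ℚ) • Tr 4 𝔤 (extSum 1 w) + (6 : ℚ) • Tr 2 𝔤 (extSum 1 w) ^ 2 := by
  funext F
  simp only [Pi.smul_apply, Pi.add_apply, Pi.pow_apply, Rat.smul_def]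
  rw [Tr_four_diffSum _ _ (sum_apply_eq_zero hw F), Tr_extSum_one, Tr_extSum_one]
  push_cast
  ring

theorem Tr_four_extSum_two {w : Fin n → 𝔤.Weight} (hw : ∑ j, w j = 0) :
    Tr 4 𝔤 (extSum 2 w) =
      (n - 8 : ℚ) • Tr 4 𝔤 (extSum 1 w) + (3 : ℚ) • Tr 2 𝔤 (extSum 1 w) ^ 2 := by
  funext F
  simp only [Pi.smul_apply, Pi.add_apply, Pi.pow_apply, Rat.smul_def]
  rw [Tr_extSum, Tr_extSum_one, Tr_extSum_one, sum_powersetCard_two_pow_four]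
  simp only [pow_one, sum_apply_eq_zero hw F, Finset.card_univ, Fintype.card_fin]
  push_cast
  ring

/-- At most three numbers with sum zero satisfy p₄ = p₂²/2 for their power sums, by Newton's
identities. So 𝔰𝔲(2) and 𝔰𝔲(3) have no independent quartic Casimir operator. -/
theorem Tr_four_extSum_one_of_two {w : Fin 2 → 𝔤.Weight} (hw : ∑ j, w j = 0) :
    Tr 4 𝔤 (extSum 1 w) = (1 / 2 : ℚ) • Tr 2 𝔤 (extSum 1 w) ^ 2 := by
  funext F
  have h := sum_apply_eq_zero hw F
  simp only [Pi.smul_apply, Pi.pow_apply, Rat.smul_def, Tr_extSum_one, Fin.sum_univ_two] at h ⊢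
  rw [eq_neg_of_add_eq_zero_right h]
  push_cast
  ring

theorem Tr_four_extSum_one_of_three {w : Fin 3 → 𝔤.Weight} (hw : ∑ j, w j = 0) :
    Tr 4 𝔤 (extSum 1 w) = (1 / 2 : ℚ) • Tr 2 𝔤 (extSum 1 w) ^ 2 := by
  funext F
  have h := sum_apply_eq_zero hw F
  simp only [Pi.smul_apply, Pi.pow_apply, Rat.smul_def, Tr_extSum_one, Fin.sum_univ_three] at h ⊢
  rw [eq_neg_of_add_eq_zero_right h]
  push_cast
  ring

theorem Tr_two_symplectic_adj :
    Tr 2 𝔤 (pairSum w + pmSum (fun j => (2 : ℂ) • w j) + (n : ℚ) • e 0) =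
      (2 * n + 2 : ℚ) • Tr 2 𝔤 (pmSum w) := by
  funext F
  simp only [Pi.smul_apply, Rat.smul_def, Tr_add_apply, Tr_smul_apply, Tr_e,
    Tr_two_pairSum, Tr_two_pmSum, LinearMap.smul_apply, smul_eq_mul, mul_pow, ← Finset.mul_sum,
    LinearMap.zero_apply]
  push_cast
  ring

theorem Tr_two_symplectic_asym :
    Tr 2 𝔤 (pairSum w + ((n : ℚ) - 1) • e 0) = (2 * n - 2 : ℚ) • Tr 2 𝔤 (pmSum w) := by
  funext F
  simp only [Pi.smul_apply, Rat.smul_def, Tr_add_apply, Tr_smul_apply, Tr_e,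
    Tr_two_pairSum, Tr_two_pmSum, LinearMap.zero_apply]
  push_cast
  ring

theorem Tr_four_symplectic_adj :
    Tr 4 𝔤 (pairSum w + pmSum (fun j => (2 : ℂ) • w j) + (n : ℚ) • e 0) =
      (2 * n + 8 : ℚ) • Tr 4 𝔤 (pmSum w) + (3 : ℚ) • Tr 2 𝔤 (pmSum w) ^ 2 := by
  funext F
  simp only [Pi.smul_apply, Pi.add_apply, Pi.pow_apply, Rat.smul_def, Tr_add_apply,
    Tr_smul_apply, Tr_e, Tr_four_pairSum, Tr_two_pmSum, Tr_four_pmSum, LinearMap.smul_apply,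
    smul_eq_mul, mul_pow, ← Finset.mul_sum, LinearMap.zero_apply]
  push_cast
  ring

theorem Tr_four_symplectic_asym :
    Tr 4 𝔤 (pairSum w + ((n : ℚ) - 1) • e 0) =
      (2 * n - 8 : ℚ) • Tr 4 𝔤 (pmSum w) + (3 : ℚ) • Tr 2 𝔤 (pmSum w) ^ 2 := by
  funext F
  simp only [Pi.smul_apply, Pi.add_apply, Pi.pow_apply, Rat.smul_def, Tr_add_apply,
    Tr_smul_apply, Tr_e, Tr_four_pairSum, Tr_two_pmSum, Tr_four_pmSum, LinearMap.zero_apply]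
  push_cast
  ring

section

variable (b : Prop) [Decidable b]

/-- The zero weight present for odd `l` does not contribute to traces of positive powers, so `b`
drops out and both parities are treated together. -/
theorem Tr_two_orthogonal_vect (F : 𝔤.cartan) :
    Tr 2 𝔤 (pmSum w + if b then e 0 else 0) F = 2 * ∑ j, w j F ^ 2 := by
  by_cases hb : b <;> simp [hb, Tr_add_apply, Tr_two_pmSum]

theorem Tr_four_orthogonal_vect (F : 𝔤.cartan) :
    Tr 4 𝔤 (pmSum w + if b then e 0 else 0) F = 2 * ∑ j, w j F ^ 4 := by
  by_cases hb : b <;> simp [hb, Tr_add_apply, Tr_four_pmSum]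

theorem Tr_two_orthogonal_adj {l : ℕ} (hl : (l : ℚ) = 2 * n + if b then 1 else 0) :
    Tr 2 𝔤 (pairSum w + (n : ℚ) • e 0 + if b then pmSum w else 0) =
      (2 * l - 4 : ℚ) • ((1 / 2 : ℚ) • Tr 2 𝔤 (pmSum w + if b then e 0 else 0)) := by
  funext F
  simp only [Pi.smul_apply, Rat.smul_def, Tr_two_orthogonal_vect]
  rw [hl]
  by_cases hb : b <;> simp only [hb, if_true, if_false, Tr_add_apply, Tr_smul_apply, Tr_e,
    Tr_two_pairSum, Tr_two_pmSum, LinearMap.zero_apply, Tr_zero_apply] <;> push_cast <;> ring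

theorem Tr_four_orthogonal_adj {l : ℕ} (hl : (l : ℚ) = 2 * n + if b then 1 else 0) :
    Tr 4 𝔤 (pairSum w + (n : ℚ) • e 0 + if b then pmSum w else 0) =
      (l - 8 : ℚ) • Tr 4 𝔤 (pmSum w + if b then e 0 else 0) +
      (12 : ℚ) • ((1 / 2 : ℚ) • Tr 2 𝔤 (pmSum w + if b then e 0 else 0)) ^ 2 := by
  funext F
  simp only [Pi.smul_apply, Pi.add_apply, Pi.pow_apply, Rat.smul_def, Tr_two_orthogonal_vect,
    Tr_four_orthogonal_vect]
  rw [hl]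
  by_cases hb : b <;> simp only [hb, if_true, if_false, Tr_add_apply, Tr_smul_apply, Tr_e,
    Tr_four_pairSum, Tr_four_pmSum, LinearMap.zero_apply, Tr_zero_apply] <;> push_cast <;> ring

theorem Tr_two_spinSum_true (P : (Fin n → ℤˣ) → Prop) [DecidablePred P] (hP : ∀ σ, P σ) :
    Tr 2 𝔤 (spinSum P w) =
      (2 ^ n / 4 : ℚ) • ((1 / 2 : ℚ) • Tr 2 𝔤 (pmSum w + if b then e 0 else 0)) := by
  funext F
  simp only [Pi.smul_apply, Rat.smul_def, Tr_two_orthogonal_vect, Tr_spinSum,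
    Finset.filter_true_of_mem fun σ _ => hP σ, sum_sign_sq]
  push_cast
  ring

theorem Tr_four_spinSum_true (P : (Fin n → ℤˣ) → Prop) [DecidablePred P] (hP : ∀ σ, P σ) :
    Tr 4 𝔤 (spinSum P w) =
      (-(2 ^ n / 16) : ℚ) • Tr 4 𝔤 (pmSum w + if b then e 0 else 0) +
      (3 * 2 ^ n / 16 : ℚ) • ((1 / 2 : ℚ) • Tr 2 𝔤 (pmSum w + if b then e 0 else 0)) ^ 2 := by
  funext F
  simp only [Pi.smul_apply, Pi.add_apply, Pi.pow_apply, Rat.smul_def, Tr_two_orthogonal_vect,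
    Tr_four_orthogonal_vect, Tr_spinSum, Finset.filter_true_of_mem fun σ _ => hP σ,
    sum_sign_pow_four]
  push_cast
  ring

/-- A half-spinor trace is half the trace over all sign choices plus a sign-weighted sum, and the
latter vanishes for `3 ≤ n`. -/
theorem Tr_two_spinSum_prod (hn : 3 ≤ n) (ν : ℤˣ) (P : (Fin n → ℤˣ) → Prop) [DecidablePred P]
    (hP : ∀ σ, P σ ↔ ∏ j, σ j = ν) :
    Tr 2 𝔤 (spinSum P w) =
      (2 ^ n / 8 : ℚ) • ((1 / 2 : ℚ) • Tr 2 𝔤 (pmSum w + if b then e 0 else 0)) := by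
  funext F
  simp only [Pi.smul_apply, Rat.smul_def, Tr_two_orthogonal_vect, Tr_spinSum, hP,
    sum_filter_prod_eq, sum_sign_sq]
  obtain ⟨n, rfl⟩ := Nat.exists_eq_add_of_le' hn
  rw [sum_sign_mul_prod_sq]
  push_cast
  ring

theorem Tr_four_spinSum_prod (hn : 5 ≤ n) (ν : ℤˣ) (P : (Fin n → ℤˣ) → Prop) [DecidablePred P]
    (hP : ∀ σ, P σ ↔ ∏ j, σ j = ν) :
    Tr 4 𝔤 (spinSum P w) =
      (-(2 ^ n / 32) : ℚ) • Tr 4 𝔤 (pmSum w + if b then e 0 else 0) +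
      (3 * 2 ^ n / 32 : ℚ) • ((1 / 2 : ℚ) • Tr 2 𝔤 (pmSum w + if b then e 0 else 0)) ^ 2 := by
  funext F
  simp only [Pi.smul_apply, Pi.add_apply, Pi.pow_apply, Rat.smul_def, Tr_two_orthogonal_vect,
    Tr_four_orthogonal_vect, Tr_spinSum, hP, sum_filter_prod_eq, sum_sign_pow_four]
  obtain ⟨n, rfl⟩ := Nat.exists_eq_add_of_le' hn
  rw [sum_sign_mul_prod_pow_four]
  push_cast
  ring

/-- The sign-weighted terms of the two chiralities are opposite, so their sum needs no lower bound
on `n`; this covers `n = 4`. -/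
theorem Tr_four_spinSum_add_spinSum (P Q : (Fin n → ℤˣ) → Prop) [DecidablePred P]
    [DecidablePred Q] (hP : ∀ σ, P σ ↔ ∏ j, σ j = 1) (hQ : ∀ σ, Q σ ↔ ∏ j, σ j = -1) :
    Tr 4 𝔤 (spinSum P w) + Tr 4 𝔤 (spinSum Q w) =
      (-(2 ^ n / 16) : ℚ) • Tr 4 𝔤 (pmSum w + if b then e 0 else 0) +
      (3 * 2 ^ n / 16 : ℚ) • ((1 / 2 : ℚ) • Tr 2 𝔤 (pmSum w + if b then e 0 else 0)) ^ 2 := by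
  funext F
  simp only [Pi.smul_apply, Pi.add_apply, Pi.pow_apply, Rat.smul_def, Tr_two_orthogonal_vect,
    Tr_four_orthogonal_vect, Tr_spinSum, hP, hQ, sum_filter_prod_eq, sum_sign_pow_four]
  push_cast
  ring

end

end

/-! ### Specialization to the weights of 𝔰𝔲, 𝔰𝔭 and 𝔰𝔬 -/

theorem sum_ε_su (m : ℕ) : ∑ j : Fin m, ε (.su m) j = 0 := by
  refine LinearMap.ext fun F => ?_
  rw [LinearMap.sum_apply]
  exact F.2

theorem Tr_two_adj_su (m : ℕ) :
    Tr 2 (.su m) (rep .adj (.su m)) = (2 * m : ℚ) • normTr2 (.su m) :=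
  Tr_two_diffSum_eq (sum_ε_su m)

theorem Tr_two_fund_su (m : ℕ) : Tr 2 (.su m) (rep .fund (.su m)) = normTr2 (.su m) := rfl

theorem Tr_two_asym_su (m : ℕ) :
    Tr 2 (.su m) (rep .asym (.su m)) = (m - 2 : ℚ) • normTr2 (.su m) :=
  Tr_two_extSum_two (sum_ε_su m)

theorem Tr_four_adj_su (m : ℕ) : Tr 4 (.su m) (rep .adj (.su m)) =
    (2 * m : ℚ) • Tr 4 (.su m) (rep .fund (.su m)) + (6 : ℚ) • normTr2 (.su m) ^ 2 :=
  Tr_four_diffSum_eq (sum_ε_su m)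

theorem Tr_four_asym_su (m : ℕ) : Tr 4 (.su m) (rep .asym (.su m)) =
    (m - 8 : ℚ) • Tr 4 (.su m) (rep .fund (.su m)) + (3 : ℚ) • normTr2 (.su m) ^ 2 :=
  Tr_four_extSum_two (sum_ε_su m)

theorem Tr_four_fund_su_two :
    Tr 4 (.su 2) (rep .fund (.su 2)) = (1 / 2 : ℚ) • normTr2 (.su 2) ^ 2 :=
  Tr_four_extSum_one_of_two (sum_ε_su 2)

theorem Tr_four_fund_su_three :
    Tr 4 (.su 3) (rep .fund (.su 3)) = (1 / 2 : ℚ) • normTr2 (.su 3) ^ 2 :=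
  Tr_four_extSum_one_of_three (sum_ε_su 3)

theorem Tr_two_adj_sp (n : ℕ) :
    Tr 2 (.sp n) (rep .adj (.sp n)) = (2 * n + 2 : ℚ) • normTr2 (.sp n) :=
  Tr_two_symplectic_adj (𝔤 := .sp n) _

theorem Tr_two_fund_sp (n : ℕ) : Tr 2 (.sp n) (rep .fund (.sp n)) = normTr2 (.sp n) := rfl

theorem Tr_two_asym_sp (n : ℕ) :
    Tr 2 (.sp n) (rep .asym (.sp n)) = (2 * n - 2 : ℚ) • normTr2 (.sp n) :=
  Tr_two_symplectic_asym (𝔤 := .sp n) _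

theorem Tr_four_adj_sp (n : ℕ) : Tr 4 (.sp n) (rep .adj (.sp n)) =
    (2 * n + 8 : ℚ) • Tr 4 (.sp n) (rep .fund (.sp n)) + (3 : ℚ) • normTr2 (.sp n) ^ 2 :=
  Tr_four_symplectic_adj (𝔤 := .sp n) _

theorem Tr_four_asym_sp (n : ℕ) : Tr 4 (.sp n) (rep .asym (.sp n)) =
    (2 * n - 8 : ℚ) • Tr 4 (.sp n) (rep .fund (.sp n)) + (3 : ℚ) • normTr2 (.sp n) ^ 2 :=
  Tr_four_symplectic_asym (𝔤 := .sp n) _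

theorem Tr_two_vect_so (l : ℕ) :
    Tr 2 (.so l) (rep .vect (.so l)) = (2 : ℚ) • normTr2 (.so l) := by
  simp [normTr2, smul_smul]

theorem cast_eq_two_mul_half_add (l : ℕ) : (l : ℚ) = 2 * (l / 2 : ℕ) + if Odd l then 1 else 0 := by
  rcases Nat.even_or_odd' l with ⟨n, rfl | rfl⟩
  · simp
  · rw [show (2 * n + 1) / 2 = n by omega]
    simp

theorem Tr_two_adj_so (l : ℕ) :
    Tr 2 (.so l) (rep .adj (.so l)) = (2 * l - 4 : ℚ) • normTr2 (.so l) :=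
  Tr_two_orthogonal_adj (𝔤 := .so l) _ _ (cast_eq_two_mul_half_add l)

theorem Tr_four_adj_so (l : ℕ) : Tr 4 (.so l) (rep .adj (.so l)) =
    (l - 8 : ℚ) • Tr 4 (.so l) (rep .vect (.so l)) + (12 : ℚ) • normTr2 (.so l) ^ 2 :=
  Tr_four_orthogonal_adj (𝔤 := .so l) _ _ (cast_eq_two_mul_half_add l)

theorem Tr_two_spin_so_odd (ν : ℤˣ) {l : ℕ} (hl : Odd l) :
    Tr 2 (.so l) (rep (.spin ν) (.so l)) = (2 ^ (l / 2) / 4 : ℚ) • normTr2 (.so l) := by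
  rcases Int.units_eq_one_or ν with rfl | rfl
  · exact Tr_two_spinSum_true (𝔤 := .so l) _ _ _ fun _ => Or.inl hl
  · exact Tr_two_spinSum_true (𝔤 := .so l) _ _ _ fun _ => Or.inl hl

theorem Tr_four_spin_so_odd (ν : ℤˣ) {l : ℕ} (hl : Odd l) :
    Tr 4 (.so l) (rep (.spin ν) (.so l)) =
      (-(2 ^ (l / 2) / 16) : ℚ) • Tr 4 (.so l) (rep .vect (.so l)) +
        (3 * 2 ^ (l / 2) / 16 : ℚ) • normTr2 (.so l) ^ 2 := by
  rcases Int.units_eq_one_or ν with rfl | rfl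
  · exact Tr_four_spinSum_true (𝔤 := .so l) _ _ _ fun _ => Or.inl hl
  · exact Tr_four_spinSum_true (𝔤 := .so l) _ _ _ fun _ => Or.inl hl

theorem Tr_two_spin_so_even (ν : ℤˣ) {l : ℕ} (hl : ¬ Odd l) (h : 3 ≤ l / 2) :
    Tr 2 (.so l) (rep (.spin ν) (.so l)) = (2 ^ (l / 2) / 8 : ℚ) • normTr2 (.so l) := by
  rcases Int.units_eq_one_or ν with rfl | rfl
  · exact Tr_two_spinSum_prod (𝔤 := .so l) _ _ h 1 _ fun _ => or_iff_right hl
  · exact Tr_two_spinSum_prod (𝔤 := .so l) _ _ h (-1) _ fun _ => or_iff_right hl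

theorem Tr_four_spin_so_even (ν : ℤˣ) {l : ℕ} (hl : ¬ Odd l) (h : 5 ≤ l / 2) :
    Tr 4 (.so l) (rep (.spin ν) (.so l)) =
      (-(2 ^ (l / 2) / 32) : ℚ) • Tr 4 (.so l) (rep .vect (.so l)) +
        (3 * 2 ^ (l / 2) / 32 : ℚ) • normTr2 (.so l) ^ 2 := by
  rcases Int.units_eq_one_or ν with rfl | rfl
  · exact Tr_four_spinSum_prod (𝔤 := .so l) _ _ h 1 _ fun _ => or_iff_right hl
  · exact Tr_four_spinSum_prod (𝔤 := .so l) _ _ h (-1) _ fun _ => or_iff_right hl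

theorem Tr_four_spin_so_eight :
    Tr 4 (.so 8) (rep .spinPlus (.so 8)) + Tr 4 (.so 8) (rep .spinMinus (.so 8)) =
      (-(2 ^ 4 / 16) : ℚ) • Tr 4 (.so 8) (rep .vect (.so 8)) +
        (3 * 2 ^ 4 / 16 : ℚ) • normTr2 (.so 8) ^ 2 :=
  have h8 : ¬ Odd 8 := by decide
  Tr_four_spinSum_add_spinSum (𝔤 := .so 8) (n := 4) _ _ _ _ (fun _ => or_iff_right h8)
    fun _ => or_iff_right h8

/-! ## Traces of the representations of the exceptional gauge algebras -/

section

theorem Tr_two_extSum_neg {n : ℕ} (k : ℕ) (w : Fin n → 𝔤.Weight) :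
    Tr 2 𝔤 (extSum k fun j => -w j) = Tr 2 𝔤 (extSum k w) := by
  funext F
  simp only [Tr_extSum, zero_add, LinearMap.neg_apply, Finset.sum_neg_distrib, neg_sq]

theorem Tr_four_extSum_neg {n : ℕ} (k : ℕ) (w : Fin n → 𝔤.Weight) :
    Tr 4 𝔤 (extSum k fun j => -w j) = Tr 4 𝔤 (extSum k w) := by
  funext F
  simp only [Tr_extSum, zero_add, LinearMap.neg_apply, Finset.sum_neg_distrib,
    Even.neg_pow (show Even 4 by decide)]

/-- Under 𝔰𝔲(8) the adjoint of 𝔢₇ is adj + Λ⁴ and the 56 is Λ² plus its dual. The power sum p₄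
disappears: it has coefficient 16 in adj, -16 in Λ⁴, and 8 - 8 = 0 in Λ². The cubic power sum only
occurs multiplied by p₁ = 0. -/
theorem Tr_e7_adj {w : Fin 8 → 𝔤.Weight} (hw : ∑ j, w j = 0) :
    Tr 2 𝔤 (diffSum w + extSum 4 w) =
      (36 : ℚ) • (1 / 12 : ℚ) • Tr 2 𝔤 (extSum 2 w + extSum 2 fun j => -w j) ∧
    Tr 4 𝔤 (diffSum w + extSum 4 w) =
      (24 : ℚ) • ((1 / 12 : ℚ) • Tr 2 𝔤 (extSum 2 w + extSum 2 fun j => -w j)) ^ 2 ∧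
    Tr 4 𝔤 (extSum 2 w + extSum 2 fun j => -w j) =
      (6 : ℚ) • ((1 / 12 : ℚ) • Tr 2 𝔤 (extSum 2 w + extSum 2 fun j => -w j)) ^ 2 := by
  simp only [map_add, Tr_two_extSum_neg, Tr_four_extSum_neg]
  refine ⟨funext fun F => ?_, funext fun F => ?_, funext fun F => ?_⟩ <;>
  · have h := sum_apply_eq_zero hw F
    simp only [Pi.add_apply, Pi.smul_apply, Pi.pow_apply, Rat.smul_def, Tr_two_diffSum _ _ h,
      Tr_four_diffSum _ _ h, Tr_extSum, sum_powersetCard_two_sq, sum_powersetCard_four_sq,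
      sum_powersetCard_two_pow_four, sum_powersetCard_four_pow_four, pow_one, h,
      Finset.card_univ, Fintype.card_fin]
    push_cast
    ring

/-- Under 𝔰𝔲(9) the adjoint is adj + Λ³ plus the dual of Λ³, where p₄ has coefficients 18, -9 and
-9. -/
theorem Tr_e8_adj {w : Fin 9 → 𝔤.Weight} (hw : ∑ j, w j = 0) :
    Tr 4 𝔤 (diffSum w + extSum 3 w + extSum 3 fun j => -w j) =
      (36 : ℚ) • ((1 / 60 : ℚ) •
        Tr 2 𝔤 (diffSum w + extSum 3 w + extSum 3 fun j => -w j)) ^ 2 := by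
  simp only [map_add, Tr_two_extSum_neg, Tr_four_extSum_neg]
  funext F
  have h := sum_apply_eq_zero hw F
  simp only [Pi.add_apply, Pi.smul_apply, Pi.pow_apply, Rat.smul_def, Tr_two_diffSum _ _ h,
    Tr_four_diffSum _ _ h, Tr_extSum, sum_powersetCard_three_sq,
    sum_powersetCard_three_pow_four, pow_one, h, Finset.card_univ, Fintype.card_fin]
  push_cast
  ring

/-- Under 𝔰𝔬(9) the 26 is vector, spinor and a singlet, and the adjoint is adj plus spinor. The sum
of fourth powers has coefficient 2 in the vector weights, -2 in the spinor weights, and 4(n - 4) = 0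
in `pairSum`. -/
theorem Tr_f4 (w : Fin 4 → 𝔤.Weight) :
    Tr 2 𝔤 (pairSum w + pmSum w + spinSum (fun _ => True) w + (4 : ℚ) • e 0) =
      (18 : ℚ) • (1 / 6 : ℚ) •
        Tr 2 𝔤 (pmSum w + spinSum (fun _ => True) w + (2 : ℚ) • e 0) ∧
    Tr 4 𝔤 (pairSum w + pmSum w + spinSum (fun _ => True) w + (4 : ℚ) • e 0) =
      (15 : ℚ) • ((1 / 6 : ℚ) •
        Tr 2 𝔤 (pmSum w + spinSum (fun _ => True) w + (2 : ℚ) • e 0)) ^ 2 ∧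
    Tr 4 𝔤 (pmSum w + spinSum (fun _ => True) w + (2 : ℚ) • e 0) =
      (3 : ℚ) • ((1 / 6 : ℚ) •
        Tr 2 𝔤 (pmSum w + spinSum (fun _ => True) w + (2 : ℚ) • e 0)) ^ 2 := by
  refine ⟨funext fun F => ?_, funext fun F => ?_, funext fun F => ?_⟩ <;>
  · simp only [Pi.smul_apply, Pi.pow_apply, Rat.smul_def, Tr_add_apply, Tr_smul_apply, Tr_e,
      Tr_two_pairSum, Tr_four_pairSum, Tr_two_pmSum, Tr_four_pmSum, Tr_spinSum,
      Finset.filter_true, sum_sign_sq, sum_sign_pow_four, LinearMap.zero_apply]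
    push_cast
    ring

/-- Under 𝔰𝔲(3) both representations are built from adj, 3, its dual and a singlet; eliminating one
coordinate leaves polynomial identities in two variables. -/
theorem Tr_g2 {w : Fin 3 → 𝔤.Weight} (hw : ∑ j, w j = 0) :
    Tr 2 𝔤 (diffSum w + pmSum w) = (8 : ℚ) • (1 / 2 : ℚ) • Tr 2 𝔤 (pmSum w + e 0) ∧
    Tr 4 𝔤 (diffSum w + pmSum w) = (10 : ℚ) • ((1 / 2 : ℚ) • Tr 2 𝔤 (pmSum w + e 0)) ^ 2 ∧
    Tr 4 𝔤 (pmSum w + e 0) = ((1 / 2 : ℚ) • Tr 2 𝔤 (pmSum w + e 0)) ^ 2 := by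
  refine ⟨funext fun F => ?_, funext fun F => ?_, funext fun F => ?_⟩ <;>
  · have h := sum_apply_eq_zero hw F
    simp only [Pi.smul_apply, Pi.pow_apply, Rat.smul_def, Tr_add_apply, Tr_e,
      Tr_two_diffSum _ _ h, Tr_four_diffSum _ _ h, Tr_two_pmSum, Tr_four_pmSum,
      LinearMap.zero_apply]
    simp only [Fin.sum_univ_three] at h ⊢
    rw [eq_neg_of_add_eq_zero_right h]
    push_cast
    ring

/-- Under 𝔰𝔲(3)³ the adjoint is the three adjoints plus (3,3,3) and its dual, and the 27 is the
cyclic sum of products of a 3 with a dual 3 of the next factor. Eliminating one coordinate per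
factor leaves polynomial identities in six variables. -/
theorem Tr_e6 {w : Fin 3 → Fin 3 → 𝔤.Weight} (hw : ∀ a, ∑ j, w a j = 0) :
    Tr 2 𝔤 ((∑ a, diffSum (w a)) + ∑ j, ∑ k, ∑ l,
        (e (w 0 j + w 1 k + w 2 l) + e (-(w 0 j + w 1 k + w 2 l)))) =
      (24 : ℚ) • (1 / 6 : ℚ) • Tr 2 𝔤 (∑ a, ∑ j, ∑ k, e (w a j - w (a + 1) k)) ∧
    Tr 4 𝔤 ((∑ a, diffSum (w a)) + ∑ j, ∑ k, ∑ l,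
        (e (w 0 j + w 1 k + w 2 l) + e (-(w 0 j + w 1 k + w 2 l)))) =
      (18 : ℚ) • ((1 / 6 : ℚ) • Tr 2 𝔤 (∑ a, ∑ j, ∑ k, e (w a j - w (a + 1) k))) ^ 2 ∧
    Tr 4 𝔤 (∑ a, ∑ j, ∑ k, e (w a j - w (a + 1) k)) =
      (3 : ℚ) • ((1 / 6 : ℚ) • Tr 2 𝔤 (∑ a, ∑ j, ∑ k, e (w a j - w (a + 1) k))) ^ 2 := by
  have h2 : (2 : Fin 3) + 1 = 0 := rfl
  have h1 : (1 : Fin 3) + 1 = 2 := rfl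
  refine ⟨funext fun F => ?_, funext fun F => ?_, funext fun F => ?_⟩ <;>
  · have h := fun a => sum_apply_eq_zero (hw a) F
    simp only [Pi.smul_apply, Pi.pow_apply, Rat.smul_def, Tr_add_apply, Tr_e, Tr_sum_apply,
      Tr_two_diffSum _ _ (h _), Tr_four_diffSum _ _ (h _), LinearMap.add_apply,
      LinearMap.sub_apply, LinearMap.neg_apply]
    simp only [Fin.sum_univ_three, zero_add, h1, h2] at h ⊢
    rw [eq_neg_of_add_eq_zero_right (h 0), eq_neg_of_add_eq_zero_right (h 1),
      eq_neg_of_add_eq_zero_right (h 2)]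
    push_cast
    ring

end

theorem sum_ε_e7 : ∑ j : Fin 8, ε .e7 j = 0 := by
  refine LinearMap.ext fun F => ?_
  rw [LinearMap.sum_apply]
  exact F.2

theorem sum_ε_e8 : ∑ j : Fin 9, ε .e8 j = 0 := by
  refine LinearMap.ext fun F => ?_
  rw [LinearMap.sum_apply]
  exact F.2

theorem sum_ε_g2 : ∑ j : Fin 3, ε .g2 j = 0 := by
  refine LinearMap.ext fun F => ?_
  rw [LinearMap.sum_apply]
  exact F.2

theorem sum_ε_e6 (a : Fin 3) : ∑ j : Fin 3, ε .e6 (a, j) = 0 := by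
  refine LinearMap.ext fun F => ?_
  rw [LinearMap.sum_apply]
  exact (Submodule.mem_iInf _).1 F.2 a

theorem Tr_two_adj_e6 : Tr 2 .e6 (rep .adj .e6) = (24 : ℚ) • normTr2 .e6 :=
  (Tr_e6 (𝔤 := .e6) (w := fun a j => ε .e6 (a, j)) sum_ε_e6).1

theorem Tr_four_adj_e6 : Tr 4 .e6 (rep .adj .e6) = (18 : ℚ) • normTr2 .e6 ^ 2 :=
  (Tr_e6 (𝔤 := .e6) (w := fun a j => ε .e6 (a, j)) sum_ε_e6).2.1

theorem Tr_two_small_e6 : Tr 2 .e6 (rep .small .e6) = (6 : ℚ) • normTr2 .e6 := by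
  simp [normTr2, smul_smul]

theorem Tr_four_small_e6 : Tr 4 .e6 (rep .small .e6) = (3 : ℚ) • normTr2 .e6 ^ 2 :=
  (Tr_e6 (𝔤 := .e6) (w := fun a j => ε .e6 (a, j)) sum_ε_e6).2.2

theorem Tr_two_adj_e7 : Tr 2 .e7 (rep .adj .e7) = (36 : ℚ) • normTr2 .e7 :=
  (Tr_e7_adj sum_ε_e7).1

theorem Tr_four_adj_e7 : Tr 4 .e7 (rep .adj .e7) = (24 : ℚ) • normTr2 .e7 ^ 2 :=
  (Tr_e7_adj sum_ε_e7).2.1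

theorem Tr_two_small_e7 : Tr 2 .e7 (rep .small .e7) = (12 : ℚ) • normTr2 .e7 := by
  simp [normTr2, smul_smul]

theorem Tr_four_small_e7 : Tr 4 .e7 (rep .small .e7) = (6 : ℚ) • normTr2 .e7 ^ 2 :=
  (Tr_e7_adj sum_ε_e7).2.2

theorem Tr_two_adj_e8 : Tr 2 .e8 (rep .adj .e8) = (60 : ℚ) • normTr2 .e8 := by
  simp [normTr2, smul_smul]

theorem Tr_four_adj_e8 : Tr 4 .e8 (rep .adj .e8) = (36 : ℚ) • normTr2 .e8 ^ 2 :=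
  Tr_e8_adj sum_ε_e8

theorem Tr_two_adj_f4 : Tr 2 .f4 (rep .adj .f4) = (18 : ℚ) • normTr2 .f4 :=
  (Tr_f4 (𝔤 := .f4) _).1

theorem Tr_four_adj_f4 : Tr 4 .f4 (rep .adj .f4) = (15 : ℚ) • normTr2 .f4 ^ 2 :=
  (Tr_f4 (𝔤 := .f4) _).2.1

theorem Tr_two_small_f4 : Tr 2 .f4 (rep .small .f4) = (6 : ℚ) • normTr2 .f4 := by
  simp [normTr2, smul_smul]

theorem Tr_four_small_f4 : Tr 4 .f4 (rep .small .f4) = (3 : ℚ) • normTr2 .f4 ^ 2 :=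
  (Tr_f4 (𝔤 := .f4) _).2.2

theorem Tr_two_adj_g2 : Tr 2 .g2 (rep .adj .g2) = (8 : ℚ) • normTr2 .g2 :=
  (Tr_g2 (𝔤 := .g2) sum_ε_g2).1

theorem Tr_four_adj_g2 : Tr 4 .g2 (rep .adj .g2) = (10 : ℚ) • normTr2 .g2 ^ 2 :=
  (Tr_g2 (𝔤 := .g2) sum_ε_g2).2.1

theorem Tr_two_small_g2 : Tr 2 .g2 (rep .small .g2) = (2 : ℚ) • normTr2 .g2 := by
  simp [normTr2, smul_smul]

theorem Tr_four_small_g2 : Tr 4 .g2 (rep .small .g2) = normTr2 .g2 ^ 2 :=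
  (Tr_g2 (𝔤 := .g2) sum_ε_g2).2.2

/-! ## The cycles `Γ_ρ` and their traces -/

open TensorProduct

theorem sum_repName {M : Type*} [AddCommMonoid M] (f : RepName → M) :
    ∑ ρ, f ρ = f .adj + (f .fund + (f .asym + (f .vect + (f .spinPlus +
      (f .spinMinus + f .small))))) := by
  have h : (Finset.univ : Finset RepName) =
    {.adj, .fund, .asym, .vect, .spinPlus, .spinMinus, .small} := rfl
  rw [h]
  simp

section

variable {A : Type} [AddCommGroup A] [Module ℚ A] (ℓ σ : A) (ν : ℤˣ)

/-- The cycle `∑ Γ_ρ ⊗ ρ`. -/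
def gammaSum (𝔤 : GaugeAlgebra) : A ⊗[ℚ] 𝔤.Character :=
  ∑ ρ : RepName, gammaClass ℓ σ ν 𝔤 ρ ⊗ₜ[ℚ] rep ρ 𝔤

theorem gammaSum_su_two : gammaSum ℓ σ ν (.su 2) =
    ((-1 / 2 : ℚ) • ℓ + (1 / 2 : ℚ) • σ) ⊗ₜ[ℚ] rep .adj (.su 2) +
      ((8 : ℚ) • ℓ + (-2 : ℚ) • σ) ⊗ₜ[ℚ] rep .fund (.su 2) := by
  simp [gammaSum, sum_repName, gammaClass, gammaCoeff]

theorem gammaSum_su_three : gammaSum ℓ σ ν (.su 3) =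
    ((-1 / 2 : ℚ) • ℓ + (1 / 2 : ℚ) • σ) ⊗ₜ[ℚ] rep .adj (.su 3) +
      ((9 : ℚ) • ℓ + (-3 : ℚ) • σ) ⊗ₜ[ℚ] rep .fund (.su 3) := by
  simp [gammaSum, sum_repName, gammaClass, gammaCoeff]

theorem gammaSum_su {m : ℕ} (hm : 4 ≤ m) : gammaSum ℓ σ ν (.su m) =
    ((-1 / 2 : ℚ) • ℓ + (1 / 2 : ℚ) • σ) ⊗ₜ[ℚ] rep .adj (.su m) +
      (((8 : ℚ) • ℓ + (-m : ℚ) • σ) ⊗ₜ[ℚ] rep .fund (.su m) + ℓ ⊗ₜ[ℚ] rep .asym (.su m)) := by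
  have h : gammaCoeff ν (.su m) .fund = ((8 : ℚ), (-m : ℚ)) := by
    unfold gammaCoeff
    split <;> simp_all
  simp only [gammaSum, sum_repName, gammaClass, h]
  simp [gammaCoeff, rep, hm]

theorem gammaSum_sp (n : ℕ) : gammaSum ℓ σ ν (.sp n) =
    ((-1 / 2 : ℚ) • ℓ + (1 / 2 : ℚ) • σ) ⊗ₜ[ℚ] rep .adj (.sp n) +
      (((8 : ℚ) • ℓ + (-2 * n : ℚ) • σ) ⊗ₜ[ℚ] rep .fund (.sp n) +
        ((1 / 2 : ℚ) • ℓ + (1 / 2 : ℚ) • σ) ⊗ₜ[ℚ] rep .asym (.sp n)) := by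
  simp [gammaSum, sum_repName, gammaClass, gammaCoeff, rep]

theorem gammaSum_so_eight : gammaSum ℓ σ ν (.so 8) =
    ((-1 / 2 : ℚ) • ℓ + (1 / 2 : ℚ) • σ) ⊗ₜ[ℚ] rep .adj (.so 8) +
      (((2 : ℚ) • ℓ + (-1 : ℚ) • σ) ⊗ₜ[ℚ] rep .vect (.so 8) +
      (((2 : ℚ) • ℓ + (-1 : ℚ) • σ) ⊗ₜ[ℚ] rep .spinPlus (.so 8) +
        ((2 : ℚ) • ℓ + (-1 : ℚ) • σ) ⊗ₜ[ℚ] rep .spinMinus (.so 8))) := by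
  simp only [gammaSum, sum_repName, gammaClass, gammaCoeff]
  norm_num [rep]

theorem gammaSum_so {l : ℕ} (hl : l ≠ 8) (hl' : l ≤ 14) : gammaSum ℓ σ ν (.so l) =
    ((-1 / 2 : ℚ) • ℓ + (1 / 2 : ℚ) • σ) ⊗ₜ[ℚ] rep .adj (.so l) +
      ((((l - 4) / 2 : ℚ) • ℓ + ((6 - l) / 2 : ℚ) • σ) ⊗ₜ[ℚ] rep .vect (.so l) +
      ((32 / 2 ^ ((l - 1) / 2) : ℚ) • ℓ + (-16 / 2 ^ ((l - 1) / 2) : ℚ) • σ) ⊗ₜ[ℚ]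
        rep (.spin ν) (.so l)) := by
  have h : ∀ ρ, ρ = .spinPlus ∨ ρ = .spinMinus → gammaCoeff ν (.so l) ρ =
      if ρ = .spin ν then (32 / 2 ^ ((l - 1) / 2), -16 / 2 ^ ((l - 1) / 2)) else (0, 0) := by
    intro ρ hρ
    unfold gammaCoeff
    split <;> simp_all
  have h1 := h .spinPlus (Or.inl rfl)
  have h2 := h .spinMinus (Or.inr rfl)
  simp only [gammaSum, sum_repName, gammaClass, h1, h2]
  rcases Int.units_eq_one_or ν with rfl | rfl <;> simp [gammaCoeff, rep, hl', RepName.spin]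

theorem gammaSum_so_large {l : ℕ} (hl : 15 ≤ l) : gammaSum ℓ σ ν (.so l) =
    ((-1 / 2 : ℚ) • ℓ + (1 / 2 : ℚ) • σ) ⊗ₜ[ℚ] rep .adj (.so l) +
      gammaClass ℓ σ ν (.so l) .vect ⊗ₜ[ℚ] rep .vect (.so l) := by
  have h : ∀ ρ, ρ = .spinPlus ∨ ρ = .spinMinus → gammaCoeff ν (.so l) ρ = (0, 0) := by
    intro ρ hρ
    have : ¬ l ≤ 14 := by omega
    unfold gammaCoeff
    split <;> simp_all
  have h1 := h .spinPlus (Or.inl rfl)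
  have h2 := h .spinMinus (Or.inr rfl)
  simp only [gammaSum, sum_repName, gammaClass, h1, h2]
  simp [rep]
  simp [gammaCoeff]

theorem gammaSum_e6 : gammaSum ℓ σ ν .e6 =
    ((-1 / 2 : ℚ) • ℓ + (1 / 2 : ℚ) • σ) ⊗ₜ[ℚ] rep .adj .e6 +
      ((3 : ℚ) • ℓ + (-2 : ℚ) • σ) ⊗ₜ[ℚ] rep .small .e6 := by
  simp [gammaSum, sum_repName, gammaClass, gammaCoeff]

theorem gammaSum_e7 : gammaSum ℓ σ ν .e7 =
    ((-1 / 2 : ℚ) • ℓ + (1 / 2 : ℚ) • σ) ⊗ₜ[ℚ] rep .adj .e7 +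
      ((2 : ℚ) • ℓ + (-3 / 2 : ℚ) • σ) ⊗ₜ[ℚ] rep .small .e7 := by
  simp [gammaSum, sum_repName, gammaClass, gammaCoeff]

theorem gammaSum_e8 : gammaSum ℓ σ ν .e8 =
    ((-1 / 2 : ℚ) • ℓ + (1 / 2 : ℚ) • σ) ⊗ₜ[ℚ] rep .adj .e8 := by
  simp [gammaSum, sum_repName, gammaClass, gammaCoeff]

theorem gammaSum_f4 : gammaSum ℓ σ ν .f4 =
    ((-1 / 2 : ℚ) • ℓ + (1 / 2 : ℚ) • σ) ⊗ₜ[ℚ] rep .adj .f4 +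
      ((5 / 2 : ℚ) • ℓ + (-3 / 2 : ℚ) • σ) ⊗ₜ[ℚ] rep .small .f4 := by
  simp [gammaSum, sum_repName, gammaClass, gammaCoeff]

theorem gammaSum_g2 : gammaSum ℓ σ ν .g2 =
    ((-1 / 2 : ℚ) • ℓ + (1 / 2 : ℚ) • σ) ⊗ₜ[ℚ] rep .adj .g2 +
      ((5 : ℚ) • ℓ + (-2 : ℚ) • σ) ⊗ₜ[ℚ] rep .small .g2 := by
  simp [gammaSum, sum_repName, gammaClass, gammaCoeff]

/-! ### Evaluation of the trace operators on cycles -/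

theorem eq_one_smul_add {𝔤 : GaugeAlgebra} (Q M : Casimir 𝔤) :
    Q = (1 : ℚ) • Q + (0 : ℚ) • M := by
  rw [one_smul, zero_smul, add_zero]

theorem eq_smul_of_eq_smul_add {𝔤 : GaugeAlgebra} {P Q M : Casimir 𝔤} {c d r : ℚ}
    (h : P = c • Q + d • M) (hQ : Q = r • M) : P = (c * r + d) • M := by
  rw [h, hQ, smul_smul, add_smul]

theorem Xop_tmul {k : ℕ} {𝔤 : GaugeAlgebra} {χ : 𝔤.Character} {M : Casimir 𝔤} {c : ℚ}
    (h : Tr k 𝔤 χ = c • M) (a : A) : Xop A k 𝔤 (a ⊗ₜ[ℚ] χ) = (c • a) ⊗ₜ[ℚ] M := by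
  rw [Xop, LinearMap.lTensor_tmul, h, tmul_smul, smul_tmul']

theorem Xop_add {k : ℕ} {𝔤 : GaugeAlgebra} {x y : A ⊗[ℚ] 𝔤.Character} {M : Casimir 𝔤} {a b : A}
    (hx : Xop A k 𝔤 x = a ⊗ₜ[ℚ] M) (hy : Xop A k 𝔤 y = b ⊗ₜ[ℚ] M) :
    Xop A k 𝔤 (x + y) = (a + b) ⊗ₜ[ℚ] M := by
  rw [map_add, hx, hy, add_tmul]

/-- In the applications `Q` is the quartic trace in the fundamental or vector representation and `M`
is (tr F²)². The two components are kept apart so that the vanishing of the `Q`-component can be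
checked in `A`. -/
theorem Xop_tmul' {k : ℕ} {𝔤 : GaugeAlgebra} {χ : 𝔤.Character} {Q M : Casimir 𝔤} {c d : ℚ}
    (h : Tr k 𝔤 χ = c • Q + d • M) (a : A) :
    Xop A k 𝔤 (a ⊗ₜ[ℚ] χ) = (c • a) ⊗ₜ[ℚ] Q + (d • a) ⊗ₜ[ℚ] M := by
  rw [Xop, LinearMap.lTensor_tmul, h, tmul_add, tmul_smul, tmul_smul, smul_tmul', smul_tmul']

theorem Xop_add' {k : ℕ} {𝔤 : GaugeAlgebra} {x y : A ⊗[ℚ] 𝔤.Character} {Q M : Casimir 𝔤}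
    {a b a' b' : A} (hx : Xop A k 𝔤 x = a ⊗ₜ[ℚ] Q + b ⊗ₜ[ℚ] M)
    (hy : Xop A k 𝔤 y = a' ⊗ₜ[ℚ] Q + b' ⊗ₜ[ℚ] M) :
    Xop A k 𝔤 (x + y) = (a + a') ⊗ₜ[ℚ] Q + (b + b') ⊗ₜ[ℚ] M := by
  rw [map_add, hx, hy, add_tmul, add_tmul]
  abel

/-- For 𝔰𝔬(8) the quartic trace is known only for the sum of the half-spinors; this is enough
because both have the same class. -/
theorem Xop_tmul_add_tmul {k : ℕ} {𝔤 : GaugeAlgebra} {χ χ' : 𝔤.Character} {Q M : Casimir 𝔤}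
    {c d : ℚ} (h : Tr k 𝔤 χ + Tr k 𝔤 χ' = c • Q + d • M) (a : A) :
    Xop A k 𝔤 (a ⊗ₜ[ℚ] χ + a ⊗ₜ[ℚ] χ') = (c • a) ⊗ₜ[ℚ] Q + (d • a) ⊗ₜ[ℚ] M := by
  rw [← tmul_add]
  exact Xop_tmul' (by rw [map_add, h]) a

theorem eq_tmul_of_eq {𝔤 : GaugeAlgebra} {x : A ⊗[ℚ] Casimir 𝔤} {M : Casimir 𝔤} {a b : A}
    (h : x = a ⊗ₜ[ℚ] M) (hb : a = b) : x = b ⊗ₜ[ℚ] M := by rw [h, hb]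

theorem eq_tmul_of_eq' {𝔤 : GaugeAlgebra} {x : A ⊗[ℚ] Casimir 𝔤} {Q M : Casimir 𝔤} {a b c : A}
    (h : x = a ⊗ₜ[ℚ] Q + b ⊗ₜ[ℚ] M) (ha : a = 0) (hb : b = c) : x = c ⊗ₜ[ℚ] M := by
  rw [h, ha, hb, zero_tmul, zero_add]

/-- The trace identities satisfied by the cycle `∑ Γ_ρ ⊗ ρ`. -/
def TraceIdentities (𝔤 : GaugeAlgebra) : Prop :=
  Xop A 2 𝔤 (gammaSum ℓ σ ν 𝔤) = ((6 : ℚ) • ℓ) ⊗ₜ[ℚ] normTr2 𝔤 ∧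
  Xop A 4 𝔤 (gammaSum ℓ σ ν 𝔤) = ((3 : ℚ) • σ) ⊗ₜ[ℚ] (normTr2 𝔤 ^ 2)

theorem Tr_two_fund_su' (m : ℕ) :
    Tr 2 (.su m) (rep .fund (.su m)) = (1 : ℚ) • normTr2 (.su m) := by
  rw [one_smul, Tr_two_fund_su]

theorem Tr_two_fund_sp' (n : ℕ) :
    Tr 2 (.sp n) (rep .fund (.sp n)) = (1 : ℚ) • normTr2 (.sp n) := by
  rw [one_smul, Tr_two_fund_sp]

/-- For `4 ≤ m` the coefficient of Tr_fund F⁴ is -m + 8 + (m - 8) = 0 in ℓ and m - m = 0 in σ. For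
`m = 2` and `m = 3` this trace is itself a multiple of (tr F²)². -/
theorem traceIdentities_su {m : ℕ} (hm : 2 ≤ m) : TraceIdentities ℓ σ ν (.su m) := by
  obtain rfl | rfl | hm : m = 2 ∨ m = 3 ∨ 4 ≤ m := by omega
  · rw [TraceIdentities, gammaSum_su_two]
    refine ⟨eq_tmul_of_eq (Xop_add (Xop_tmul (Tr_two_adj_su _) _) (Xop_tmul (Tr_two_fund_su' _) _))
      ?_, eq_tmul_of_eq (Xop_add (Xop_tmul (eq_smul_of_eq_smul_add (Tr_four_adj_su _)
        Tr_four_fund_su_two) _) (Xop_tmul Tr_four_fund_su_two _)) ?_⟩ <;>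
    · push_cast
      module
  · rw [TraceIdentities, gammaSum_su_three]
    refine ⟨eq_tmul_of_eq (Xop_add (Xop_tmul (Tr_two_adj_su _) _) (Xop_tmul (Tr_two_fund_su' _) _))
      ?_, eq_tmul_of_eq (Xop_add (Xop_tmul (eq_smul_of_eq_smul_add (Tr_four_adj_su _)
        Tr_four_fund_su_three) _) (Xop_tmul Tr_four_fund_su_three _)) ?_⟩ <;>
    · push_cast
      module
  · rw [TraceIdentities, gammaSum_su ℓ σ ν hm]
    refine ⟨eq_tmul_of_eq (Xop_add (Xop_tmul (Tr_two_adj_su _) _) (Xop_add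
        (Xop_tmul (Tr_two_fund_su' _) _) (Xop_tmul (Tr_two_asym_su _) _))) ?_,
      eq_tmul_of_eq' (Xop_add' (Xop_tmul' (Tr_four_adj_su _) _) (Xop_add'
        (Xop_tmul' (eq_one_smul_add _ _) _) (Xop_tmul' (Tr_four_asym_su _) _))) ?_ ?_⟩ <;>
    module

theorem traceIdentities_sp (n : ℕ) : TraceIdentities ℓ σ ν (.sp n) := by
  rw [TraceIdentities, gammaSum_sp]
  refine ⟨eq_tmul_of_eq (Xop_add (Xop_tmul (Tr_two_adj_sp _) _) (Xop_add
      (Xop_tmul (Tr_two_fund_sp' _) _) (Xop_tmul (Tr_two_asym_sp _) _))) ?_,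
    eq_tmul_of_eq' (Xop_add' (Xop_tmul' (Tr_four_adj_sp _) _) (Xop_add'
      (Xop_tmul' (eq_one_smul_add _ _) _) (Xop_tmul' (Tr_four_asym_sp _) _))) ?_ ?_⟩ <;>
  module

theorem traceIdentities_so_eight : TraceIdentities ℓ σ ν (.so 8) := by
  have h1 := Tr_two_spin_so_even 1 (l := 8) (by decide) (by decide)
  have h2 := Tr_two_spin_so_even (-1) (l := 8) (by decide) (by decide)
  rw [TraceIdentities, gammaSum_so_eight]
  refine ⟨eq_tmul_of_eq (Xop_add (Xop_tmul (Tr_two_adj_so _) _) (Xop_add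
      (Xop_tmul (Tr_two_vect_so _) _) (Xop_add (Xop_tmul h1 _) (Xop_tmul h2 _)))) ?_,
    eq_tmul_of_eq' (Xop_add' (Xop_tmul' (Tr_four_adj_so _) _) (Xop_add'
      (Xop_tmul' (eq_one_smul_add _ _) _) (Xop_tmul_add_tmul Tr_four_spin_so_eight _))) ?_ ?_⟩ <;>
  · norm_num
    try module

/-- The spinor class is divided by the dimension of the spinor, so its contribution to the
coefficient of Tr_vect F⁴ is always -2ℓ + σ. This cancels what the adjoint and the vector leave
over. -/
theorem traceIdentities_so_odd {l : ℕ} (hl : Odd l) (hl' : l ≤ 14) :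
    TraceIdentities ℓ σ ν (.so l) := by
  have h8 : l ≠ 8 := by rintro rfl; revert hl; decide
  have hdiv : (l - 1) / 2 = l / 2 := by obtain ⟨n, rfl⟩ := hl; omega
  have hpow : (2 : ℚ) ^ (l / 2) ≠ 0 := by positivity
  rw [TraceIdentities, gammaSum_so ℓ σ ν h8 hl', hdiv]
  refine ⟨eq_tmul_of_eq (Xop_add (Xop_tmul (Tr_two_adj_so _) _) (Xop_add
      (Xop_tmul (Tr_two_vect_so _) _) (Xop_tmul (Tr_two_spin_so_odd ν hl) _))) ?_,
    eq_tmul_of_eq' (Xop_add' (Xop_tmul' (Tr_four_adj_so _) _) (Xop_add'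
      (Xop_tmul' (eq_one_smul_add _ _) _) (Xop_tmul' (Tr_four_spin_so_odd ν hl) _))) ?_ ?_⟩ <;>
  · match_scalars <;> field_simp <;> ring

theorem traceIdentities_so_even {l : ℕ} (hl : ¬ Odd l) (h10 : 10 ≤ l) (hl' : l ≤ 14) :
    TraceIdentities ℓ σ ν (.so l) := by
  -- For even `l` the half-spinor has dimension `2 ^ (l / 2 - 1)`, which is `2 ^ ((l - 1) / 2)` in
  -- truncated division.
  have hdiv : l / 2 = (l - 1) / 2 + 1 := by
    obtain ⟨n, rfl⟩ := Nat.not_odd_iff_even.1 hl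
    omega
  have hpow : (2 : ℚ) ^ ((l - 1) / 2) ≠ 0 := by positivity
  rw [TraceIdentities, gammaSum_so ℓ σ ν (by omega) hl']
  refine ⟨eq_tmul_of_eq (Xop_add (Xop_tmul (Tr_two_adj_so _) _) (Xop_add
      (Xop_tmul (Tr_two_vect_so _) _) (Xop_tmul (Tr_two_spin_so_even ν hl (by omega)) _))) ?_,
    eq_tmul_of_eq' (Xop_add' (Xop_tmul' (Tr_four_adj_so _) _) (Xop_add'
      (Xop_tmul' (eq_one_smul_add _ _) _)
      (Xop_tmul' (Tr_four_spin_so_even ν hl (by omega)) _))) ?_ ?_⟩ <;>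
  · rw [hdiv, pow_succ]
    match_scalars <;> field_simp <;> ring

/-- Once σ = 2ℓ, the four entries of the table for the residues of `l` modulo 4 become one formula
linear in `l`. -/
theorem gammaClass_so_large {l : ℕ} (hl : 15 ≤ l) :
    gammaClass ℓ ((2 : ℚ) • ℓ) ν (.so l) .vect = (4 - l / 2 : ℚ) • ℓ := by
  obtain ⟨n, hn⟩ : ∃ n, n = (l + 1) / 4 := ⟨_, rfl⟩
  have h14 : ¬ l ≤ 14 := by omega
  simp only [gammaClass, gammaCoeff, h14, if_false, ← hn]
  obtain h | h | h | h : l = 4 * n - 1 ∨ l = 4 * n ∨ l = 4 * n + 1 ∨ l = 4 * n + 2 := by omega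
  · have hc : (l : ℚ) = 4 * n - 1 := by
      rw [h, Nat.cast_sub (by omega)]
      push_cast
      ring
    rw [if_pos h, hc]
    module
  · have hc : (l : ℚ) = 4 * n := by rw [h]; push_cast; ring
    rw [if_neg (by omega), if_pos h, hc]
    module
  · have hc : (l : ℚ) = 4 * n + 1 := by rw [h]; push_cast; ring
    rw [if_neg (by omega), if_neg (by omega), if_pos h, hc]
    module
  · have hc : (l : ℚ) = 4 * n + 2 := by rw [h]; push_cast; ring
    rw [if_neg (by omega), if_neg (by omega), if_neg (by omega), hc]
    module

theorem traceIdentities_so_large {l : ℕ} (hl : 15 ≤ l) :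
    TraceIdentities ℓ ((2 : ℚ) • ℓ) ν (.so l) := by
  rw [TraceIdentities, gammaSum_so_large ℓ _ ν hl, gammaClass_so_large ℓ ν hl]
  refine ⟨eq_tmul_of_eq (Xop_add (Xop_tmul (Tr_two_adj_so _) _)
      (Xop_tmul (Tr_two_vect_so _) _)) ?_,
    eq_tmul_of_eq' (Xop_add' (Xop_tmul' (Tr_four_adj_so _) _)
      (Xop_tmul' (eq_one_smul_add _ _) _)) ?_ ?_⟩ <;>
  module

theorem traceIdentities_e6 : TraceIdentities ℓ σ ν .e6 := by
  rw [TraceIdentities, gammaSum_e6]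
  refine ⟨eq_tmul_of_eq (Xop_add (Xop_tmul Tr_two_adj_e6 _) (Xop_tmul Tr_two_small_e6 _)) ?_,
    eq_tmul_of_eq (Xop_add (Xop_tmul Tr_four_adj_e6 _) (Xop_tmul Tr_four_small_e6 _)) ?_⟩ <;>
  module

theorem traceIdentities_e7 : TraceIdentities ℓ σ ν .e7 := by
  rw [TraceIdentities, gammaSum_e7]
  refine ⟨eq_tmul_of_eq (Xop_add (Xop_tmul Tr_two_adj_e7 _) (Xop_tmul Tr_two_small_e7 _)) ?_,
    eq_tmul_of_eq (Xop_add (Xop_tmul Tr_four_adj_e7 _) (Xop_tmul Tr_four_small_e7 _)) ?_⟩ <;>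
  module

/-- Only the adjoint occurs, with class ℓ/10 when σ = (6/5)ℓ; then 60/10 = 6 and 36/10 = 3 · 6/5. -/
theorem traceIdentities_e8 : TraceIdentities ℓ ((6 / 5 : ℚ) • ℓ) ν .e8 := by
  rw [TraceIdentities, gammaSum_e8]
  refine ⟨eq_tmul_of_eq (Xop_tmul Tr_two_adj_e8 _) ?_,
    eq_tmul_of_eq (Xop_tmul Tr_four_adj_e8 _) ?_⟩ <;>
  module

theorem traceIdentities_f4 : TraceIdentities ℓ σ ν .f4 := by
  rw [TraceIdentities, gammaSum_f4]
  refine ⟨eq_tmul_of_eq (Xop_add (Xop_tmul Tr_two_adj_f4 _) (Xop_tmul Tr_two_small_f4 _)) ?_,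
    eq_tmul_of_eq (Xop_add (Xop_tmul Tr_four_adj_f4 _) (Xop_tmul Tr_four_small_f4 _)) ?_⟩ <;>
  module

theorem traceIdentities_g2 : TraceIdentities ℓ σ ν .g2 := by
  have h : Tr 4 .g2 (rep .small .g2) = (1 : ℚ) • normTr2 .g2 ^ 2 := by
    rw [one_smul, Tr_four_small_g2]
  rw [TraceIdentities, gammaSum_g2]
  refine ⟨eq_tmul_of_eq (Xop_add (Xop_tmul Tr_two_adj_g2 _) (Xop_tmul Tr_two_small_g2 _)) ?_,
    eq_tmul_of_eq (Xop_add (Xop_tmul Tr_four_adj_g2 _) (Xop_tmul h _)) ?_⟩ <;>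
  module

end

/-! ## Classes of divisors -/

section Divisors

variable {X : Scheme.{0}} [IsIntegral X] [IsLocallyNoetherian X]

/-- Such a point must be the generic point of an irreducible component of `V \ U`, and a noetherian
space has finitely many components. -/
theorem finite_coheight_one_compl {U V : X.Opens} (hU : genericPoint X ∈ U)
    (hV : IsAffineOpen V) : {y : X | y ∈ V ∧ y ∉ U ∧ Order.coheight y = 1}.Finite := by
  have hR : IsNoetherianRing Γ(X, V) := IsLocallyNoetherian.component_noetherian ⟨V, hV⟩
  have hN : TopologicalSpace.NoetherianSpace (V : Set X) := noetherianSpace_of_isAffineOpen V hV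
  have hQ : QuasiSober (V : Set X) := V.isOpen.isOpenEmbedding_subtypeVal.quasiSober
  let Z : TopologicalSpace.Closeds (V : Set X) :=
    ⟨{y | (y : X) ∉ U}, (U.isOpen.preimage continuous_subtype_val).isClosed_compl⟩
  obtain ⟨T, hT, hirr, hZ⟩ :=
    TopologicalSpace.NoetherianSpace.exists_finite_set_closeds_irreducible Z
  have hTle : ∀ t ∈ T, (t : Set (V : Set X)) ⊆ Z := fun t ht => by
    rw [hZ]
    exact SetLike.coe_subset_coe.2 (le_sSup ht)
  classical
  let γ : TopologicalSpace.Closeds (V : Set X) → X := fun t =>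
    if h : IsIrreducible (t : Set (V : Set X)) then (h.genericPoint : X) else genericPoint X
  refine (hT.image γ).subset ?_
  rintro y ⟨hyV, hyU, hy⟩
  have hyZ : (⟨y, hyV⟩ : (V : Set X)) ∈ Z := hyU
  obtain ⟨t, ht, hyt⟩ : ∃ t ∈ T, (⟨y, hyV⟩ : (V : Set X)) ∈ t := by
    have h : sSup T = hT.toFinset.sup id := by
      rw [Finset.sup_id_eq_sSup, hT.coe_toFinset]
    rw [hZ, h, ← SetLike.mem_coe, TopologicalSpace.Closeds.coe_finset_sup] at hyZ
    simpa using hyZ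
  refine ⟨t, ht, ?_⟩
  have hgen := (hirr t ht).isGenericPoint_genericPoint t.isClosed
  have hspec : γ t ⤳ y := by
    simp only [γ, dif_pos (hirr t ht)]
    exact (hgen.specializes hyt).map continuous_subtype_val
  have hγU : γ t ∉ U := by
    simp only [γ, dif_pos (hirr t ht)]
    exact hTle t ht hgen.mem
  by_contra hne
  -- A strict generization of a point of coheight one has coheight zero, so it is the generic point
  -- of `X`. That point lies in `U`, whereas `γ t` does not.
  have hlt : y < γ t := lt_of_le_not_ge hspec fun h => hne (hspec.antisymm h).eq
  have h0 := Order.coheight_add_one_le hlt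
  rw [hy] at h0
  have h1 : Order.coheight (γ t) = 0 := by
    by_contra h
    have := add_le_add_left (Order.one_le_iff_ne_zero.2 h) 1
    exact absurd (this.trans h0) (by decide)
  have hmax : IsMax (γ t) := Order.coheight_eq_zero.1 h1
  have hle : γ t ≤ genericPoint X := genericPoint_specializes _
  have : genericPoint X ⤳ γ t := hle
  have h' : γ t ⤳ genericPoint X := hmax hle
  exact hγU ((h'.antisymm this).eq ▸ hU)

/-- A nonzero rational function is a unit on some nonempty open set, so its divisor is supported on
the complement. -/
theorem finite_support_ord {f : X.functionField} (hf : f ≠ 0) (x : X) :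
    ∃ t ∈ nhds x, (t ∩ {y | Scheme.ord f y ≠ 0}).Finite := by
  obtain ⟨U, -, f', hne, rfl, hu⟩ := exists_isUnit_germ_eq X f hf
  obtain ⟨_, ⟨V, hV, rfl⟩, hxV, -⟩ :=
    X.isBasis_affineOpens.exists_subset_of_mem_open (Set.mem_univ x) isOpen_univ
  have hU : genericPoint X ∈ U :=
    ((genericPoint_spec X).mem_open_set_iff U.isOpen).mpr (by simpa using hne)
  refine ⟨V, V.isOpen.mem_nhds hxV, (finite_coheight_one_compl hU hV).subset ?_⟩
  rintro y ⟨hyV, hy⟩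
  refine ⟨hyV, fun hyU => hy (Scheme.ord_of_isUnit hu hyU), ?_⟩
  by_contra h
  exact hy (Scheme.ord_eq_zero_of_coheight_neq_one h _)

theorem ord_one (x : X) : Scheme.ord (1 : X.functionField) x = 0 := by
  have h := Scheme.ord_mul (x := x) (one_ne_zero (α := X.functionField)) one_ne_zero
  rw [mul_one] at h
  omega

theorem ord_inv {f : X.functionField} (hf : f ≠ 0) (x : X) :
    Scheme.ord f⁻¹ x = -Scheme.ord f x := by
  have h := Scheme.ord_mul (x := x) hf (inv_ne_zero hf)
  rw [mul_inv_cancel₀ hf, ord_one] at h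
  omega

theorem ord_algebraMap_of_isUnit {x : X} {a : X.presheaf.stalk x} (ha : IsUnit a) :
    Scheme.ord (algebraMap (X.presheaf.stalk x) X.functionField a) x = 0 := by
  by_cases hx : Order.coheight x = 1
  · have hne : algebraMap (X.presheaf.stalk x) X.functionField a ≠ 0 := (ha.map _).ne_zero
    rw [Scheme.ord_eq_iff hx hne]
    have : Ring.KrullDimLE 1 (X.presheaf.stalk x) := krullDimLE_of_coheight_le hx.le
    exact Ring.ordFrac_of_isUnit ha
  · exact Scheme.ord_eq_zero_of_coheight_neq_one hx _

/-- A family of nonzero rational functions that has, near each point, the divisor of a single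
rational function. -/
structure IsLocallyPrincipal (s : X → X.functionField) : Prop where
  ne_zero : ∀ x, s x ≠ 0
  exists_open : ∀ x, ∃ U : X.Opens, x ∈ U ∧ ∀ y ∈ U, Scheme.ord (s y) y = Scheme.ord (s x) y

namespace IsLocallyPrincipal

variable {s t : X → X.functionField}

theorem const {c : X.functionField} (hc : c ≠ 0) : IsLocallyPrincipal fun _ : X => c :=
  ⟨fun _ => hc, fun _ => ⟨⊤, trivial, fun _ _ => rfl⟩⟩

theorem mul (hs : IsLocallyPrincipal s) (ht : IsLocallyPrincipal t) :
    IsLocallyPrincipal fun x => s x * t x := by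
  refine ⟨fun x => mul_ne_zero (hs.ne_zero x) (ht.ne_zero x), fun x => ?_⟩
  obtain ⟨U, hxU, hU⟩ := hs.exists_open x
  obtain ⟨V, hxV, hV⟩ := ht.exists_open x
  refine ⟨U ⊓ V, ⟨hxU, hxV⟩, fun y hy => ?_⟩
  rw [Scheme.ord_mul (hs.ne_zero y) (ht.ne_zero y), Scheme.ord_mul (hs.ne_zero x) (ht.ne_zero x),
    hU y hy.1, hV y hy.2]

theorem inv (hs : IsLocallyPrincipal s) : IsLocallyPrincipal fun x => (s x)⁻¹ := by
  refine ⟨fun x => inv_ne_zero (hs.ne_zero x), fun x => ?_⟩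
  obtain ⟨U, hxU, hU⟩ := hs.exists_open x
  refine ⟨U, hxU, fun y hy => ?_⟩
  rw [ord_inv (hs.ne_zero y), ord_inv (hs.ne_zero x), hU y hy]

theorem pow (hs : IsLocallyPrincipal s) (n : ℕ) : IsLocallyPrincipal fun x => s x ^ n := by
  induction n with
  | zero => simpa using const (X := X) one_ne_zero
  | succ n ih => simpa only [pow_succ] using ih.mul hs

theorem mem_weilDivisors (hs : IsLocallyPrincipal s) :
    (fun x => (Scheme.ord (s x) x : ℚ)) ∈ weilDivisors X := by
  refine ⟨⟨Set.subset_univ _, fun x _ => ?_⟩, fun x hx => ?_⟩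
  · obtain ⟨U, hxU, hU⟩ := hs.exists_open x
    obtain ⟨t, ht, hfin⟩ := finite_support_ord (hs.ne_zero x) x
    refine ⟨U ∩ t, Filter.inter_mem (U.isOpen.mem_nhds hxU) ht, hfin.subset ?_⟩
    rintro y ⟨⟨hyU, hyt⟩, hy⟩
    refine ⟨hyt, ?_⟩
    rw [Set.mem_ofPred_eq, ← hU y hyU]
    exact fun h => hy (by simp [h])
  · by_contra h
    exact hx (by simp [Scheme.ord_eq_zero_of_coheight_neq_one h])

theorem divClass_eq (hs : IsLocallyPrincipal s) :
    divClass s = (principalDivisors X).mkQ ⟨_, hs.mem_weilDivisors⟩ :=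
  dif_pos hs.mem_weilDivisors

theorem divClass_mul (hs : IsLocallyPrincipal s) (ht : IsLocallyPrincipal t) :
    divClass (fun x => s x * t x) = divClass s + divClass t := by
  rw [hs.divClass_eq, ht.divClass_eq, (hs.mul ht).divClass_eq, ← map_add]
  congr 1
  ext x
  simp [Scheme.ord_mul (hs.ne_zero x) (ht.ne_zero x)]

theorem divClass_inv (hs : IsLocallyPrincipal s) :
    divClass (fun x => (s x)⁻¹) = -divClass s := by
  rw [hs.divClass_eq, hs.inv.divClass_eq, ← map_neg]
  congr 1
  ext x
  simp [ord_inv (hs.ne_zero x)]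

end IsLocallyPrincipal

theorem divClass_eq_zero_of_ord_eq_zero {s : X → X.functionField}
    (hs : ∀ x, Scheme.ord (s x) x = 0) : divClass s = 0 := by
  have h : (fun x => (Scheme.ord (s x) x : ℚ)) = 0 := by
    funext x
    simp [hs x]
  rw [divClass, dif_pos (h ▸ zero_mem _)]
  simp_rw [h]
  exact map_zero _

theorem divClass_const {c : X.functionField} (hc : c ≠ 0) : divClass (fun _ : X => c) = 0 := by
  rw [(IsLocallyPrincipal.const hc).divClass_eq, Submodule.mkQ_apply,
    Submodule.Quotient.mk_eq_zero]
  exact Submodule.subset_span ⟨c, hc, fun _ => rfl⟩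

theorem IsLocallyPrincipal.divClass_pow {s : X → X.functionField} (hs : IsLocallyPrincipal s)
    (n : ℕ) : divClass (fun x => s x ^ n) = (n : ℚ) • divClass s := by
  induction n with
  | zero => simpa using divClass_const (X := X) one_ne_zero
  | succ n ih =>
    simp only [pow_succ]
    rw [(hs.pow n).divClass_mul hs, ih]
    push_cast
    module

end Divisors

/-! ## Regular local rings of dimension two -/

section RegularLocalRing

open IsLocalRing

variable {A : Type*} [CommRing A] [IsRegularLocalRing A]

/-- Exchange argument: in x = ap + bq with generators p, q, one of a, b is a unit because x ∉ 𝔪², so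
x can replace that generator. -/
theorem exists_maximalIdeal_eq_span_pair (hA : ringKrullDim A = 2) {x : A}
    (hx : x ∈ maximalIdeal A) (hx2 : x ∉ maximalIdeal A ^ 2) :
    ∃ y, maximalIdeal A = Ideal.span {x, y} := by
  have hfin : (maximalIdeal A).spanFinrank = 2 := by
    have h := IsRegularLocalRing.spanFinrank_maximalIdeal (R := A)
    rw [hA] at h
    exact_mod_cast h
  classical
  obtain ⟨s, hs, hspan⟩ :=
    (IsNoetherian.noetherian (maximalIdeal A)).exists_span_finset_card_eq_spanFinrank
  rw [hfin, Finset.card_eq_two] at hs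
  obtain ⟨p, q, -, rfl⟩ := hs
  have hm : maximalIdeal A = Ideal.span {p, q} := by
    rw [← hspan]
    simp [Ideal.span]
  have key : ∀ p q : A, maximalIdeal A = Ideal.span {p, q} → ∀ a b : A, x = a * p + b * q →
      a ∉ maximalIdeal A → maximalIdeal A = Ideal.span {x, q} := by
    intro p q hm a b hxe ha
    obtain ⟨u, rfl⟩ : IsUnit a := by simpa using ha
    have hq : q ∈ maximalIdeal A := hm ▸ Ideal.subset_span (by simp)
    apply le_antisymm
    · rw [hm, Ideal.span_le]
      rintro r (rfl | rfl)
      · refine Ideal.mem_span_pair.2 ⟨↑u⁻¹, -↑u⁻¹ * b, ?_⟩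
        rw [hxe]
        linear_combination r * u.inv_mul
      · exact Ideal.subset_span (by simp)
    · rw [Ideal.span_le]
      rintro r (rfl | rfl)
      exacts [hx, hq]
  obtain ⟨a, b, hab⟩ := Ideal.mem_span_pair.1 (hm ▸ hx)
  by_cases ha : a ∈ maximalIdeal A
  · by_cases hb : b ∈ maximalIdeal A
    · refine absurd ?_ hx2
      have hp : p ∈ maximalIdeal A := hm ▸ Ideal.subset_span (by simp)
      have hq : q ∈ maximalIdeal A := hm ▸ Ideal.subset_span (by simp)
      rw [← hab, pow_two]
      exact add_mem (Ideal.mul_mem_mul ha hp) (Ideal.mul_mem_mul hb hq)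
    · exact ⟨p, key q p (by rw [hm, Set.pair_comm]) b a (by rw [← hab]; ring) hb⟩
  · exact ⟨q, key p q hm a b hab.symm ha⟩

theorem maximalIdeal_ne_span_singleton (hA : ringKrullDim A = 2) (x : A) :
    maximalIdeal A ≠ Ideal.span {x} := by
  intro h
  have hp : (maximalIdeal A).IsPrime := (maximalIdeal.isMaximal A).isPrime
  have : Submodule.IsPrincipal (maximalIdeal A) := ⟨x, h⟩
  have h1 := Ideal.height_le_one_of_isPrincipal_of_mem_minimalPrimes (maximalIdeal A)
    (maximalIdeal A) (by simp [Ideal.minimalPrimes_eq_subsingleton_self])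
  have h2 : (maximalIdeal A).height = 2 :=
    WithBot.coe_injective ((maximalIdeal_height_eq_ringKrullDim (R := A)).trans hA)
  rw [h2] at h1
  exact absurd h1 (by decide)

theorem not_dvd_of_maximalIdeal_eq_span_pair (hA : ringKrullDim A = 2) {x y : A}
    (hm : maximalIdeal A = Ideal.span {x, y}) : ¬ x ∣ y := by
  intro h
  refine maximalIdeal_ne_span_singleton hA x ?_
  rw [hm]
  refine le_antisymm (Ideal.span_le.2 ?_) (Ideal.span_mono (by simp))
  rintro r (rfl | rfl)
  exacts [Ideal.mem_span_singleton_self _, Ideal.mem_span_singleton.2 h]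

/-- Let P ⊆ 𝔪 be a minimal prime over (x). It has height at most one, so y ∉ P. Writing elements of
P as αx + βy then forces β ∈ P, so P ⊆ (x) + 𝔪P, and Nakayama gives P = (x). -/
theorem prime_of_maximalIdeal_eq_span_pair (hA : ringKrullDim A = 2) {x y : A}
    (hm : maximalIdeal A = Ideal.span {x, y}) : Prime x := by
  have hx : x ∈ maximalIdeal A := hm ▸ Ideal.subset_span (by simp)
  have hx0 : x ≠ 0 := by
    rintro rfl
    exact maximalIdeal_ne_span_singleton hA y (by rw [hm, Ideal.span_insert_zero])
  obtain ⟨P, hP, hPm⟩ := Ideal.exists_minimalPrimes_le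
    (Ideal.span_singleton_le_iff_mem (I := maximalIdeal A) |>.2 hx)
  have hPp : P.IsPrime := hP.1.1
  have hxP : x ∈ P := hP.1.2 (Ideal.mem_span_singleton_self x)
  have hy : y ∉ P := by
    intro hy
    have hPe : P = maximalIdeal A := le_antisymm hPm (by
      rw [hm, Ideal.span_le]
      rintro r (rfl | rfl)
      exacts [hxP, hy])
    have h1 := Ideal.height_le_one_of_isPrincipal_of_mem_minimalPrimes (Ideal.span {x}) P hP
    have h2 : (maximalIdeal A).height = 2 :=
      WithBot.coe_injective ((maximalIdeal_height_eq_ringKrullDim (R := A)).trans hA)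
    rw [hPe, h2] at h1
    exact absurd h1 (by decide)
  have hPx : P = Ideal.span {x} := by
    refine le_antisymm ?_ ((Ideal.span_singleton_le_iff_mem _).2 hxP)
    refine Submodule.le_of_le_smul_of_le_jacobson_bot (I := maximalIdeal A)
      (IsNoetherian.noetherian P) (maximalIdeal_le_jacobson _) fun a ha => ?_
    obtain ⟨α, β, hab⟩ := Ideal.mem_span_pair.1 (hm ▸ hPm ha)
    have hβ : β ∈ P := by
      have : β * y ∈ P := by
        rw [eq_sub_iff_add_eq'.2 hab]
        exact sub_mem ha (P.mul_mem_left _ hxP)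
      exact (hPp.mem_or_mem this).resolve_right hy
    rw [← hab]
    refine Submodule.add_mem_sup (Ideal.mul_mem_left _ _ (Ideal.mem_span_singleton_self x)) ?_
    rw [mul_comm]
    exact Submodule.smul_mem_smul (hm ▸ Ideal.subset_span (by simp)) hβ
  exact (Ideal.span_singleton_prime hx0).1 (hPx ▸ hPp)

/-- Among the monomials of degree n + 1 in the two generators, only `y ^ (n + 1)` is free of `x`. -/
theorem exists_eq_of_mem_maximalIdeal_pow {x y : A} (hm : maximalIdeal A = Ideal.span {x, y})
    (n : ℕ) : ∀ a ∈ maximalIdeal A ^ (n + 1),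
      ∃ c ∈ maximalIdeal A ^ n, ∃ s, a = x * c + y ^ (n + 1) * s := by
  have hx : x ∈ maximalIdeal A := hm ▸ Ideal.subset_span (by simp)
  have hy : y ∈ maximalIdeal A := hm ▸ Ideal.subset_span (by simp)
  induction n with
  | zero =>
    intro a ha
    rw [zero_add, pow_one, hm] at ha
    obtain ⟨α, β, rfl⟩ := Ideal.mem_span_pair.1 ha
    exact ⟨α, by simp, β, by ring⟩
  | succ n ih =>
    intro a ha
    rw [pow_succ'] at ha
    refine Submodule.mul_induction_on ha (fun p hp q hq => ?_) ?_
    · obtain ⟨α, β, rfl⟩ := Ideal.mem_span_pair.1 (hm ▸ hp)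
      obtain ⟨c, hc, s, rfl⟩ := ih q hq
      refine ⟨α * (x * c + y ^ (n + 1) * s) + β * (y * c), add_mem (Ideal.mul_mem_left _ _ hq)
        (Ideal.mul_mem_left _ _ ?_), β * s, by ring⟩
      rw [pow_succ']
      exact Ideal.mul_mem_mul hy hc
    · rintro a b ⟨c, hc, s, rfl⟩ ⟨c', hc', s', rfl⟩
      exact ⟨c + c', add_mem hc hc', s + s', by ring⟩

theorem exists_mem_maximalIdeal_notMem_sq (hA : ringKrullDim A = 2) :
    ∃ x ∈ maximalIdeal A, x ∉ maximalIdeal A ^ 2 := by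
  by_contra! h
  have h1 : maximalIdeal A ≤ ⊥ := by
    refine Submodule.le_of_le_smul_of_le_jacobson_bot (I := maximalIdeal A)
      (IsNoetherian.noetherian _) (maximalIdeal_le_jacobson _) fun a ha => ?_
    rw [bot_sup_eq, smul_eq_mul, ← pow_two]
    exact h a ha
  have h2 : ringKrullDim A = 0 := by
    have hf : IsField A := isField_iff_maximalIdeal_eq.2 (le_bot_iff.1 h1)
    exact ringKrullDim_eq_zero_of_isField hf
  rw [hA] at h2
  exact absurd h2 (by decide)

variable [IsDomain A]

/-- Additivity of the 𝔪-adic order for a factor of order one. The three lemmas that follow deduce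
the few cases for squares and cubes that are needed, without the associated graded ring. -/
theorem mem_maximalIdeal_pow_of_mul_mem (hA : ringKrullDim A = 2) {x a : A} {n : ℕ}
    (hx : x ∈ maximalIdeal A) (hx2 : x ∉ maximalIdeal A ^ 2)
    (h : x * a ∈ maximalIdeal A ^ (n + 1)) : a ∈ maximalIdeal A ^ n := by
  obtain ⟨y, hm⟩ := exists_maximalIdeal_eq_span_pair hA hx hx2
  have hp := prime_of_maximalIdeal_eq_span_pair hA hm
  have hy : y ∈ maximalIdeal A := hm ▸ Ideal.subset_span (by simp)
  obtain ⟨c, hc, s, hs⟩ := exists_eq_of_mem_maximalIdeal_pow hm n _ h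
  obtain ⟨s', rfl⟩ : x ∣ s := by
    have h1 : x ∣ y ^ (n + 1) * s := ⟨a - c, by linear_combination -hs⟩
    refine (hp.dvd_or_dvd h1).resolve_left fun h2 => ?_
    exact not_dvd_of_maximalIdeal_eq_span_pair hA hm (hp.dvd_of_dvd_pow h2)
  have ha : a = c + y ^ (n + 1) * s' := mul_left_cancel₀ hp.ne_zero (by linear_combination hs)
  rw [ha]
  refine add_mem hc (Ideal.mul_mem_right _ _ ?_)
  exact Ideal.pow_le_pow_right (Nat.le_succ n) (Ideal.pow_mem_pow hy _)

theorem mem_maximalIdeal_sq_of_sq_mem (hA : ringKrullDim A = 2) {a : A}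
    (h : a ^ 2 ∈ maximalIdeal A ^ 3) : a ∈ maximalIdeal A ^ 2 := by
  have ha : a ∈ maximalIdeal A :=
    (maximalIdeal.isMaximal A).isPrime.mem_of_pow_mem 2 (Ideal.pow_le_self (by norm_num) h)
  by_contra h2
  exact h2 (mem_maximalIdeal_pow_of_mul_mem hA ha h2 (by rwa [← pow_two]))

theorem mem_maximalIdeal_sq_of_cube_mem (hA : ringKrullDim A = 2) {a : A}
    (h : a ^ 3 ∈ maximalIdeal A ^ 4) : a ∈ maximalIdeal A ^ 2 := by
  have ha : a ∈ maximalIdeal A :=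
    (maximalIdeal.isMaximal A).isPrime.mem_of_pow_mem 3 (Ideal.pow_le_self (by norm_num) h)
  by_contra h2
  exact h2 (mem_maximalIdeal_sq_of_sq_mem hA
    (mem_maximalIdeal_pow_of_mul_mem hA ha h2 (by rwa [← pow_succ'])))

/-- Write a = xc + y²s. Reducing a² modulo x shows s ∈ 𝔪, so (xc)² ∈ 𝔪⁵; cancelling x twice gives c²
∈ 𝔪³ and hence c ∈ 𝔪². -/
theorem mem_maximalIdeal_cube_of_sq_mem (hA : ringKrullDim A = 2) {a : A}
    (h : a ^ 2 ∈ maximalIdeal A ^ 5) : a ∈ maximalIdeal A ^ 3 := by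
  have ha : a ∈ maximalIdeal A ^ 2 :=
    mem_maximalIdeal_sq_of_sq_mem hA (Ideal.pow_le_pow_right (by norm_num) h)
  obtain ⟨x, hx, hx2⟩ := exists_mem_maximalIdeal_notMem_sq hA
  obtain ⟨y, hm⟩ := exists_maximalIdeal_eq_span_pair hA hx hx2
  have hp := prime_of_maximalIdeal_eq_span_pair hA hm
  have hy : y ∈ maximalIdeal A := hm ▸ Ideal.subset_span (by simp)
  obtain ⟨c, hc, s, rfl⟩ := exists_eq_of_mem_maximalIdeal_pow hm 1 a ha
  obtain ⟨c', -, s', hs'⟩ := exists_eq_of_mem_maximalIdeal_pow hm 4 _ h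
  rw [pow_one] at hc
  norm_num at hs' ⊢
  have hs : s ∈ maximalIdeal A := by
    have h1 : x ∣ y ^ 4 * (s ^ 2 - y * s') :=
      ⟨c' - x * c ^ 2 - 2 * c * y ^ 2 * s, by linear_combination hs'⟩
    have h2 : x ∣ s ^ 2 - y * s' := (hp.dvd_or_dvd h1).resolve_left fun h2 =>
      not_dvd_of_maximalIdeal_eq_span_pair hA hm (hp.dvd_of_dvd_pow h2)
    have h3 : s ^ 2 ∈ maximalIdeal A := by
      rw [← sub_add_cancel (s ^ 2) (y * s')]
      exact add_mem (Ideal.mem_of_dvd _ h2 hx) (Ideal.mul_mem_right _ _ hy)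
    exact (maximalIdeal.isMaximal A).isPrime.mem_of_pow_mem 2 h3
  have hys : y ^ 2 * s ∈ maximalIdeal A ^ 3 := by
    rw [pow_succ]
    exact Ideal.mul_mem_mul (Ideal.pow_mem_pow hy 2) hs
  have hxc : x * c ∈ maximalIdeal A ^ 2 := by
    rw [pow_two]
    exact Ideal.mul_mem_mul hx hc
  have h1 : x * (x * c ^ 2) ∈ maximalIdeal A ^ 5 := by
    have e : x * (x * c ^ 2) = (x * c + y ^ 2 * s) ^ 2 - 2 * ((x * c) * (y ^ 2 * s)) -
      (y ^ 2 * s) ^ 2 := by ring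
    rw [e]
    refine sub_mem (sub_mem h (Ideal.mul_mem_left _ _ ?_)) ?_
    · rw [show 5 = 2 + 3 from rfl, pow_add]
      exact Ideal.mul_mem_mul hxc hys
    · refine Ideal.pow_le_pow_right (show 5 ≤ 3 * 2 by norm_num) ?_
      rw [pow_mul]
      exact Ideal.pow_mem_pow hys 2
  have h2 := mem_maximalIdeal_sq_of_sq_mem hA
    (mem_maximalIdeal_pow_of_mul_mem hA hx hx2 (mem_maximalIdeal_pow_of_mul_mem hA hx hx2 h1))
  refine add_mem ?_ hys
  rw [pow_succ']
  exact Ideal.mul_mem_mul hx h2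

/-- Over a regular local ring of dimension two, if `4F³ + 27G²` is divisible by the fourth power
of a prime element that does not divide `F`, then either `F` is a unit or `z²F` and `z³G` have
multiplicities at least four and six. -/
theorem mem_maximalIdeal_pow_of_pow_four_dvd (hA : ringKrullDim A = 2) (h2 : IsUnit (2 : A))
    (h3 : IsUnit (3 : A)) {t F G : A} (ht : Prime t) (htF : ¬ t ∣ F) (hF : F ∈ maximalIdeal A)
    (hdvd : t ^ 4 ∣ 4 * F ^ 3 + 27 * G ^ 2) :
    F ∈ maximalIdeal A ^ 2 ∧ G ∈ maximalIdeal A ^ 3 := by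
  have htm : t ∈ maximalIdeal A := ht.not_isUnit
  have hmp : (maximalIdeal A).IsPrime := (maximalIdeal.isMaximal A).isPrime
  have hcancel : ∀ {u : A}, IsUnit u → ∀ {I : Ideal A} {a : A}, u * a ∈ I → a ∈ I := by
    rintro _ ⟨u, rfl⟩ I a h
    exact (Ideal.unit_mul_mem_iff_mem I u.isUnit).1 h
  have h4 : IsUnit (4 : A) := by convert h2.pow 2 using 1; norm_num
  have h27 : IsUnit (27 : A) := by convert h3.pow 3 using 1; norm_num
  -- If t ∈ 𝔪² then 4F³ + 27G² ∈ 𝔪⁸, and lower bounds for the orders of F and G improve each other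
  -- alternately. Otherwise t is a regular parameter and Δ is expanded in powers of t.
  by_cases ht2 : t ∈ maximalIdeal A ^ 2
  · have h8 : 4 * F ^ 3 + 27 * G ^ 2 ∈ maximalIdeal A ^ 8 := by
      refine Ideal.mem_of_dvd _ hdvd ?_
      rw [show 8 = 2 * 4 from rfl, pow_mul]
      exact Ideal.pow_mem_pow ht2 4
    have hG2 : ∀ k ≤ 8, F ^ 3 ∈ maximalIdeal A ^ k → G ^ 2 ∈ maximalIdeal A ^ k := by
      intro k hk h
      refine hcancel h27 ?_
      rw [← add_sub_cancel_left (4 * F ^ 3) (27 * G ^ 2)]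
      exact sub_mem (Ideal.pow_le_pow_right hk h8) (Ideal.mul_mem_left _ _ h)
    have hG : G ∈ maximalIdeal A ^ 2 :=
      mem_maximalIdeal_sq_of_sq_mem hA (hG2 3 (by norm_num) (Ideal.pow_mem_pow hF 3))
    have hF2 : F ∈ maximalIdeal A ^ 2 := by
      refine mem_maximalIdeal_sq_of_cube_mem hA (hcancel h4 ?_)
      rw [← add_sub_cancel_right (4 * F ^ 3) (27 * G ^ 2)]
      refine sub_mem (Ideal.pow_le_pow_right (by norm_num) h8) (Ideal.mul_mem_left _ _ ?_)
      rw [show 4 = 2 * 2 from rfl, pow_mul]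
      exact Ideal.pow_mem_pow hG 2
    refine ⟨hF2, mem_maximalIdeal_cube_of_sq_mem hA (hG2 5 (by norm_num) ?_)⟩
    refine Ideal.pow_le_pow_right (show 5 ≤ 2 * 3 by norm_num) ?_
    rw [pow_mul]
    exact Ideal.pow_mem_pow hF2 3
  · have h16 : IsUnit (16 : A) := by convert h2.pow 4 using 1; norm_num
    have h12 : IsUnit (12 : A) := by convert h4.mul h3 using 1; norm_num
    have h108 : IsUnit (108 : A) := by convert h4.mul h27 using 1; norm_num
    have hndvd : ∀ {u : A}, IsUnit u → ∀ {a : A}, t ∣ u * a → t ∣ a := fun hu _ h =>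
      (hu.dvd_mul_left).1 h
    obtain ⟨y, hm⟩ := exists_maximalIdeal_eq_span_pair hA htm ht2
    -- The quotient by t is a local domain with principal maximal ideal, so it is integrally closed.
    -- There c = 9G/F satisfies c² = -12F, hence lies in the quotient, and h is a lift of -c/2. The
    -- factors 12 and 108 are chosen so that (12F)³ + (108G)² = 432(4F³ + 27G²).
    obtain ⟨h, b, a, hf, hg⟩ : ∃ h b a, 12 * F = -4 * h ^ 2 + t * b ∧
        108 * G = 8 * h ^ 3 + t * a := by
      have hprime : (Ideal.span {t}).IsPrime := (Ideal.span_singleton_prime ht.ne_zero).2 ht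
      have hloc : IsLocalRing (A ⧸ Ideal.span {t}) :=
        IsLocalRing.of_surjective' _ Ideal.Quotient.mk_surjective
      have hmap : maximalIdeal (A ⧸ Ideal.span {t}) =
          (maximalIdeal A).map (Ideal.Quotient.mk (Ideal.span {t})) := by
        refine (eq_maximalIdeal ?_).symm
        refine Ideal.IsMaximal.map_of_surjective_of_ker_le Ideal.Quotient.mk_surjective ?_
        rw [Ideal.mk_ker, Ideal.span_singleton_le_iff_mem]
        exact htm
      have hprin : (maximalIdeal (A ⧸ Ideal.span {t})).IsPrincipal := by
        refine ⟨Ideal.Quotient.mk _ y, ?_⟩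
        rw [hmap, hm, Ideal.map_span, Set.image_pair,
          Ideal.Quotient.eq_zero_iff_mem.2 (Ideal.mem_span_singleton_self t),
          Ideal.span_insert_zero]
      have hpid : IsPrincipalIdealRing (A ⧸ Ideal.span {t}) :=
        ((tfae_of_isNoetherianRing_of_isLocalRing_of_isDomain
          (R := A ⧸ Ideal.span {t})).out 4 0).1 hprin
      set q := Ideal.Quotient.mk (Ideal.span {t}) with hq
      have hq0 : ∀ r, q r = 0 ↔ t ∣ r := fun r => by
        rw [hq, Ideal.Quotient.eq_zero_iff_mem, Ideal.mem_span_singleton]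
      have hD : 4 * q F ^ 3 + 27 * q G ^ 2 = 0 := by
        have : q (4 * F ^ 3 + 27 * G ^ 2) = 0 :=
          (hq0 _).2 ((dvd_pow_self t (by norm_num)).trans hdvd)
        simpa only [map_add, map_mul, map_pow, map_ofNat] using this
      have hqF : q F ≠ 0 := fun h => htF ((hq0 F).1 h)
      obtain ⟨c, hc⟩ : q F ∣ 9 * q G := by
        refine (IsIntegrallyClosed.pow_dvd_pow_iff (n := 2) (by norm_num)).1
          ⟨-12 * q F, ?_⟩
        linear_combination 3 * hD
      have hc2 : c ^ 2 = -12 * q F := by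
        refine mul_left_cancel₀ (pow_ne_zero 2 hqF) ?_
        linear_combination 3 * hD - (q F * c + 9 * q G) * hc
      obtain ⟨c, rfl⟩ := Ideal.Quotient.mk_surjective c
      obtain ⟨u, hu⟩ := h2
      obtain ⟨b, hb⟩ : t ∣ 12 * F + c ^ 2 := (hq0 _).1 (by
        simp only [map_add, map_mul, map_pow, map_ofNat]
        linear_combination hc2)
      obtain ⟨a, ha⟩ : t ∣ 108 * G + c ^ 3 := (hq0 _).1 (by
        simp only [map_add, map_mul, map_pow, map_ofNat]
        linear_combination 12 * hc + q c * hc2)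
      have h2u : (2 : A) * ↑u⁻¹ = 1 := by rw [← hu]; exact u.mul_inv
      refine ⟨-(↑u⁻¹ * c), b, a, ?_, ?_⟩
      · linear_combination hb + c ^ 2 * (2 * (↑u⁻¹ : A) + 1) * h2u
      · linear_combination ha + c ^ 3 * (4 * (↑u⁻¹ : A) ^ 2 + 2 * (↑u⁻¹ : A) + 1) * h2u
    have hth : ¬ t ∣ h := by
      rintro ⟨k, rfl⟩
      refine htF (hndvd h12 ⟨-4 * t * k ^ 2 + b, ?_⟩)
      linear_combination hf
    have hcube : t ^ 4 ∣ (-4 * h ^ 2 + t * b) ^ 3 + (8 * h ^ 3 + t * a) ^ 2 := by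
      rw [← hf, ← hg]
      refine hdvd.trans ⟨432, by ring⟩
    obtain ⟨d, hd⟩ := hcube
    have ht0 := ht.ne_zero
    -- The terms of degree zero in t cancel; the coefficient of t is 16h³(3hb + a).
    obtain ⟨a2, ha2⟩ : t ∣ 3 * h * b + a := by
      have h1 : t ∣ 16 * (h ^ 3 * (3 * h * b + a)) := by
        refine ⟨t ^ 2 * d - (a ^ 2 - 12 * h ^ 2 * b ^ 2) - t * b ^ 3, mul_left_cancel₀ ht0 ?_⟩
        linear_combination hd
      exact (ht.dvd_or_dvd (hndvd h16 h1)).resolve_left fun h => hth (ht.dvd_of_dvd_pow h)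
    obtain rfl : a = -(3 * h * b) + t * a2 := by linear_combination ha2
    -- After the substitution for a, the coefficient of t² is h²(16h·a2 - 3b²).
    obtain ⟨e, he⟩ : t ∣ 16 * h * a2 - 3 * b ^ 2 := by
      have h1 : t ∣ h ^ 2 * (16 * h * a2 - 3 * b ^ 2) := by
        refine ⟨t * d - (b ^ 3 - 6 * h * b * a2) - t * a2 ^ 2,
          mul_left_cancel₀ (pow_ne_zero 2 ht0) ?_⟩
        linear_combination hd
      exact (ht.dvd_or_dvd h1).resolve_left fun h => hth (ht.dvd_of_dvd_pow h)
    -- Three times the coefficient of t³, reduced modulo t by means of `he`, is h(3he - 2b·a2).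
    have h5 : t ∣ 3 * h * e - 2 * b * a2 := by
      have h1 : t ∣ h * (3 * h * e - 2 * b * a2) := by
        refine ⟨3 * (d - a2 ^ 2) + b * e, mul_left_cancel₀ (pow_ne_zero 3 ht0) ?_⟩
        linear_combination 3 * hd - (3 * t ^ 2 * h ^ 2 - t ^ 3 * b) * he
      exact (ht.dvd_or_dvd h1).resolve_left hth
    have hhm : h ∈ maximalIdeal A := by
      refine hmp.mem_of_pow_mem 2 (hcancel h4 ?_)
      have e : 4 * h ^ 2 = t * b - 12 * F := by linear_combination hf
      rw [e]
      exact sub_mem (Ideal.mul_mem_right _ _ htm) (Ideal.mul_mem_left _ _ hF)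
    have hbm : b ∈ maximalIdeal A := by
      refine hmp.mem_of_pow_mem 2 (hcancel h3 ?_)
      have e : 3 * b ^ 2 = 16 * a2 * h - t * e := by linear_combination -he
      rw [e]
      exact sub_mem (Ideal.mul_mem_left _ _ hhm) (Ideal.mul_mem_right _ _ htm)
    have ha2m : a2 ∈ maximalIdeal A := by
      by_contra ha2
      have hu2 : IsUnit a2 := by simpa using ha2
      obtain ⟨k, hk⟩ := h5
      -- This combination of `hk` and `he` eliminates the product h·e·a2. If t divided b, then `he`
      -- would make t divide h.
      have h6 : t ∣ b * (9 * e * b - 32 * a2 ^ 2) := by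
        refine ⟨16 * a2 * k - 3 * e ^ 2, ?_⟩
        linear_combination 16 * a2 * hk - 3 * e * he
      rcases ht.dvd_or_dvd h6 with ⟨b', rfl⟩ | ⟨b', hb'⟩
      · refine hth (hndvd (h16.mul hu2) ⟨e + 3 * t * b' ^ 2, ?_⟩)
        linear_combination he
      · have h7 : (32 * a2) * a2 ∈ maximalIdeal A := by
          have e' : (32 * a2) * a2 = 9 * e * b - t * b' := by linear_combination -hb'
          rw [e']
          exact sub_mem (Ideal.mul_mem_left _ _ hbm) (Ideal.mul_mem_right _ _ htm)
        have h32 : IsUnit (32 : A) := by convert h2.pow 5 using 1; norm_num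
        exact ha2 (hcancel (h32.mul hu2) h7)
    have hmul2 : ∀ {p q : A}, p ∈ maximalIdeal A → q ∈ maximalIdeal A →
        p * q ∈ maximalIdeal A ^ 2 := fun hp hq => by
      rw [pow_two]
      exact Ideal.mul_mem_mul hp hq
    have hmul3 : ∀ {p q r : A}, p ∈ maximalIdeal A → q ∈ maximalIdeal A → r ∈ maximalIdeal A →
        p * (q * r) ∈ maximalIdeal A ^ 3 := fun hp hq hr => by
      rw [pow_succ']
      exact Ideal.mul_mem_mul hp (hmul2 hq hr)
    constructor
    · refine hcancel h12 ?_
      rw [hf, pow_two h]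
      exact add_mem (Ideal.mul_mem_left _ _ (hmul2 hhm hhm)) (hmul2 htm hbm)
    · refine hcancel h108 ?_
      have e : 108 * G = 8 * (h * (h * h)) + (-3 * (t * (h * b)) + t * (t * a2)) := by
        linear_combination hg
      rw [e]
      exact add_mem (Ideal.mul_mem_left _ _ (hmul3 hhm hhm hhm))
        (add_mem (Ideal.mul_mem_left _ _ (hmul3 htm hhm hbm)) (hmul3 htm htm ha2m))

end RegularLocalRing

/-! ## Restriction of rational functions to a prime divisor -/

section Restriction

theorem map_genericPoint_specializes {B S : Scheme.{0}} [IsIntegral S] (i : S ⟶ B) (s : S) :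
    i (genericPoint S) ⤳ i s :=
  (genericPoint_specializes s).map i.continuous

variable {B S : Scheme.{0}} [IsIntegral S] (i : S ⟶ B)

/-- The localization map from the local ring of `B` at a point of `S` to the local ring at the
generic point of `S`. -/
def toGenericStalk (s : S) : B.presheaf.stalk (i s) →+* B.presheaf.stalk (i (genericPoint S)) :=
  (B.presheaf.stalkSpecializes (map_genericPoint_specializes i s)).hom

theorem stalkMap_toGenericStalk (s : S) (b : B.presheaf.stalk (i s)) :
    (i.stalkMap (genericPoint S)).hom (toGenericStalk i s b) =
      algebraMap (S.presheaf.stalk s) S.functionField ((i.stalkMap s).hom b) :=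
  Scheme.Hom.stalkSpecializes_stalkMap_apply i (genericPoint S) s (genericPoint_specializes s) b

variable [IsIntegral B]

theorem algebraMap_toGenericStalk (s : S) (b : B.presheaf.stalk (i s)) :
    algebraMap (B.presheaf.stalk (i (genericPoint S))) B.functionField (toGenericStalk i s b) =
      algebraMap (B.presheaf.stalk (i s)) B.functionField b := by
  simp only [RingHom.algebraMap_toAlgebra, toGenericStalk]
  rw [← ConcreteCategory.comp_apply, TopCat.Presheaf.stalkSpecializes_comp]

theorem algebraMap_stalk_injective (x : B) :
    Function.Injective (algebraMap (B.presheaf.stalk x) B.functionField) :=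
  IsFractionRing.injective _ _

theorem restrict_algebraMap (a : B.presheaf.stalk (i (genericPoint S))) :
    restrict i (algebraMap _ B.functionField a) = (i.stalkMap (genericPoint S)).hom a := by
  have H : ∃ b : B.presheaf.stalk (i (genericPoint S)),
    algebraMap _ B.functionField b = algebraMap _ B.functionField a := ⟨a, rfl⟩
  rw [restrict, dif_pos H, algebraMap_stalk_injective _ H.choose_spec]

theorem restrict_algebraMap_stalk (s : S) (b : B.presheaf.stalk (i s)) :
    restrict i (algebraMap (B.presheaf.stalk (i s)) B.functionField b) =
      algebraMap (S.presheaf.stalk s) S.functionField ((i.stalkMap s).hom b) := by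
  rw [← algebraMap_toGenericStalk, restrict_algebraMap, stalkMap_toGenericStalk]

/-- The rational function `h` is a unit at the generic point of `S`. -/
def IsUnitAlong (h : B.functionField) : Prop :=
  ∃ u : (B.presheaf.stalk (i (genericPoint S)))ˣ,
    algebraMap (B.presheaf.stalk (i (genericPoint S))) B.functionField u = h

/-- The stalk map is a local homomorphism into a field, so it reflects units. -/
theorem isUnitAlong_of_stalkMap_ne_zero {a : B.presheaf.stalk (i (genericPoint S))}
    (ha : (i.stalkMap (genericPoint S)).hom a ≠ 0) :
    IsUnitAlong i (algebraMap _ B.functionField a) := by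
  have h : IsUnit a := isUnit_of_map_unit (i.stalkMap (genericPoint S)).hom a
    (isUnit_iff_ne_zero.2 ha)
  exact ⟨h.unit, rfl⟩

theorem isUnitAlong_natCast [CharZero S.functionField] {n : ℕ} (hn : n ≠ 0) :
    IsUnitAlong i (n : B.functionField) := by
  have h : (i.stalkMap (genericPoint S)).hom n ≠ 0 := by
    rw [map_natCast]
    exact_mod_cast hn
  simpa using isUnitAlong_of_stalkMap_ne_zero i h

namespace IsUnitAlong

variable {i} {h k : B.functionField}

theorem mul (hh : IsUnitAlong i h) (hk : IsUnitAlong i k) : IsUnitAlong i (h * k) := by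
  obtain ⟨u, rfl⟩ := hh
  obtain ⟨v, rfl⟩ := hk
  exact ⟨u * v, by simp⟩

theorem inv (hh : IsUnitAlong i h) : IsUnitAlong i h⁻¹ := by
  obtain ⟨u, rfl⟩ := hh
  refine ⟨u⁻¹, eq_inv_of_mul_eq_one_left ?_⟩
  rw [← map_mul, Units.inv_mul, map_one]

theorem div (hh : IsUnitAlong i h) (hk : IsUnitAlong i k) : IsUnitAlong i (h / k) := by
  rw [div_eq_mul_inv]
  exact hh.mul hk.inv

theorem neg (hh : IsUnitAlong i h) : IsUnitAlong i (-h) := by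
  obtain ⟨u, rfl⟩ := hh
  exact ⟨-u, by simp⟩

theorem pow (hh : IsUnitAlong i h) (n : ℕ) : IsUnitAlong i (h ^ n) := by
  obtain ⟨u, rfl⟩ := hh
  exact ⟨u ^ n, by simp⟩

theorem restrict_ne_zero (hh : IsUnitAlong i h) : restrict i h ≠ 0 := by
  obtain ⟨u, rfl⟩ := hh
  rw [restrict_algebraMap]
  exact (u.isUnit.map _).ne_zero

/-- `k` may fail to be regular along `S`; then so does `h * k`, and both sides take the default
value 0. -/
theorem restrict_mul (hh : IsUnitAlong i h) (k : B.functionField) :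
    restrict i (h * k) = restrict i h * restrict i k := by
  obtain ⟨u, rfl⟩ := hh
  by_cases H : ∃ a : B.presheaf.stalk (i (genericPoint S)), algebraMap _ B.functionField a = k
  · obtain ⟨a, rfl⟩ := H
    rw [← map_mul, restrict_algebraMap, restrict_algebraMap, restrict_algebraMap, map_mul]
  · have H' : ¬ ∃ a : B.presheaf.stalk (i (genericPoint S)), algebraMap _ B.functionField a =
        algebraMap _ B.functionField (u : B.presheaf.stalk (i (genericPoint S))) * k := by
      rintro ⟨a, ha⟩
      refine H ⟨↑u⁻¹ * a, ?_⟩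
      rw [map_mul, ha, ← mul_assoc, ← map_mul, Units.inv_mul, map_one, one_mul]
    have e : restrict i k = 0 := dif_neg H
    rw [e, mul_zero]
    exact dif_neg H'

theorem restrict_inv (hh : IsUnitAlong i h) : restrict i h⁻¹ = (restrict i h)⁻¹ := by
  have h1 : restrict i (h * h⁻¹) = 1 := by
    obtain ⟨u, rfl⟩ := hh
    rw [mul_inv_cancel₀ (u.isUnit.map _).ne_zero,
      ← map_one (algebraMap (B.presheaf.stalk (i (genericPoint S))) B.functionField),
      restrict_algebraMap, map_one]
  rw [hh.restrict_mul] at h1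
  exact eq_inv_of_mul_eq_one_right h1

theorem restrict_pow (hh : IsUnitAlong i h) (n : ℕ) : restrict i (h ^ n) = restrict i h ^ n := by
  obtain ⟨u, rfl⟩ := hh
  rw [← map_pow, restrict_algebraMap, restrict_algebraMap, map_pow]

end IsUnitAlong

/-! ### Transition functions and classes of restricted sections -/

/-- The local equation of `D` at a point of `S`, divided by the one at the generic point. -/
def relEqn (D : CartierDivisor B) (s : S) : B.functionField :=
  D.eqn (i s) / D.eqn (i (genericPoint S))

theorem eqn_eq_relEqn_mul (D : CartierDivisor B) (s : S) :
    D.eqn (i s) = relEqn i D s * D.eqn (i (genericPoint S)) :=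
  (div_mul_cancel₀ _ (D.eqn_ne_zero _)).symm

/-- The generic point of `S` lies in every neighbourhood of `i s`, where the local equations agree
up to units. -/
theorem isUnitAlong_relEqn (D : CartierDivisor B) (s : S) : IsUnitAlong i (relEqn i D s) := by
  obtain ⟨U, hsU, hU⟩ := D.compat (i s)
  obtain ⟨a, ha⟩ := hU _ ((map_genericPoint_specializes i s).mem_open U.isOpen hsU)
  have h : IsUnitAlong i (D.eqn (i (genericPoint S)) / D.eqn (i s)) :=
    ⟨a, by rw [ha, mul_div_cancel_right₀ _ (D.eqn_ne_zero _)]⟩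
  have h' := h.inv
  rwa [inv_div] at h'

variable [IsLocallyNoetherian S]

/-- Near `i s` the local equation changes by a unit of the local ring of `B` at `i y`. It restricts
to a unit of the local ring of `S` at `y` and so has order zero there. -/
theorem isLocallyPrincipal_relEqn (D : CartierDivisor B) :
    IsLocallyPrincipal fun s => restrict i (relEqn i D s) := by
  refine ⟨fun s => (isUnitAlong_relEqn i D s).restrict_ne_zero, fun s => ?_⟩
  obtain ⟨U, hsU, hU⟩ := D.compat (i s)
  refine ⟨i ⁻¹ᵁ U, hsU, fun y hy => ?_⟩
  obtain ⟨a, ha⟩ := hU (i y) hy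
  have hy' : relEqn i D y =
      algebraMap (B.presheaf.stalk (i y)) B.functionField a * relEqn i D s := by
    rw [relEqn, ha, mul_div_assoc, relEqn]
  have hau : IsUnitAlong i (algebraMap (B.presheaf.stalk (i y)) B.functionField a) :=
    ⟨Units.map (toGenericStalk i y).toMonoidHom a, algebraMap_toGenericStalk i y a⟩
  rw [hy', hau.restrict_mul, Scheme.ord_mul hau.restrict_ne_zero
    (isUnitAlong_relEqn i D s).restrict_ne_zero, restrict_algebraMap_stalk,
    ord_algebraMap_of_isUnit (a.isUnit.map _), zero_add]

/-- The family `s` is locally principal, and `c` is the class of its divisor. -/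
def HasClass (s : S → S.functionField) (c : Chow1 S) : Prop :=
  IsLocallyPrincipal s ∧ divClass s = c

theorem HasClass.congr {s t : S → S.functionField} {c : Chow1 S} (h : HasClass s c)
    (hst : ∀ x, t x = s x) : HasClass t c := by
  rwa [show t = s from funext hst]

theorem hasClass_relEqn (D : CartierDivisor B) :
    HasClass (fun s => restrict i (relEqn i D s)) (restrictClass i D) :=
  ⟨isLocallyPrincipal_relEqn i D, rfl⟩

theorem hasClass_const {c : S.functionField} (hc : c ≠ 0) : HasClass (fun _ : S => c) 0 :=
  ⟨.const hc, divClass_const hc⟩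

namespace HasClass

variable {s t : S → S.functionField} {c d : Chow1 S}

theorem mul (hs : HasClass s c) (ht : HasClass t d) : HasClass (fun x => s x * t x) (c + d) :=
  ⟨hs.1.mul ht.1, by rw [hs.1.divClass_mul ht.1, hs.2, ht.2]⟩

theorem inv (hs : HasClass s c) : HasClass (fun x => (s x)⁻¹) (-c) :=
  ⟨hs.1.inv, by rw [hs.1.divClass_inv, hs.2]⟩

theorem pow (hs : HasClass s c) (n : ℕ) : HasClass (fun x => s x ^ n) ((n : ℚ) • c) :=
  ⟨hs.1.pow n, by rw [hs.1.divClass_pow, hs.2]⟩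

theorem div (hs : HasClass s c) (ht : HasClass t d) : HasClass (fun x => s x / t x) (c - d) := by
  simpa only [div_eq_mul_inv, sub_eq_add_neg] using hs.mul ht.inv

theorem neg (hs : HasClass s c) : HasClass (fun x => -s x) c := by
  have h := (hasClass_const (S := S) (c := -1) (by simp)).mul hs
  simpa using h

end HasClass

/-- The class of the divisor of the restriction of a section of `𝒪(aL - bΣ)`. -/
theorem hasClass_restrict (L z : CartierDivisor B) (a b : ℕ) {h : B.functionField}
    (hh : restrict i h ≠ 0) :
    HasClass (fun s => restrict i (relEqn i L s ^ a * (relEqn i z s ^ b)⁻¹ * h))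
      ((a : ℚ) • restrictClass i L - (b : ℚ) • restrictClass i z) := by
  have h1 := (((hasClass_relEqn i L).pow a).mul ((hasClass_relEqn i z).pow b).inv).mul
    (hasClass_const hh)
  rw [add_zero, ← sub_eq_add_neg] at h1
  refine h1.congr fun s => ?_
  have hL := isUnitAlong_relEqn i L s
  have hz := isUnitAlong_relEqn i z s
  rw [((hL.pow a).mul (hz.pow b).inv).restrict_mul, (hL.pow a).restrict_mul, hL.restrict_pow,
    (hz.pow b).restrict_inv, hz.restrict_pow]

end Restriction

/-! ## Orders along a prime divisor -/

section PrimeDivisor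

/-- The local equation of `S` at a point of `S`, as an element of the local ring. -/
theorem CartierDivisor.IsEquationOf.exists_eqn {B S : Scheme.{0}} [IsIntegral B]
    {i : S ⟶ B} {z : CartierDivisor B} (hz : z.IsEquationOf i) (s : S) :
    ∃ t : B.presheaf.stalk (i s), algebraMap _ B.functionField t = z.eqn (i s) ∧
      t ≠ 0 ∧ ∀ b, (i.stalkMap s).hom b = 0 ↔ t ∣ b := by
  obtain ⟨t, ht, hker⟩ := hz.1 s
  refine ⟨t, ht, ?_, fun b => ?_⟩
  · rintro rfl
    exact z.eqn_ne_zero (i s) (by rw [← ht, map_zero])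
  · rw [← RingHom.mem_ker, hker, Ideal.mem_span_singleton]

theorem prime_of_stalkMap_eq_zero_iff {B S : Scheme.{0}} [IsIntegral S] {i : S ⟶ B}
    {s : S} {t : B.presheaf.stalk (i s)} (ht0 : t ≠ 0)
    (ht : ∀ b, (i.stalkMap s).hom b = 0 ↔ t ∣ b) : Prime t := by
  refine ⟨ht0, fun hu => ?_, fun a b hab => ?_⟩
  · have h1 := (ht 1).2 (hu.dvd)
    rw [map_one] at h1
    exact one_ne_zero h1
  · rw [← ht, map_mul, mul_eq_zero, ht, ht] at hab
    exact hab

variable {B S : Scheme.{0}} [IsIntegral B] [IsIntegral S] {i : S ⟶ B} {z : CartierDivisor B}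

/-- If the quotient restricted to zero, it would be divisible by the equation of `S` and the order
would be at least k + 1. -/
theorem OrdEq.isUnitAlong (hz : z.IsEquationOf i) {k : ℕ} {h : B.functionField}
    (hh : OrdEq i z k h) : IsUnitAlong i (h / z.eqn (i (genericPoint S)) ^ k) := by
  obtain ⟨⟨a, ha⟩, hn⟩ := hh
  obtain ⟨t, ht, -, hker⟩ := hz.exists_eqn (genericPoint S)
  rw [← ha]
  refine isUnitAlong_of_stalkMap_ne_zero i fun h0 => hn ?_
  obtain ⟨b, rfl⟩ := (hker a).1 h0
  refine ⟨b, ?_⟩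
  rw [map_mul, ht] at ha
  rw [pow_succ, ← div_div, ← ha, mul_div_cancel_left₀ _ (z.eqn_ne_zero _)]

theorem OrdGE.of_le (hz : z.IsEquationOf i) {k m : ℕ} (hkm : k ≤ m) {h : B.functionField}
    (hh : OrdGE i z m h) : OrdGE i z k h := by
  obtain ⟨a, ha⟩ := hh
  obtain ⟨t, ht, -, -⟩ := hz.exists_eqn (genericPoint S)
  have hz0 := z.eqn_ne_zero (i (genericPoint S))
  obtain ⟨n, rfl⟩ := Nat.exists_eq_add_of_le hkm
  refine ⟨t ^ n * a, ?_⟩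
  rw [map_mul, map_pow, ht, ha, pow_add]
  field_simp

theorem OrdGE.mul_isUnitAlong {k : ℕ} {h u : B.functionField} (hu : IsUnitAlong i u)
    (hh : OrdGE i z k h) : OrdGE i z k (u * h) := by
  obtain ⟨a, ha⟩ := hh
  obtain ⟨u, rfl⟩ := hu
  exact ⟨u * a, by rw [map_mul, ha, mul_div_assoc]⟩

/-- Passes from vanishing at the generic point of `S` to divisibility at every point `s`: the local
ring of `S` at `s` embeds into the function field, so a cofactor vanishing generically lies in the
ideal generated by `t`. -/
theorem pow_dvd_of_ordGE (hz : z.IsEquationOf i) {s : S} {t : B.presheaf.stalk (i s)}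
    (ht : algebraMap _ B.functionField t = z.eqn (i s))
    (hker : ∀ b, (i.stalkMap s).hom b = 0 ↔ t ∣ b) {k : ℕ} {b : B.presheaf.stalk (i s)}
    (hb : OrdGE i z k (algebraMap _ B.functionField b)) : t ^ k ∣ b := by
  induction k with
  | zero => simp
  | succ k ih =>
    obtain ⟨b', rfl⟩ := ih (hb.of_le hz (Nat.le_succ k))
    rw [pow_succ]
    refine mul_dvd_mul_left _ ((hker b').1 ?_)
    obtain ⟨a, ha⟩ := hb
    obtain ⟨t', ht', -, hker'⟩ := hz.exists_eqn (genericPoint S)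
    obtain ⟨u, hu⟩ := (isUnitAlong_relEqn i z s).pow k
    refine (map_eq_zero_iff _ (algebraMap_stalk_injective s)).1 ?_
    rw [← stalkMap_toGenericStalk, hker']
    refine ⟨↑u⁻¹ * a, algebraMap_stalk_injective _ ?_⟩
    have h1 : algebraMap _ B.functionField (↑u⁻¹ : B.presheaf.stalk (i (genericPoint S))) *
        relEqn i z s ^ k = 1 := by
      rw [← hu, ← map_mul, Units.inv_mul, map_one]
    have hz0 := z.eqn_ne_zero (i (genericPoint S))
    rw [algebraMap_toGenericStalk, map_mul, map_mul, ht', ha, map_mul, map_pow, ht,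
      eqn_eq_relEqn_mul i z s, mul_pow, pow_succ]
    field_simp
    linear_combination -(algebraMap _ B.functionField b') * h1

/-- The local ring of `S` is the quotient by a nonzerodivisor in the maximal ideal, so the dimension
drops by exactly one. -/
theorem coheight_map_eq_two [IsClosedImmersion i] (hz : z.IsEquationOf i) {s : S}
    (hN : IsNoetherianRing (B.presheaf.stalk (i s))) (hs : Order.coheight s = 1) :
    ringKrullDim (B.presheaf.stalk (i s)) = 2 := by
  obtain ⟨t, -, ht0, hker⟩ := hz.exists_eqn s
  have hp := prime_of_stalkMap_eq_zero_iff ht0 hker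
  have hk : RingHom.ker (i.stalkMap s).hom = Ideal.span {t} := by
    ext b
    rw [RingHom.mem_ker, hker, Ideal.mem_span_singleton]
  have e := (Ideal.quotEquivOfEq hk).symm.trans
    (RingHom.quotientKerEquivOfSurjective (f := (i.stalkMap s).hom)
      (Scheme.Hom.stalkMap_surjective i s))
  have h1 := ringKrullDim_quotient_span_singleton_succ_eq_ringKrullDim (x := t)
    (IsSMulRegular.of_ne_zero ht0) (show t ∈ IsLocalRing.maximalIdeal _ from hp.not_isUnit)
  rw [← h1, ringKrullDim_eq_of_ringEquiv e, ringKrullDim_stalk_eq_coheight, hs]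
  rfl

end PrimeDivisor

/-! ## The ground field -/

/-- The structure map of the local ring at `x` of a scheme over `ℂ`. -/
def stalkOfComplex {X : Scheme.{0}} (p : X ⟶ Spec (CommRingCat.of ℂ)) (x : X) :
    ℂ →+* X.presheaf.stalk x :=
  ((Scheme.ΓSpecIso (CommRingCat.of ℂ)).inv ≫ p.appTop ≫
    X.presheaf.germ (U := ⊤) x trivial).hom

theorem charZero_functionField {X : Scheme.{0}} [IsIntegral X]
    (p : X ⟶ Spec (CommRingCat.of ℂ)) : CharZero X.functionField :=
  charZero_of_injective_ringHom (stalkOfComplex p (genericPoint X)).injective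

theorem isUnit_natCast_stalk {X : Scheme.{0}} (p : X ⟶ Spec (CommRingCat.of ℂ)) (x : X) {n : ℕ}
    (hn : n ≠ 0) : IsUnit (n : X.presheaf.stalk x) := by
  have h : IsUnit (n : ℂ) := isUnit_iff_ne_zero.2 (by exact_mod_cast hn)
  simpa using h.map (stalkOfComplex p x)

/-! ## The classes of the sections in Tate's algorithm -/

section Classes

variable {B S : Scheme.{0}} [IsIntegral B] [IsIntegral S] {i : S ⟶ B}
  {W : WeierstrassModel B} {z : CartierDivisor B}

theorem fAt_eq (i : S ⟶ B) (W : WeierstrassModel B) (s : S) :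
    W.fAt (i s) = relEqn i W.L s ^ 4 * W.fAt (i (genericPoint S)) := by
  rw [WeierstrassModel.fAt, WeierstrassModel.fAt, eqn_eq_relEqn_mul i W.L s]
  ring

theorem gAt_eq (i : S ⟶ B) (W : WeierstrassModel B) (s : S) :
    W.gAt (i s) = relEqn i W.L s ^ 6 * W.gAt (i (genericPoint S)) := by
  rw [WeierstrassModel.gAt, WeierstrassModel.gAt, eqn_eq_relEqn_mul i W.L s]
  ring

theorem discAt_eq (i : S ⟶ B) (W : WeierstrassModel B) (s : S) :
    W.discAt (i s) = relEqn i W.L s ^ 12 * W.discAt (i (genericPoint S)) := by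
  rw [WeierstrassModel.discAt, WeierstrassModel.discAt, fAt_eq, gAt_eq]
  ring

theorem div_eqn_pow_eq (z L : CartierDivisor B) {h : B → B.functionField} {n : ℕ}
    (hh : ∀ s : S, h (i s) = relEqn i L s ^ n * h (i (genericPoint S))) (k : ℕ) (s : S) :
    h (i s) / z.eqn (i s) ^ k = relEqn i L s ^ n * (relEqn i z s ^ k)⁻¹ *
      (h (i (genericPoint S)) / z.eqn (i (genericPoint S)) ^ k) := by
  rw [hh, eqn_eq_relEqn_mul i z s, mul_pow, div_eq_mul_inv, div_eq_mul_inv, mul_inv]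
  ring

variable [IsLocallyNoetherian S]

/-- The class of the divisor of the leading coefficient along `S` of a section of `𝒪(nL)`. -/
theorem hasClass_leadingCoeff (hz : z.IsEquationOf i) (L : CartierDivisor B)
    {h : B → B.functionField} {n k : ℕ}
    (hh : ∀ s : S, h (i s) = relEqn i L s ^ n * h (i (genericPoint S)))
    (hk : OrdEq i z k (h (i (genericPoint S)))) :
    HasClass (fun s => restrict i (h (i s) / z.eqn (i s) ^ k))
      ((n : ℚ) • restrictClass i L - (k : ℚ) • restrictClass i z) := by
  refine (hasClass_restrict i L z n k (hk.isUnitAlong hz).restrict_ne_zero).congr fun s => ?_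
  rw [div_eqn_pow_eq z L hh]

theorem hasClass_deltaSec (hz : z.IsEquationOf i) {T : KodairaType}
    (hT : OrdEq i z T.mult (W.discAt (i (genericPoint S)))) :
    HasClass (deltaSec i W z T)
      ((12 : ℚ) • restrictClass i W.L - (T.mult : ℚ) • restrictClass i z) :=
  hasClass_leadingCoeff hz W.L (discAt_eq i W) hT

theorem hasClass_fAt (hz : z.IsEquationOf i) {k : ℕ}
    (hf : OrdEq i z k (W.fAt (i (genericPoint S)))) :
    HasClass (fun s => restrict i (W.fAt (i s) / z.eqn (i s) ^ k))
      ((4 : ℚ) • restrictClass i W.L - (k : ℚ) • restrictClass i z) :=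
  hasClass_leadingCoeff hz W.L (fAt_eq i W) hf

theorem hasClass_gAt (hz : z.IsEquationOf i) {k : ℕ}
    (hg : OrdEq i z k (W.gAt (i (genericPoint S)))) :
    HasClass (fun s => restrict i (W.gAt (i s) / z.eqn (i s) ^ k))
      ((6 : ℚ) • restrictClass i W.L - (k : ℚ) • restrictClass i z) :=
  hasClass_leadingCoeff hz W.L (gAt_eq i W) hg

variable [CharZero S.functionField]

theorem hasClass_uSec (hz : z.IsEquationOf i) (hf : OrdEq i z 0 (W.fAt (i (genericPoint S))))
    (hg : OrdEq i z 0 (W.gAt (i (genericPoint S)))) :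
    HasClass (uSec i W) ((2 : ℚ) • restrictClass i W.L) := by
  have h9 := isUnitAlong_natCast i (n := 9) (by norm_num)
  have h2 := isUnitAlong_natCast i (n := 2) (by norm_num)
  have hu := (h9.neg.mul (hg.isUnitAlong hz)).div (h2.mul (hf.isUnitAlong hz))
  have h := hasClass_restrict i W.L z 2 0 hu.restrict_ne_zero
  rw [Nat.cast_zero, zero_smul, sub_zero] at h
  refine h.congr fun s => ?_
  have hL : relEqn i W.L s ≠ 0 := div_ne_zero (W.L.eqn_ne_zero _) (W.L.eqn_ne_zero _)
  rw [uSec, fAt_eq, gAt_eq]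
  congr 1
  simp only [pow_zero, div_one, inv_one, mul_one, Nat.cast_ofNat]
  rw [show -9 * (relEqn i W.L s ^ 6 * W.gAt (i (genericPoint S))) = relEqn i W.L s ^ 4 *
    (relEqn i W.L s ^ 2 * (-9 * W.gAt (i (genericPoint S)))) by ring,
    mul_left_comm 2, mul_div_mul_left _ _ (pow_ne_zero 4 hL), mul_div_assoc]

theorem hasClass_uStarSec (hz : z.IsEquationOf i) (hf : OrdEq i z 2 (W.fAt (i (genericPoint S))))
    (hg : OrdEq i z 3 (W.gAt (i (genericPoint S)))) :
    HasClass (uStarSec i W z) ((2 : ℚ) • restrictClass i W.L - restrictClass i z) := by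
  have h9 := isUnitAlong_natCast i (n := 9) (by norm_num)
  have h2 := isUnitAlong_natCast i (n := 2) (by norm_num)
  have hu := (h9.neg.mul (hg.isUnitAlong hz)).div (h2.mul (hf.isUnitAlong hz))
  have h := hasClass_restrict i W.L z 2 1 hu.restrict_ne_zero
  rw [Nat.cast_one, one_smul] at h
  refine h.congr fun s => ?_
  have hL : relEqn i W.L s ≠ 0 := div_ne_zero (W.L.eqn_ne_zero _) (W.L.eqn_ne_zero _)
  have hzs : relEqn i z s ≠ 0 := div_ne_zero (z.eqn_ne_zero _) (z.eqn_ne_zero _)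
  have hz0 := z.eqn_ne_zero (i (genericPoint S))
  rw [uStarSec, fAt_eq, gAt_eq, eqn_eq_relEqn_mul i z s]
  congr 1
  generalize relEqn i W.L s = l at *
  generalize relEqn i z s = r at *
  generalize z.eqn (i (genericPoint S)) = t at *
  generalize W.fAt (i (genericPoint S)) = f at *
  generalize W.gAt (i (genericPoint S)) = g at *
  rw [Nat.cast_ofNat, Nat.cast_ofNat,
    show -9 * (l ^ 6 * g) = (l ^ 4 * t ^ 3 * r) * (l ^ 2 * r⁻¹ * (-9 * (g / t ^ 3))) by
      field_simp,
    show 2 * (r * t) * (l ^ 4 * f) = (l ^ 4 * t ^ 3 * r) * (2 * (f / t ^ 2)) by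
      field_simp,
    mul_div_mul_left _ _ (by positivity), mul_div_assoc, pow_one]

end Classes

/-! ## Relations between the classes of `L` and `S` -/

section Relations

theorem algebraMap_eq_div_pow {B S : Scheme.{0}} [IsIntegral B] {i : S ⟶ B}
    {z : CartierDivisor B} {s : S} {t c : B.presheaf.stalk (i s)} {k : ℕ} {h : B.functionField}
    (ht : algebraMap _ B.functionField t = z.eqn (i s))
    (hb : algebraMap _ B.functionField (t ^ k * c) = h) :
    algebraMap _ B.functionField c = h / z.eqn (i s) ^ k := by
  rw [← hb, map_mul, map_pow, ht, mul_div_cancel_left₀ _ (pow_ne_zero k (z.eqn_ne_zero _))]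

variable {B S : Scheme.{0}} [IsIntegral B] [IsIntegral S] {i : S ⟶ B}
  {W : WeierstrassModel B} {z : CartierDivisor B}

/-- The class of the divisor of the leading coefficient along `S` of a section of `𝒪(nL)` is zero if
this coefficient vanishes nowhere in codimension one. -/
theorem class_eq_zero_of_isUnit [IsLocallyNoetherian S] (hz : z.IsEquationOf i)
    (L : CartierDivisor B) {h : B → B.functionField} {n k : ℕ}
    (hh : ∀ s : S, h (i s) = relEqn i L s ^ n * h (i (genericPoint S)))
    (hk : OrdEq i z k (h (i (genericPoint S))))
    (hu : ∀ s : S, Order.coheight s = 1 → ∃ c : B.presheaf.stalk (i s), IsUnit c ∧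
      algebraMap _ B.functionField c = h (i s) / z.eqn (i s) ^ k) :
    (n : ℚ) • restrictClass i L - (k : ℚ) • restrictClass i z = 0 := by
  rw [← (hasClass_leadingCoeff hz L hh hk).2]
  refine divClass_eq_zero_of_ord_eq_zero fun s => ?_
  by_cases hs : Order.coheight s = 1
  · obtain ⟨c, hc, e⟩ := hu s hs
    rw [← e, restrict_algebraMap_stalk, ord_algebraMap_of_isUnit (hc.map _)]
  · exact Scheme.ord_eq_zero_of_coheight_neq_one hs _

theorem pow_dvd_of_ordGE_genericPoint (hz : z.IsEquationOf i) {L : CartierDivisor B}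
    {h : B → B.functionField} {n k : ℕ}
    (hh : ∀ s : S, h (i s) = relEqn i L s ^ n * h (i (genericPoint S)))
    (hk : OrdGE i z k (h (i (genericPoint S)))) {s : S} {t b : B.presheaf.stalk (i s)}
    (ht : algebraMap _ B.functionField t = z.eqn (i s))
    (hker : ∀ b, (i.stalkMap s).hom b = 0 ↔ t ∣ b)
    (hb : algebraMap _ B.functionField b = h (i s)) : t ^ k ∣ b := by
  refine pow_dvd_of_ordGE hz ht hker ?_
  rw [hb, hh]
  exact hk.mul_isUnitAlong ((isUnitAlong_relEqn i L s).pow n)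

variable [IsClosedImmersion i] [IsLocallyNoetherian S]

/-- With f = t⁴F and g = t⁵G, a zero of G at `s` would give f ∈ 𝔪⁴ and g ∈ 𝔪⁶. -/
theorem six_smul_eq_of_IIstar (hB : ∀ x : B, IsRegularLocalRing (B.presheaf.stalk x))
    (hW : W.MinimalInCodimTwo) (hz : z.IsEquationOf i)
    (hf : OrdGE i z 4 (W.fAt (i (genericPoint S))))
    (hg : OrdEq i z 5 (W.gAt (i (genericPoint S)))) :
    (6 : ℚ) • restrictClass i W.L - (5 : ℚ) • restrictClass i z = 0 := by
  refine class_eq_zero_of_isUnit hz W.L (gAt_eq i W) hg fun s hs => ?_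
  have hR := hB (i s)
  have hdim := coheight_map_eq_two hz inferInstance hs
  rw [ringKrullDim_stalk_eq_coheight] at hdim
  obtain ⟨t, ht, ht0, hker⟩ := hz.exists_eqn s
  have htm : t ∈ IsLocalRing.maximalIdeal (B.presheaf.stalk (i s)) :=
    (prime_of_stalkMap_eq_zero_iff ht0 hker).not_isUnit
  obtain ⟨a, ha⟩ := W.f_section (i s)
  obtain ⟨b, hb⟩ := W.g_section (i s)
  obtain ⟨F, rfl⟩ := pow_dvd_of_ordGE_genericPoint hz (fAt_eq i W) hf ht hker ha
  obtain ⟨G, rfl⟩ := pow_dvd_of_ordGE_genericPoint hz (gAt_eq i W) hg.1 ht hker hb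
  refine ⟨G, ?_, algebraMap_eq_div_pow ht hb⟩
  by_contra hG
  refine hW (i s) (WithBot.coe_injective hdim) _ _ ha hb
    ⟨Ideal.mul_mem_right _ _ (Ideal.pow_mem_pow htm 4), ?_⟩
  rw [pow_succ _ 5]
  exact Ideal.mul_mem_mul (Ideal.pow_mem_pow htm 5) hG

/-- With f = t²F and g = t³G, order ten of Δ means t⁴ ∣ 4F³ + 27G². A zero of F would then force F ∈
𝔪² and G ∈ 𝔪³, hence f ∈ 𝔪⁴ and g ∈ 𝔪⁶. -/
theorem four_smul_eq_of_Istar (hB : ∀ x : B, IsRegularLocalRing (B.presheaf.stalk x))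
    (h2 : ∀ x : B, IsUnit (2 : B.presheaf.stalk x)) (h3 : ∀ x : B, IsUnit (3 : B.presheaf.stalk x))
    (hW : W.MinimalInCodimTwo) (hz : z.IsEquationOf i)
    (hf : OrdEq i z 2 (W.fAt (i (genericPoint S))))
    (hg : OrdGE i z 3 (W.gAt (i (genericPoint S))))
    (hΔ : OrdGE i z 10 (W.discAt (i (genericPoint S)))) :
    (4 : ℚ) • restrictClass i W.L - (2 : ℚ) • restrictClass i z = 0 := by
  refine class_eq_zero_of_isUnit hz W.L (fAt_eq i W) hf fun s hs => ?_
  have hR := hB (i s)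
  have hdim := coheight_map_eq_two hz inferInstance hs
  obtain ⟨t, ht, ht0, hker⟩ := hz.exists_eqn s
  have htp := prime_of_stalkMap_eq_zero_iff ht0 hker
  have htm : t ∈ IsLocalRing.maximalIdeal (B.presheaf.stalk (i s)) := htp.not_isUnit
  obtain ⟨a, ha⟩ := W.f_section (i s)
  obtain ⟨b, hb⟩ := W.g_section (i s)
  obtain ⟨F, rfl⟩ := pow_dvd_of_ordGE_genericPoint hz (fAt_eq i W) hf.1 ht hker ha
  obtain ⟨G, rfl⟩ := pow_dvd_of_ordGE_genericPoint hz (gAt_eq i W) hg ht hker hb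
  have hF := algebraMap_eq_div_pow ht ha
  refine ⟨F, ?_, hF⟩
  by_contra hFm
  have hd : t ^ 10 ∣ 4 * (t ^ 2 * F) ^ 3 + 27 * (t ^ 3 * G) ^ 2 := by
    refine pow_dvd_of_ordGE_genericPoint hz (discAt_eq i W) hΔ ht hker ?_
    rw [map_add, map_mul, map_pow, ha, map_mul, map_pow, hb, map_ofNat, map_ofNat]
    rfl
  have hd' : t ^ 4 ∣ 4 * F ^ 3 + 27 * G ^ 2 := by
    refine (mul_dvd_mul_iff_left (pow_ne_zero 6 ht0)).1 ?_
    convert hd using 1 <;> ring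
  have htF : ¬ t ∣ F := fun h => by
    have hu : IsUnitAlong i (algebraMap _ B.functionField F) := by
      have e := div_eqn_pow_eq z W.L (fAt_eq i W) 2 s
      rw [hF]
      refine e ▸ (((isUnitAlong_relEqn i W.L s).pow 4).mul
        ((isUnitAlong_relEqn i z s).pow 2).inv).mul (hf.isUnitAlong hz)
    apply hu.restrict_ne_zero
    rw [restrict_algebraMap_stalk, (hker F).2 h, map_zero]
  obtain ⟨h4, h6⟩ := mem_maximalIdeal_pow_of_pow_four_dvd hdim (h2 _) (h3 _) htp htF hFm hd'
  rw [ringKrullDim_stalk_eq_coheight] at hdim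
  refine hW (i s) (WithBot.coe_injective hdim) _ _ ha hb ⟨?_, ?_⟩
  · rw [pow_add _ 2 2]
    exact Ideal.mul_mem_mul (Ideal.pow_mem_pow htm 2) h4
  · rw [pow_add _ 3 3]
    exact Ideal.mul_mem_mul (Ideal.pow_mem_pow htm 3) h6

end Relations

/-! ## The Tate cycle -/

section Tensor

variable {A M : Type*} [AddCommGroup A] [Module ℚ A] [AddCommGroup M] [Module ℚ M]
  {ℓ σ β γ δ : A} {a f g h rα rβ rγ rδ : M}

/-- Here `a` plays the adjoint and `f` the only other representation. `hu` and `hv` compare the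
coefficients of ℓ ⊗ f and σ ⊗ f; the terms in `p` are the contribution of ρ' in ρ_α. -/
theorem tate_tensor_eq_one {p q r d b₁ b₂ c₁ c₂ d₁ d₂ : ℚ}
    (hα : rα = a + p • f) (hβ : rβ = q • f) (hγ : rγ = r • f) (hδ : rδ = d • f)
    (eβ : β = b₁ • ℓ + b₂ • σ) (eγ : γ = c₁ • ℓ + c₂ • σ) (eδ : δ = d₁ • ℓ + d₂ • σ)
    {u v : ℚ} (hu : -p / 2 + q * b₁ / 2 + r * c₁ + d * d₁ = u)
    (hv : p / 2 + q * b₂ / 2 + r * c₂ + d * d₂ = v) :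
    ((1 / 2 : ℚ) • (-ℓ + σ)) ⊗ₜ[ℚ] rα + ((1 / 2 : ℚ) • β) ⊗ₜ[ℚ] rβ + γ ⊗ₜ[ℚ] rγ +
        δ ⊗ₜ[ℚ] rδ =
      ((-1 / 2 : ℚ) • ℓ + (1 / 2 : ℚ) • σ) ⊗ₜ[ℚ] a + (u • ℓ + v • σ) ⊗ₜ[ℚ] f := by
  subst_vars
  simp only [TensorProduct.add_tmul, TensorProduct.tmul_add, TensorProduct.tmul_smul,
    ← TensorProduct.smul_tmul', TensorProduct.neg_tmul, smul_add, smul_neg]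
  module

theorem tate_tensor_eq_two {p q r d p' q' r' d' b₁ b₂ c₁ c₂ d₁ d₂ : ℚ}
    (hα : rα = a + (p • f + p' • g)) (hβ : rβ = q • f + q' • g) (hγ : rγ = r • f + r' • g)
    (hδ : rδ = d • f + d' • g)
    (eβ : β = b₁ • ℓ + b₂ • σ) (eγ : γ = c₁ • ℓ + c₂ • σ) (eδ : δ = d₁ • ℓ + d₂ • σ)
    {u v u' v' : ℚ} (hu : -p / 2 + q * b₁ / 2 + r * c₁ + d * d₁ = u)
    (hv : p / 2 + q * b₂ / 2 + r * c₂ + d * d₂ = v)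
    (hu' : -p' / 2 + q' * b₁ / 2 + r' * c₁ + d' * d₁ = u')
    (hv' : p' / 2 + q' * b₂ / 2 + r' * c₂ + d' * d₂ = v') :
    ((1 / 2 : ℚ) • (-ℓ + σ)) ⊗ₜ[ℚ] rα + ((1 / 2 : ℚ) • β) ⊗ₜ[ℚ] rβ + γ ⊗ₜ[ℚ] rγ +
        δ ⊗ₜ[ℚ] rδ =
      ((-1 / 2 : ℚ) • ℓ + (1 / 2 : ℚ) • σ) ⊗ₜ[ℚ] a + ((u • ℓ + v • σ) ⊗ₜ[ℚ] f +
        (u' • ℓ + v' • σ) ⊗ₜ[ℚ] g) := by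
  subst_vars
  simp only [TensorProduct.add_tmul, TensorProduct.tmul_add, TensorProduct.tmul_smul,
    ← TensorProduct.smul_tmul', TensorProduct.neg_tmul, smul_add, smul_neg]
  module

theorem tate_tensor_eq_three {d d₁ d₂ : ℚ}
    (hα : rα = a) (hβ : rβ = 0) (hγ : rγ = 0) (hδ : rδ = d • (f + g + h))
    (eδ : δ = d₁ • ℓ + d₂ • σ) {u v : ℚ} (hu : d * d₁ = u) (hv : d * d₂ = v) :
    ((1 / 2 : ℚ) • (-ℓ + σ)) ⊗ₜ[ℚ] rα + ((1 / 2 : ℚ) • β) ⊗ₜ[ℚ] rβ + γ ⊗ₜ[ℚ] rγ +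
        δ ⊗ₜ[ℚ] rδ =
      ((-1 / 2 : ℚ) • ℓ + (1 / 2 : ℚ) • σ) ⊗ₜ[ℚ] a + ((u • ℓ + v • σ) ⊗ₜ[ℚ] f +
        ((u • ℓ + v • σ) ⊗ₜ[ℚ] g + (u • ℓ + v • σ) ⊗ₜ[ℚ] h)) := by
  subst_vars
  simp only [TensorProduct.add_tmul, TensorProduct.tmul_add, TensorProduct.tmul_smul,
    ← TensorProduct.smul_tmul', TensorProduct.neg_tmul, smul_add, smul_neg,
    TensorProduct.tmul_zero]
  module

end Tensor

/-! ### Divisor classes of β, γ and δ as combinations of L and Σ -/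

section SectionClasses

variable {B S : Scheme.{0}} [IsIntegral B] [IsIntegral S] [IsLocallyNoetherian S] {i : S ⟶ B}
  {W : WeierstrassModel B} {z : CartierDivisor B}

/-- Serves for β or γ when the type does not define it and the section is the constant 1. -/
theorem divClass_one (L z : CartierDivisor B) : divClass (fun _ : S => 1) =
    (0 : ℚ) • restrictClass i L + (0 : ℚ) • restrictClass i z := by
  rw [divClass_const one_ne_zero, zero_smul, zero_smul, add_zero]

theorem divClass_deltaSec (hz : z.IsEquationOf i) {T : KodairaType} {m : ℕ} (hm : T.mult = m)
    (hT : OrdEq i z m (W.discAt (i (genericPoint S)))) : divClass (deltaSec i W z T) =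
      (12 : ℚ) • restrictClass i W.L + (-m : ℚ) • restrictClass i z := by
  subst hm
  rw [(hasClass_deltaSec hz hT).2, neg_smul, sub_eq_add_neg]

theorem divClass_fAt (hz : z.IsEquationOf i) {k : ℕ}
    (hf : OrdEq i z k (W.fAt (i (genericPoint S)))) :
    divClass (fun s => restrict i (W.fAt (i s) / z.eqn (i s) ^ k)) =
      (4 : ℚ) • restrictClass i W.L + (-k : ℚ) • restrictClass i z := by
  rw [(hasClass_fAt hz hf).2, neg_smul, sub_eq_add_neg]

theorem divClass_gAt (hz : z.IsEquationOf i) {k : ℕ}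
    (hg : OrdEq i z k (W.gAt (i (genericPoint S)))) :
    divClass (fun s => restrict i (W.gAt (i s) / z.eqn (i s) ^ k)) =
      (6 : ℚ) • restrictClass i W.L + (-k : ℚ) • restrictClass i z := by
  rw [(hasClass_gAt hz hg).2, neg_smul, sub_eq_add_neg]

variable [CharZero S.functionField]

theorem divClass_gammaSec_I (hz : z.IsEquationOf i) {m : ℕ} (hT : HasType i W z (.I m)) :
    divClass (gammaSec i W z (.I m)) =
      (8 : ℚ) • restrictClass i W.L + (-m : ℚ) • restrictClass i z := by
  obtain ⟨-, hf, hg, hΔ⟩ := hT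
  refine ((hasClass_deltaSec (T := .I m) hz hΔ).div ((hasClass_uSec hz hf hg).pow 2)).2.trans ?_
  rw [KodairaType.mult]
  push_cast
  module

theorem divClass_betaSec_I (hz : z.IsEquationOf i) {m : ℕ} (hm : m ≠ 2)
    (hT : HasType i W z (.I m)) : divClass (betaSec i W z (.I m)) =
      (2 : ℚ) • restrictClass i W.L + (0 : ℚ) • restrictClass i z := by
  have h : betaSec i W z (.I m) = uSec i W := funext fun s => if_neg hm
  rw [h, (hasClass_uSec hz hT.2.1 hT.2.2.1).2, zero_smul, add_zero]

theorem divClass_gammaSec_Istar (hz : z.IsEquationOf i) {k : ℕ}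
    (hT : HasType i W z (.Istar (k + 1))) : divClass (gammaSec i W z (.Istar (k + 1))) =
      (2 : ℚ) • restrictClass i W.L + (-1 : ℚ) • restrictClass i z := by
  refine (hasClass_uStarSec hz hT.1 hT.2.1).2.trans ?_
  module

theorem divClass_betaSec_Istar_odd (hz : z.IsEquationOf i) {k : ℕ} (hk : Odd (k + 1))
    (hT : HasType i W z (.Istar (k + 1))) : divClass (betaSec i W z (.Istar (k + 1))) =
      (6 : ℚ) • restrictClass i W.L + (-(k + 4) : ℚ) • restrictClass i z := by
  obtain ⟨hf, hg, hΔ⟩ := hT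
  have h : betaSec i W z (.Istar (k + 1)) = fun s =>
      deltaSec i W z (.Istar (k + 1)) s / uStarSec i W z s ^ 3 := funext fun s => if_pos hk
  rw [h, ((hasClass_deltaSec (T := .Istar (k + 1)) hz hΔ).div
    ((hasClass_uStarSec hz hf hg).pow 3)).2, KodairaType.mult]
  push_cast
  module

theorem divClass_betaSec_Istar_even (hz : z.IsEquationOf i) {k : ℕ} (hk : ¬ Odd (k + 1))
    (hT : HasType i W z (.Istar (k + 1))) : divClass (betaSec i W z (.Istar (k + 1))) =
      (8 : ℚ) • restrictClass i W.L + (-(k + 5) : ℚ) • restrictClass i z := by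
  obtain ⟨hf, hg, hΔ⟩ := hT
  have h : betaSec i W z (.Istar (k + 1)) = fun s =>
      -(deltaSec i W z (.Istar (k + 1)) s / uStarSec i W z s ^ 2) := funext fun s => if_neg hk
  rw [h, ((hasClass_deltaSec (T := .Istar (k + 1)) hz hΔ).div
    ((hasClass_uStarSec hz hf hg).pow 2)).neg.2, KodairaType.mult]
  push_cast
  module

end SectionClasses

/-! ## The Tate cycle equals the cycle of the classes `Γ_ρ` -/

section TateCycle

variable {B S : Scheme.{0}} [IsIntegral B] [IsIntegral S] [IsLocallyNoetherian S] {i : S ⟶ B}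
  {W : WeierstrassModel B} {z : CartierDivisor B}

variable (i W z) in
/-- The Tate cycle of type `T` for the gauge algebra `𝔤` equals the cycle of the classes `Γ_ρ`. -/
def TateCycleEq (ν : ℤˣ) (T : KodairaType) (𝔤 : GaugeAlgebra) : Prop :=
  tateCycle i W z ν T 𝔤 = gammaSum (restrictClass i W.L) (restrictClass i z) ν 𝔤

variable (ν : ℤˣ)

theorem tateCycleEq_III (hz : z.IsEquationOf i) (hT : HasType i W z .III) :
    TateCycleEq i W z ν .III (.su 2) := by
  have hγ : gammaSec i W z .III = fun s => restrict i (W.fAt (i s) / z.eqn (i s) ^ 1) := by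
    simp only [pow_one]
    rfl
  rw [TateCycleEq, gammaSum_su_two]
  refine tate_tensor_eq_one (p := 0) (q := 0) (r := 2) (d := 0) ?_ ?_ rfl ?_
    (divClass_one W.L z) (hγ ▸ divClass_fAt hz hT.1)
    (divClass_deltaSec (m := 3) hz rfl hT.2.2) ?_ ?_
  · simp [rhoAlpha]
  · simp [rhoSqrtBeta]
  · simp [rhoDelta]
  all_goals norm_num

theorem tateCycleEq_IV (hz : z.IsEquationOf i) (hT : HasType i W z .IV) {n : ℕ}
    (hn : n = 2 ∨ n = 3) : TateCycleEq i W z ν .IV (.su n) := by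
  rcases hn with rfl | rfl
  · rw [TateCycleEq, gammaSum_su_two]
    refine tate_tensor_eq_one (p := 2) (q := 3) (r := 0) (d := 0) ?_ rfl ?_ ?_
      (divClass_gAt hz hT.2.1) (divClass_one W.L z) (divClass_deltaSec (m := 4) hz rfl hT.2.2) ?_ ?_
    · simp [rhoAlpha]
    · simp [rhoGamma]
    · simp [rhoDelta]
    all_goals norm_num
  · rw [TateCycleEq, gammaSum_su_three]
    refine tate_tensor_eq_one (p := 0) (q := 3) (r := 0) (d := 0) ?_ rfl ?_ ?_
      (divClass_gAt hz hT.2.1) (divClass_one W.L z) (divClass_deltaSec (m := 4) hz rfl hT.2.2) ?_ ?_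
    · simp [rhoAlpha]
    · simp [rhoGamma]
    · simp [rhoDelta]
    all_goals norm_num

theorem tateCycleEq_Istar_zero_g2 (hz : z.IsEquationOf i) (hT : HasType i W z (.Istar 0)) :
    TateCycleEq i W z ν (.Istar 0) .g2 := by
  rw [TateCycleEq, gammaSum_g2]
  refine tate_tensor_eq_one (p := 2) (q := 0) (r := 0) (d := 1 / 2) rfl ?_ ?_ rfl
    (divClass_one W.L z) (divClass_one W.L z) (divClass_deltaSec (m := 6) hz rfl hT.2.2) ?_ ?_
  · simp [rhoSqrtBeta]
  · simp [rhoGamma]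
  all_goals norm_num

theorem tateCycleEq_Istar_zero_so_seven (hz : z.IsEquationOf i)
    (hT : HasType i W z (.Istar 0)) : TateCycleEq i W z ν (.Istar 0) (.so 7) := by
  rw [TateCycleEq, gammaSum_so _ _ _ (by norm_num) (by norm_num)]
  refine tate_tensor_eq_two (p := 1) (q := 0) (r := 0) (d := 1 / 6)
    (p' := 0) (q' := 0) (r' := 0) (d' := 1 / 3) ?_ ?_ ?_ ?_
    (divClass_one W.L z) (divClass_one W.L z) (divClass_deltaSec (m := 6) hz rfl hT.2.2) ?_ ?_ ?_ ?_
  · simp [rhoAlpha, show Odd 7 by decide]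
  · simp [rhoSqrtBeta]
  · simp [rhoGamma]
  · exact add_comm _ _
  all_goals norm_num

theorem tateCycleEq_Istar_zero_so_eight (hz : z.IsEquationOf i)
    (hT : HasType i W z (.Istar 0)) : TateCycleEq i W z ν (.Istar 0) (.so 8) := by
  rw [TateCycleEq, gammaSum_so_eight]
  refine tate_tensor_eq_three (d := 1 / 6) ?_ rfl rfl rfl
    (divClass_deltaSec (m := 6) hz rfl hT.2.2) ?_ ?_
  · simp [rhoAlpha, show ¬ Odd 8 by decide]
  all_goals norm_num

theorem tateCycleEq_IVstar_e6 (hz : z.IsEquationOf i) (hT : HasType i W z .IVstar) :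
    TateCycleEq i W z ν .IVstar .e6 := by
  rw [TateCycleEq, gammaSum_e6]
  refine tate_tensor_eq_one (p := 0) (q := 1) (r := 0) (d := 0) ?_ ?_ ?_ ?_
    (divClass_gAt hz hT.2.1) (divClass_one W.L z) (divClass_deltaSec (m := 8) hz rfl hT.2.2) ?_ ?_
  · simp [rhoAlpha]
  · simp [rhoSqrtBeta]
  · simp [rhoGamma]
  · simp [rhoDelta]
  all_goals norm_num

theorem tateCycleEq_IVstar_f4 (hz : z.IsEquationOf i) (hT : HasType i W z .IVstar) :
    TateCycleEq i W z ν .IVstar .f4 := by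
  rw [TateCycleEq, gammaSum_f4]
  refine tate_tensor_eq_one (p := 1) (q := 1) (r := 0) (d := 0) ?_ ?_ ?_ ?_
    (divClass_gAt hz hT.2.1) (divClass_one W.L z) (divClass_deltaSec (m := 8) hz rfl hT.2.2) ?_ ?_
  · simp [rhoAlpha]
  · simp [rhoSqrtBeta]
  · simp [rhoGamma]
  · simp [rhoDelta]
  all_goals norm_num

theorem tateCycleEq_IIIstar (hz : z.IsEquationOf i) (hT : HasType i W z .IIIstar) :
    TateCycleEq i W z ν .IIIstar .e7 := by
  rw [TateCycleEq, gammaSum_e7]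
  refine tate_tensor_eq_one (p := 0) (q := 0) (r := 1 / 2) (d := 0) ?_ ?_ rfl ?_
    (divClass_one W.L z) (divClass_fAt hz hT.1) (divClass_deltaSec (m := 9) hz rfl hT.2.2) ?_ ?_
  · simp [rhoAlpha]
  · simp [rhoSqrtBeta]
  · simp [rhoDelta]
  all_goals norm_num

theorem tateCycleEq_IIstar (hz : z.IsEquationOf i) (hT : HasType i W z .IIstar) :
    TateCycleEq i W z ν .IIstar .e8 := by
  rw [TateCycleEq, gammaSum_e8]
  -- Only the adjoint occurs for 𝔢₈, so the second representation is set to zero.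
  refine (tate_tensor_eq_one (a := rep .adj .e8) (f := 0) (p := 0) (q := 0) (r := 0) (d := 0)
    ?_ ?_ ?_ ?_ (divClass_one W.L z) (divClass_gAt hz hT.2.1)
    (divClass_deltaSec (m := 10) hz rfl hT.2.2) rfl rfl).trans ?_
  · simp [rhoAlpha]
  · simp [rhoSqrtBeta]
  · simp [rhoGamma]
  · simp [rhoDelta]
  · rw [TensorProduct.tmul_zero, add_zero]

variable [CharZero S.functionField]

theorem tateCycleEq_I_two (hz : z.IsEquationOf i) (hT : HasType i W z (.I 2)) :
    TateCycleEq i W z ν (.I 2) (.su 2) := by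
  rw [TateCycleEq, gammaSum_su_two]
  refine tate_tensor_eq_one (p := 0) (q := 0) (r := 1) (d := 0) ?_ ?_ ?_ ?_
    (divClass_one W.L z) (divClass_gammaSec_I hz hT)
    (divClass_deltaSec (m := 2) hz rfl hT.2.2.2) ?_ ?_
  · simp [rhoAlpha]
  · simp [rhoSqrtBeta]
  · simp [rhoGamma]
  · simp [rhoDelta]
  all_goals norm_num

theorem tateCycleEq_I_three (hz : z.IsEquationOf i) (hT : HasType i W z (.I 3)) {n : ℕ}
    (hn : n = 2 ∨ n = 3) : TateCycleEq i W z ν (.I 3) (.su n) := by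
  rcases hn with rfl | rfl
  · rw [TateCycleEq, gammaSum_su_two]
    refine tate_tensor_eq_one (p := 2) (q := 1) (r := 1) (d := 0) ?_ ?_ ?_ ?_
      (divClass_betaSec_I hz (by norm_num) hT) (divClass_gammaSec_I hz hT)
      (divClass_deltaSec (m := 3) hz rfl hT.2.2.2) ?_ ?_
    · simp [rhoAlpha]
    · simp [rhoSqrtBeta]
    · simp [rhoGamma]
    · simp [rhoDelta]
    all_goals norm_num
  · rw [TateCycleEq, gammaSum_su_three]
    refine tate_tensor_eq_one (p := 0) (q := 1) (r := 1) (d := 0) ?_ ?_ ?_ ?_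
      (divClass_betaSec_I hz (by norm_num) hT) (divClass_gammaSec_I hz hT)
      (divClass_deltaSec (m := 3) hz rfl hT.2.2.2) ?_ ?_
    · simp [rhoAlpha]
    · simp [rhoSqrtBeta]
    · simp [rhoGamma]
    · simp [rhoDelta]
    all_goals norm_num

theorem tateCycleEq_I_su (hz : z.IsEquationOf i) {m : ℕ} (hm : 4 ≤ m)
    (hT : HasType i W z (.I m)) : TateCycleEq i W z ν (.I m) (.su m) := by
  rw [TateCycleEq, gammaSum_su _ _ _ hm]
  refine (tate_tensor_eq_two (a := rep .adj (.su m)) (f := rep .fund (.su m))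
    (g := rep .asym (.su m)) (p := 0) (q := 0) (r := 1) (d := 0)
    (p' := 0) (q' := 1) (r' := 0) (d' := 0) (u := 8) (v := -m) (u' := 1) (v' := 0) ?_ ?_ ?_ ?_
    (divClass_betaSec_I hz (by omega) hT) (divClass_gammaSec_I hz hT)
    (divClass_deltaSec (m := m) hz rfl hT.2.2.2) ?_ ?_ ?_ ?_).trans ?_
  · simp [rhoAlpha]
  · simp [rhoSqrtBeta, show m ≠ 2 by omega, show m ≠ 3 by omega]
  · simp [rhoGamma]
  · simp [rhoDelta]
  · norm_num
  · norm_num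
  · norm_num
  · norm_num
  · rw [one_smul, zero_smul, add_zero]

theorem tateCycleEq_I_sp (hz : z.IsEquationOf i) {m : ℕ} (hm : 4 ≤ m)
    (hT : HasType i W z (.I m)) : TateCycleEq i W z ν (.I m) (.sp (m / 2)) := by
  rw [TateCycleEq, gammaSum_sp]
  have hβ := divClass_betaSec_I hz (by omega) hT
  have hγ := divClass_gammaSec_I hz hT
  have hδ := divClass_deltaSec (T := .I m) (m := m) hz rfl hT.2.2.2
  rcases Nat.even_or_odd m with h | h
  · have hm2 : (m : ℚ) = 2 * (m / 2 : ℕ) := by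
      obtain ⟨n, rfl⟩ := h
      rw [← two_mul, Nat.mul_div_cancel_left _ two_pos]
      push_cast
      rfl
    refine tate_tensor_eq_two (p := 0) (q := 0) (r := 1) (d := 0)
      (p' := 1) (q' := 1) (r' := 0) (d' := 0) ?_ ?_ ?_ ?_ hβ hγ hδ ?_ ?_ ?_ ?_
    · simp [rhoAlpha, Nat.not_odd_iff_even.2 h]
    · simp [rhoSqrtBeta, Nat.not_odd_iff_even.2 h]
    · simp [rhoGamma]
    · simp [rhoDelta]
    · norm_num
    · linarith
    all_goals norm_num
  · have hm2 : (m : ℚ) = 2 * (m / 2 : ℕ) + 1 := by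
      obtain ⟨n, rfl⟩ := h
      rw [show (2 * n + 1) / 2 = n by omega]
      push_cast
      rfl
    refine tate_tensor_eq_two (p := 2) (q := 1) (r := 1) (d := 0)
      (p' := 1) (q' := 1) (r' := 0) (d' := 0) ?_ ?_ ?_ ?_ hβ hγ hδ ?_ ?_ ?_ ?_
    · simp [rhoAlpha, h, add_assoc, add_comm]
    · simp [rhoSqrtBeta, h, add_comm]
    · simp [rhoGamma]
    · simp [rhoDelta]
    · norm_num
    · linarith
    all_goals norm_num

theorem rhoAlpha_Istar_so (k l : ℕ) : rhoAlpha (.Istar k) (.so l) =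
    rep .adj (.so l) + (if Odd l then 1 else 0 : ℚ) • rep .vect (.so l) := by
  split_ifs with h <;> simp [rhoAlpha, h]

theorem tateCycleEq_Istar_one (hz : z.IsEquationOf i) (hT : HasType i W z (.Istar 1)) {l : ℕ}
    (hl : l = 9 ∨ l = 10) : TateCycleEq i W z ν (.Istar 1) (.so l) := by
  rw [TateCycleEq, gammaSum_so _ _ _ (by omega) (by omega)]
  refine tate_tensor_eq_two (p := if Odd l then 1 else 0) (q := 1) (r := 0)
    (d := 0) (p' := 0) (q' := 0) (r' := 1) (d' := 0)
    (by rw [rhoAlpha_Istar_so, zero_smul, add_zero]) ?_ ?_ ?_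
    (divClass_betaSec_Istar_odd (k := 0) hz (by decide) hT)
    (divClass_gammaSec_Istar (k := 0) hz hT) (divClass_deltaSec (m := 7) hz rfl hT.2.2) ?_ ?_ ?_ ?_
  · simp [rhoSqrtBeta]
  · simp [rhoGamma]
  · simp [rhoDelta]
  all_goals rcases hl with rfl | rfl <;> norm_num [show Odd 9 by decide, show ¬ Odd 10 by decide]

theorem tateCycleEq_Istar_two (hz : z.IsEquationOf i) (hT : HasType i W z (.Istar 2)) {l : ℕ}
    (hl : l = 11 ∨ l = 12) : TateCycleEq i W z ν (.Istar 2) (.so l) := by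
  rw [TateCycleEq, gammaSum_so _ _ _ (by omega) (by omega)]
  refine tate_tensor_eq_two (p := if Odd l then 1 else 0) (q := 1) (r := 0)
    (d := 0) (p' := 0) (q' := 0) (r' := 1 / 2) (d' := 0)
    (by rw [rhoAlpha_Istar_so, zero_smul, add_zero]) ?_ ?_ ?_
    (divClass_betaSec_Istar_even (k := 1) hz (by decide) hT)
    (divClass_gammaSec_Istar (k := 1) hz hT) (divClass_deltaSec (m := 8) hz rfl hT.2.2) ?_ ?_ ?_ ?_
  · simp [rhoSqrtBeta]
  · simp [rhoGamma]
  · simp [rhoDelta]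
  all_goals rcases hl with rfl | rfl <;> norm_num [show Odd 11 by decide, show ¬ Odd 12 by decide]

theorem tateCycleEq_Istar_three (hz : z.IsEquationOf i) (hT : HasType i W z (.Istar 3)) {l : ℕ}
    (hl : l = 13 ∨ l = 14) : TateCycleEq i W z ν (.Istar 3) (.so l) := by
  rw [TateCycleEq, gammaSum_so _ _ _ (by omega) (by omega)]
  refine tate_tensor_eq_two (p := if Odd l then 1 else 0) (q := 1) (r := 1)
    (d := 0) (p' := 0) (q' := 0) (r' := 1 / 4) (d' := 0)
    (by rw [rhoAlpha_Istar_so, zero_smul, add_zero]) ?_ ?_ ?_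
    (divClass_betaSec_Istar_odd (k := 2) hz (by decide) hT)
    (divClass_gammaSec_Istar (k := 2) hz hT) (divClass_deltaSec (m := 9) hz rfl hT.2.2) ?_ ?_ ?_ ?_
  · simp [rhoSqrtBeta]
  · simp [rhoGamma, add_comm]
  · simp [rhoDelta]
  all_goals rcases hl with rfl | rfl <;> norm_num [show Odd 13 by decide, show ¬ Odd 14 by decide]

/-- The relation Σ = 2L gives β the same class for both parities of k and merges the residue classes
in the table, so one computation covers all cases. -/
theorem tateCycleEq_Istar_of_four_le (hz : z.IsEquationOf i) {k : ℕ} (hk : 4 ≤ k)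
    (hT : HasType i W z (.Istar k)) (hσ : restrictClass i z = (2 : ℚ) • restrictClass i W.L)
    {l : ℕ} (hl : l = 2 * k + 7 ∨ l = 2 * k + 8) : TateCycleEq i W z ν (.Istar k) (.so l) := by
  obtain ⟨k, rfl⟩ : ∃ n, k = n + 4 := ⟨k - 4, by omega⟩
  have hβ : divClass (betaSec i W z (.Istar (k + 4))) =
      (-2 * (k + 4) : ℚ) • restrictClass i W.L + (0 : ℚ) • restrictClass i z := by
    by_cases h : Odd (k + 4)
    · rw [divClass_betaSec_Istar_odd (k := k + 3) hz h hT, hσ]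
      push_cast
      module
    · rw [divClass_betaSec_Istar_even (k := k + 3) hz h hT, hσ]
      push_cast
      module
  -- L and Σ are dependent here; this form is the one in which ρ_α contributes half of -L + Σ for
  -- odd `l` and div β the rest.
  have hv : gammaClass (restrictClass i W.L) (restrictClass i z) ν (.so l) .vect =
      (-(if Odd l then 1 else 0) / 2 - (k + 4) : ℚ) • restrictClass i W.L +
        ((if Odd l then 1 else 0) / 2 : ℚ) • restrictClass i z := by
    rw [hσ, gammaClass_so_large _ _ (by omega)]
    rcases hl with rfl | rfl
    · rw [if_pos ⟨k + 7, by ring⟩]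
      push_cast
      module
    · rw [if_neg (Nat.not_odd_iff_even.2 ⟨k + 8, by ring⟩)]
      push_cast
      module
  rw [TateCycleEq, gammaSum_so_large _ _ _ (by omega), hv]
  refine tate_tensor_eq_one (q := 1) (r := 0) (d := 0) (rhoAlpha_Istar_so _ _) ?_ ?_ ?_
    hβ (divClass_gammaSec_Istar (k := k + 3) hz hT)
    (divClass_deltaSec (m := k + 10) hz rfl hT.2.2) ?_ ?_
  · simp [rhoSqrtBeta]
  · simp [rhoGamma]
  · simp [rhoDelta]
  · ring
  · ring

end TateCycle

section Main

variable {B S : Scheme.{0}} [IsIntegral B] [IsIntegral S] [IsLocallyNoetherian S] {i : S ⟶ B}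
  {W : WeierstrassModel B} {z : CartierDivisor B} (ν : ℤˣ)

theorem restrictClass_eq_of_IIstar [IsClosedImmersion i]
    (hB : ∀ x : B, IsRegularLocalRing (B.presheaf.stalk x)) (hW : W.MinimalInCodimTwo)
    (hz : z.IsEquationOf i) (hT : HasType i W z .IIstar) :
    restrictClass i z = (6 / 5 : ℚ) • restrictClass i W.L := by
  have h := congrArg ((1 / 5 : ℚ) • ·) (six_smul_eq_of_IIstar hB hW hz hT.1 hT.2.1)
  simp only [smul_sub, smul_smul, smul_zero] at h
  rw [show (1 / 5 * 5 : ℚ) = 1 by norm_num, one_smul, sub_eq_zero] at h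
  rw [← h]
  norm_num

theorem restrictClass_eq_of_Istar [IsClosedImmersion i] (π : B ⟶ Spec (CommRingCat.of ℂ))
    (hB : ∀ x : B, IsRegularLocalRing (B.presheaf.stalk x)) (hW : W.MinimalInCodimTwo)
    (hz : z.IsEquationOf i) {k : ℕ} (hk : 4 ≤ k) (hT : HasType i W z (.Istar k)) :
    restrictClass i z = (2 : ℚ) • restrictClass i W.L := by
  obtain ⟨k, rfl⟩ : ∃ n, k = n + 4 := ⟨k - 4, by omega⟩
  obtain ⟨hf, hg, hΔ⟩ := hT
  have h := congrArg ((1 / 2 : ℚ) • ·) (four_smul_eq_of_Istar hB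
    (fun x => by simpa using isUnit_natCast_stalk π x (n := 2) (by norm_num))
    (fun x => by simpa using isUnit_natCast_stalk π x (n := 3) (by norm_num)) hW hz hf hg.1
    (hΔ.1.of_le hz (by omega)))
  simp only [smul_sub, smul_smul, smul_zero] at h
  rw [show (1 / 2 * 2 : ℚ) = 1 by norm_num, one_smul, sub_eq_zero] at h
  rw [← h]
  norm_num

/-- The Tate cycle equals the cycle of the classes `Γ_ρ`, and the latter has the expected traces. -/
theorem tateCycleEq_and_traceIdentities [IsClosedImmersion i] (π : B ⟶ Spec (CommRingCat.of ℂ))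
    (hB : ∀ x : B, IsRegularLocalRing (B.presheaf.stalk x)) (hW : W.MinimalInCodimTwo)
    (hz : z.IsEquationOf i) {T : KodairaType} (hT : HasType i W z T) :
    TateCycleEq i W z ν T (gaugeAlgebra i W z T) ∧
      TraceIdentities (restrictClass i W.L) (restrictClass i z) ν (gaugeAlgebra i W z T) := by
  have h0 : CharZero S.functionField := charZero_functionField (i ≫ π)
  match T, hT with
  | .I m, hT =>
    have hm := hT.1
    rw [gaugeAlgebra]
    split_ifs with h2 hsq h3
    · subst h2
      exact ⟨tateCycleEq_I_two ν hz hT, traceIdentities_su _ _ _ le_rfl⟩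
    · obtain rfl | h4 : m = 3 ∨ 4 ≤ m := by omega
      · exact ⟨tateCycleEq_I_three ν hz hT (.inr rfl), traceIdentities_su _ _ _ hm⟩
      · exact ⟨tateCycleEq_I_su ν hz h4 hT, traceIdentities_su _ _ _ hm⟩
    · subst h3
      exact ⟨tateCycleEq_I_three ν hz hT (.inl rfl), traceIdentities_su _ _ _ le_rfl⟩
    · exact ⟨tateCycleEq_I_sp ν hz (by omega) hT, traceIdentities_sp _ _ _ _⟩
  | .III, hT => exact ⟨tateCycleEq_III ν hz hT, traceIdentities_su _ _ _ le_rfl⟩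
  | .IV, hT =>
    rw [gaugeAlgebra]
    split_ifs
    · exact ⟨tateCycleEq_IV ν hz hT (.inr rfl), traceIdentities_su _ _ _ (by norm_num)⟩
    · exact ⟨tateCycleEq_IV ν hz hT (.inl rfl), traceIdentities_su _ _ _ le_rfl⟩
  | .Istar 0, hT =>
    rw [gaugeAlgebra]
    split_ifs
    · exact ⟨tateCycleEq_Istar_zero_g2 ν hz hT, traceIdentities_g2 _ _ _⟩
    · exact ⟨tateCycleEq_Istar_zero_so_eight ν hz hT, traceIdentities_so_eight _ _ _⟩
    · exact ⟨tateCycleEq_Istar_zero_so_seven ν hz hT,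
        traceIdentities_so_odd _ _ _ (by decide) (by norm_num)⟩
  | .Istar (k + 1), hT =>
    have key : ∀ l, l = 2 * (k + 1) + 7 ∨ l = 2 * (k + 1) + 8 →
        TateCycleEq i W z ν (.Istar (k + 1)) (.so l) ∧
          TraceIdentities (restrictClass i W.L) (restrictClass i z) ν (.so l) := by
      intro l hl
      -- From I_4^* on, Δ has order at least ten and the relation Σ = 2L is available. Below that
      -- the spinor terms make the identities formal in L and Σ.
      by_cases hk : 4 ≤ k + 1
      · have hσ := restrictClass_eq_of_Istar π hB hW hz hk hT
        refine ⟨tateCycleEq_Istar_of_four_le ν hz hk hT hσ hl, ?_⟩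
        rw [hσ]
        exact traceIdentities_so_large _ _ (by omega)
      · refine ⟨?_, ?_⟩
        · obtain rfl | rfl | rfl : k = 0 ∨ k = 1 ∨ k = 2 := by omega
          · exact tateCycleEq_Istar_one ν hz hT hl
          · exact tateCycleEq_Istar_two ν hz hT hl
          · exact tateCycleEq_Istar_three ν hz hT hl
        · by_cases h : Odd l
          · exact traceIdentities_so_odd _ _ _ h (by omega)
          · exact traceIdentities_so_even _ _ _ h
              (by rcases hl with rfl | rfl <;> grind) (by omega)
    rw [gaugeAlgebra]
    split_ifs
    · exact key _ (.inr rfl)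
    · exact key _ (.inl rfl)
  | .IVstar, hT =>
    rw [gaugeAlgebra]
    split_ifs
    · exact ⟨tateCycleEq_IVstar_e6 ν hz hT, traceIdentities_e6 _ _ _⟩
    · exact ⟨tateCycleEq_IVstar_f4 ν hz hT, traceIdentities_f4 _ _ _⟩
  | .IIIstar, hT => exact ⟨tateCycleEq_IIIstar ν hz hT, traceIdentities_e7 _ _ _⟩
  | .IIstar, hT =>
    refine ⟨tateCycleEq_IIstar ν hz hT, ?_⟩
    rw [restrictClass_eq_of_IIstar hB hW hz hT]
    exact traceIdentities_e8 _ _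

end Main

end FTheory

end

theorem mainTheorem3
    (B : Scheme.{0}) [IsIntegral B] (π : B ⟶ Spec (CommRingCat.of ℂ)) [IsSeparated π]
    [LocallyOfFiniteType π] [QuasiCompact π]
    (hB : ∀ x : B, IsRegularLocalRing (B.presheaf.stalk x))
    (W : FTheory.WeierstrassModel B) (hW : W.MinimalInCodimTwo)
    (S : Scheme.{0}) [IsIntegral S] [IsLocallyNoetherian S] (i : S ⟶ B) [IsClosedImmersion i]
    (z : FTheory.CartierDivisor B) (hz : z.IsEquationOf i)
    (T : FTheory.KodairaType) (hT : FTheory.HasType i W z T)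
    (𝔤 : FTheory.GaugeAlgebra) (h𝔤 : 𝔤 = FTheory.gaugeAlgebra i W z T) (ν : ℤˣ) :
    FTheory.tateCycle i W z ν T 𝔤 =
      ∑ ρ : FTheory.RepName,
        FTheory.gammaClass (FTheory.restrictClass i W.L) (FTheory.restrictClass i z) ν 𝔤 ρ
          ⊗ₜ[ℚ] FTheory.rep ρ 𝔤 ∧
    FTheory.Xop (FTheory.Chow1 S) 2 𝔤 (FTheory.tateCycle i W z ν T 𝔤) =
      ((6 : ℚ) • FTheory.restrictClass i W.L) ⊗ₜ[ℚ] FTheory.normTr2 𝔤 ∧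
    FTheory.Xop (FTheory.Chow1 S) 4 𝔤 (FTheory.tateCycle i W z ν T 𝔤) =
      ((3 : ℚ) • FTheory.restrictClass i z) ⊗ₜ[ℚ] (FTheory.normTr2 𝔤 ^ 2) := by
  subst h𝔤
  obtain ⟨h1, h2, h3⟩ := FTheory.tateCycleEq_and_traceIdentities ν π hB hW hz hT
  rw [FTheory.TateCycleEq] at h1
  rw [h1]
  exact ⟨rfl, h2, h3⟩
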